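/- **Setting.** Let $(M,\rho)$ be a metric space all of whose closed bounded subsets are compact (so $M$ is complete, separable and locally compact), with Borel $\sigma$-field $\mathcal B(M)$. Assume that $M$ is a *metric graph*: there are a countable set $V\subset M$ (vertices) and a partition $\mathcal E$ of $M\setminus V$ (edges) such that every $E\in\mathcal E$ is open in $M$ and isometric to an interval $(0,L_E)$, $0<L_E\le\infty$, and for every $v\in V$ the set $J(v)=\{E\in\mathcal E: v\in\partial E\}$ is non-empty and finite and $\{v\}\cup\bigcup_{E\in J(v)}E$ is a neighbourhood of $v$. A *simple compact set* is the closure of a bounded connected open set $O\subset M$ that contains at most one vertex and satisfies $\partial O\cap V=\emptyset$. For every $n\in\mathbb N$ let $\mathsf P^{(n)}=(\mathsf P^{(n)}_t)_{t\ge0}$ be a Feller transition function on $M^n$, that is, a semigroup of probability kernels acting as a strongly continuous semigroup on $C_0(M^n)$. Where it exists, let $\mathbb P^{(n)}_x$ be the (unique) law on $C([0,\infty):M^n)$ under which the canonical process is a Markov process with transition function $\mathsf P^{(n)}$ started at $x$ (it exists under (TF1) and (TF3) below); for $n=2$ the canonical process is written $(X,Y)$. Assume: * (TF1) for distinct $i_1,\dots,i_k\in\{1,\dots,n\}$,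 $t\ge 0$, $x\in M^n$, $B\in\mathcal B(M^k)$: $\mathsf P^{(n)}_t(x,\pi^{-1}_{i_1,\dots,i_k}B)=\mathsf P^{(k)}_t(\pi_{i_1,\dots,i_k}x,B)$, where $\pi_{i_1,\dots,i_k}x=(x_{i_1},\dots,x_{i_k})$; * (TF2) $\mathsf P^{(2)}_t((x,x),\Delta)=1$ for all $x\in M$, $t\ge0$, where $\Delta$ is the diagonal of $M^2$; * (TF3) for every compact $K\subset M$ and $r>0$: $\lim_{t\downarrow0}t^{-1}\sup_{x\in K}\mathsf P^{(1)}_t(x,\{y:\rho(x,y)>r\})=0$; * (TF5) for every simple compact $K\subset M$ there are $\beta,p>0$ such that for all $(x,y)\in K^2$ and $\varepsilon>0$ with $\rho(x,y)\le\varepsilon$, $$\mathbb P^{(2)}_{(x,y)}[\sigma\wedge\tau>\beta\varepsilon^2]\le 1-p,\qquad \sigma=\inf\{t:(X_t,Y_t)\notin K^2\},\quad \tau=\inf\{t:X_t=Y_t\}.$$ **The flow $\psi^0$.** Let $F$ be the space of measurable maps $M\to M$ with the cylindrical $\sigma$-field, and let $\psi^0=(\psi^0_{s,t})_{s\le t}$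 be a stochastic flow of measurable mappings associated with $(\mathsf P^{(n)})_n$: random elements of $F$ on a probability space $(\Omega,\mathcal A,\mathbb P)$ such that * $\mathbb E f(\psi^0_{s,t}(x_1),\dots,\psi^0_{s,t}(x_n))=\mathsf P^{(n)}_{t-s}f(x)$ for all $s\le t$, $n$, $x\in M^n$, $f\in C_0(M^n)$; * there are measurable maps $\mathcal J_t:F\times M\to M$, $t\ge0$, such that for all $s\le t\le u$ and $x\in M$: $\mathcal J_{t-s}(\psi^0_{s,t})(x)=\psi^0_{s,t}(x)$ a.s., $\psi^0_{s,u}(x)=\mathcal J_{u-t}(\psi^0_{t,u})(\psi^0_{s,t}(x))$ a.s., and $\psi^0_{s,s}(x)=x$; * for $t_1\le\dots\le t_n$ the random mappings $\psi^0_{t_i,t_{i+1}}$, $1\le i\le n-1$, are independent; * for $f\in C_0(M)$ and $s\le t$: $\sup_{x\in M}\mathbb E[(f(\psi^0_{u,v}(x))-f(\psi^0_{s,t}(x)))^2]\to0$ as $(u,v)\to(s,t)$, $u\le v$; * for $f\in C_0(M)$, $x\in M$, $s\le t$: $\mathbb E[(f(\psi^0_{s,t}(y))-f(\psi^0_{s,t}(x)))^2]\to0$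 as $y\to x$, and $\mathbb E[f(\psi^0_{s,t}(y))^2]\to0$ as $y\to\infty$. **Paths and skeletons.** Let $X=\bigcup_{s\in\mathbb R}C([s,\infty):M)$. For $f\in X$ let $i(f)$ be its starting time and $e(f)(t)=f(t\vee i(f))$, $t\in\mathbb R$. Let $\delta$ be a metric on $C(\mathbb R:M)$ inducing the topology of uniform convergence on compact sets, give $X$ the metric $d(f,g)=|i(f)-i(g)|+\delta(e(f),e(g))$ and its Borel $\sigma$-field, and let $d_0$ be the restriction of $d$ to $C([0,\infty):M)$. For $f\in X$ let $f[s,\infty)$ be the restriction of $e(f)$ to $[s,\infty)$. A sequence $\varphi\in X^{\mathbb N}$, with $s_n=i(\varphi_n)$, is a *skeleton* if: $\varphi_m(s)=\varphi_n(s)$ with $s\ge s_m\vee s_n$ implies $\varphi_m=\varphi_n$ on $[s,\infty)$; $\{(s_n,\varphi_n(s_n))\}$ is dense in $\mathbb R\times M$; and for every compact $L\subset\mathbb R\times M$ the set of all $\varphi_n[s,\infty)$ with $s_n\le s$ and $(s,\varphi_n(s))\in L$ is relatively compact in $X$. **The family $\theta$.** Let $((s_n,x_n))_{n\in\mathbb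 N}$ be a dense sequence in $\mathbb R\times M$, and let $\varPhi=(\varPhi_n)_n$ be a random element of $X^{\mathbb N}$ such that $\varPhi_n\in C([s_n,\infty):M)$ is a continuous modification of $\psi^0_{s_n,\cdot}(x_n)$ with $\varPhi_n(s_n)=x_n$. Let $\ell:X^{\mathbb N}\to X$ be a measurable map sending every relatively compact sequence to one of its limit points. Put $$\varepsilon_k(x)=2^{-k}\wedge\inf\Big\{r>0:\ \sup_{y:\rho(x,y)\le r}\mathbb P^{(2)}_{(x,y)}[d_0(X,Y)\ge2^{-k}]>2^{-k}\Big\},$$ $$n^{s,x}_k=\inf\{n: s_n\le s,\ \rho(\varPhi_n(s),x)<\varepsilon_k(x)\},\qquad \theta_{s,t}(x)=\ell\Big(\big(\varPhi_{n^{s,x}_k}[s,\infty)\big)_{k\in\mathbb N}\Big)(t),\quad s\le t.$$ **Claim.** Almost surely $\varPhi$ is a skeleton, and $\theta$ is a strong measurable continuous modification of $\psi^0$, after restriction to an event of full probability. That is, there is $\Omega_0\in\mathcal A$ with $\mathbb P(\Omega_0)=1$ such that $\varPhi(\omega)$ is a skeleton for all $\omega\in\Omega_0$ and, on the probability space $\Omega_0$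 (with the restrictions of $\mathcal A$ and $\mathbb P$): * the $\theta_{s,t}$, $s\le t$, are random elements of $F$, and $(s,t,x,\omega)\mapsto\theta_{s,t}(\omega,x)$ is measurable on $\{s\le t\}\times M\times\Omega_0$; * $\theta_{s,s}(\omega,x)=x$ and $t\mapsto\theta_{s,t}(\omega,x)$ is continuous on $[s,\infty)$, for all $s\in\mathbb R$, $x\in M$, $\omega\in\Omega_0$; * $\mathbb P[\theta_{s,t}(x)=\psi^0_{s,t}(x)]=1$ for all $s\le t$, $x\in M$; * $\theta_{s,u}(\omega,\cdot)=\theta_{t,u}(\omega,\cdot)\circ\theta_{s,t}(\omega,\cdot)$ for all $s\le t\le u$ and $\omega\in\Omega_0$. -/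

import Mathlib

open MeasureTheory ProbabilityTheory Filter Topology Set
open scoped NNReal ENNReal ZeroAtInfty

noncomputable section

namespace CoalescingFlow

/-! ### Metric graphs -/

/-- `M` is a metric graph with vertex set `V` and set of edges `𝓔`. -/
structure IsMetricGraph {M : Type*} [MetricSpace M] (V : Set M) (𝓔 : Set (Set M)) : Prop where
  countable_vertices : V.Countable
  pairwise_disjoint : 𝓔.PairwiseDisjoint id
  sUnion_edges : ⋃₀ 𝓔 = Vᶜ
  isOpen_edge : ∀ E ∈ 𝓔, IsOpen E
  /-- every edge is isometric to an interval `(0, L)` with `0 < L ≤ ∞` -/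
  edge_isometry : ∀ E ∈ 𝓔, ∃ L : EReal, 0 < L ∧
    ∃ e : {t : ℝ // 0 < t ∧ (t : EReal) < L} → M, Isometry e ∧ range e = E
  adjacent_nonempty : ∀ v ∈ V, {E ∈ 𝓔 | v ∈ frontier E}.Nonempty
  adjacent_finite : ∀ v ∈ V, {E ∈ 𝓔 | v ∈ frontier E}.Finite
  star_mem_nhds : ∀ v ∈ V, {v} ∪ ⋃₀ {E ∈ 𝓔 | v ∈ frontier E} ∈ 𝓝 v

/-- Simple open sets: bounded connected open sets that contain at most one vertex and have no
vertex on the boundary. -/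
structure IsSimpleOpen {M : Type*} [MetricSpace M] (V : Set M) (O : Set M) : Prop where
  bounded : Bornology.IsBounded O
  connected : IsConnected O
  isOpen : IsOpen O
  subsingleton : (O ∩ V).Subsingleton
  frontier_inter : frontier O ∩ V = ∅

/-- Simple compact sets: closures of simple open sets. -/
def IsSimpleCompact {M : Type*} [MetricSpace M] (V : Set M) (K : Set M) : Prop :=
  ∃ O, IsSimpleOpen V O ∧ K = closure O

/-! ### Transition functions -/

/-- Feller transition functions: Markovian semigroups of probability kernels which act as a
strongly continuous semigroup on `C₀(E)`. -/
structure IsFellerTransition {E : Type*} [TopologicalSpace E] [MeasurableSpace E]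
    (P : ℝ≥0 → Kernel E E) : Prop where
  markov : ∀ t, IsMarkovKernel (P t)
  zero : P 0 = Kernel.id
  semigroup : ∀ s t, P (s + t) = P t ∘ₖ P s
  maps_C0 : ∀ (t : ℝ≥0) (f : C₀(E, ℝ)), ∃ g : C₀(E, ℝ), ∀ x, ∫ y, f y ∂(P t x) = g x
  strongly_continuous : ∀ f : C₀(E, ℝ),
    TendstoUniformly (fun (t : ℝ≥0) x => ∫ y, f y ∂(P t x)) f (𝓝[>] 0)

section Transition

variable {M : Type*} [MetricSpace M] [MeasurableSpace M]

/-- (TF1): consistency of the sequence of transition functions. -/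
def TF1 (P : (n : ℕ) → ℝ≥0 → Kernel (Fin n → M) (Fin n → M)) : Prop :=
  ∀ (n k : ℕ) (i : Fin k → Fin n), Function.Injective i →
    ∀ (t : ℝ≥0) (x : Fin n → M) (B : Set (Fin k → M)), MeasurableSet B →
      P n t x ((fun y : Fin n → M => y ∘ i) ⁻¹' B) = P k t (x ∘ i) B

/-- (TF2): the coalescing property. -/
def TF2 (P : (n : ℕ) → ℝ≥0 → Kernel (Fin n → M) (Fin n → M)) : Prop :=
  ∀ (x : M) (t : ℝ≥0), P 2 t ![x, x] {y | y 0 = y 1} = 1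

/-- (TF3): the condition that ensures continuity of trajectories. -/
def TF3 (P : (n : ℕ) → ℝ≥0 → Kernel (Fin n → M) (Fin n → M)) : Prop :=
  ∀ K : Set M, IsCompact K → ∀ r : ℝ, 0 < r →
    Tendsto (fun t : ℝ≥0 => (t : ℝ≥0∞)⁻¹ * ⨆ x ∈ K, P 1 t (fun _ => x) {y | r < dist x (y 0)})
      (𝓝[>] 0) (𝓝 0)

end Transition

/-! ### Laws of Markov processes on the space of continuous trajectories -/

instance {E : Type*} [TopologicalSpace E] : MeasurableSpace C(ℝ≥0, E) := borel _

instance {E : Type*} [TopologicalSpace E] : BorelSpace C(ℝ≥0, E) := ⟨rfl⟩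

/-- `Q` is a law on `C([0,∞), E)` under which the canonical process is a Markov process (in its
natural filtration) with transition function `P`, started at `x`. -/
structure IsMarkovLaw {E : Type*} [TopologicalSpace E] [MeasurableSpace E]
    (P : ℝ≥0 → Kernel E E) (x : E) (Q : Measure C(ℝ≥0, E)) : Prop where
  prob : IsProbabilityMeasure Q
  start : ∀ᵐ w ∂Q, w 0 = x
  markov : ∀ (s t : ℝ≥0) (A : Set C(ℝ≥0, E)) (B : Set E),
    MeasurableSet[⨆ r : Iic s, MeasurableSpace.comap (fun w : C(ℝ≥0, E) => w r) inferInstance] A →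
    MeasurableSet B →
    Q (A ∩ {w | w (s + t) ∈ B}) = ∫⁻ w in A, P t (w s) B ∂Q

open Classical in
/-- The law `ℙ_x` on `C([0,∞), E)` of the Markov process with transition function `P` and starting
point `x` (it is unique when it exists). -/
def markovLaw {E : Type*} [TopologicalSpace E] [MeasurableSpace E]
    (P : ℝ≥0 → Kernel E E) (x : E) : Measure C(ℝ≥0, E) :=
  if h : ∃ Q, IsMarkovLaw P x Q then h.choose else 0

section Two

variable {M : Type*} [MetricSpace M] [MeasurableSpace M]

/-- `σ`, the first time at which the two-point process is not in `K²` (`∞` if there is none). -/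
def exitTime (K : Set M) (w : C(ℝ≥0, Fin 2 → M)) : ℝ≥0∞ :=
  ⨅ (t : ℝ≥0) (_ : ¬ (w t 0 ∈ K ∧ w t 1 ∈ K)), (t : ℝ≥0∞)

/-- `τ`, the first meeting time of the two-point process (`∞` if there is none). -/
def meetingTime (w : C(ℝ≥0, Fin 2 → M)) : ℝ≥0∞ :=
  ⨅ (t : ℝ≥0) (_ : w t 0 = w t 1), (t : ℝ≥0∞)

/-- (TF5): the meeting-time condition, on a metric graph with vertex set `V`. -/
def TF5 (V : Set M) (P : (n : ℕ) → ℝ≥0 → Kernel (Fin n → M) (Fin n → M)) : Prop :=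
  ∀ K : Set M, IsSimpleCompact V K → ∃ β p : ℝ, 0 < β ∧ 0 < p ∧
    ∀ x ∈ K, ∀ y ∈ K, ∀ ε : ℝ, 0 < ε → dist x y ≤ ε →
      (markovLaw (P 2) ![x, y]).real
        {w | ENNReal.ofReal (β * ε ^ 2) < min (exitTime K w) (meetingTime w)} ≤ 1 - p

end Two

/-! ### Stochastic flows of measurable mappings -/

/-- The space `F` of measurable mappings of `M`; the subtype `σ`-field is the cylindrical one. -/
abbrev MeasMap (M : Type*) [MeasurableSpace M] : Type _ := {f : M → M // Measurable f}

/-- Stochastic flows of measurable mappings of `M` associated with the transition functions `P`.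
Only the values `ψ s t` with `s ≤ t` are meaningful. -/
structure IsStochasticFlow {M : Type*} [MetricSpace M] [MeasurableSpace M]
    (P : (n : ℕ) → ℝ≥0 → Kernel (Fin n → M) (Fin n → M))
    {Ω : Type*} [MeasurableSpace Ω] (μ : Measure Ω) (ψ : ℝ → ℝ → Ω → MeasMap M) : Prop where
  measurable : ∀ s t, s ≤ t → Measurable (ψ s t)
  finite_point_motion : ∀ s t, s ≤ t → ∀ (n : ℕ) (x : Fin n → M) (f : C₀(Fin n → M, ℝ)),
    ∫ ω, f (fun i => (ψ s t ω).1 (x i)) ∂μ = ∫ y, f y ∂(P n (t - s).toNNReal x)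
  flow : ∃ J : ℝ≥0 → MeasMap M × M → M, (∀ t, Measurable (J t)) ∧
    ∀ s t u, s ≤ t → t ≤ u → ∀ x : M,
      (∀ᵐ ω ∂μ, J (t - s).toNNReal (ψ s t ω, x) = (ψ s t ω).1 x) ∧
      (∀ᵐ ω ∂μ, (ψ s u ω).1 x = J (u - t).toNNReal (ψ t u ω, (ψ s t ω).1 x))
  refl : ∀ s ω x, (ψ s s ω).1 x = x
  indep : ∀ (m : ℕ) (t : Fin (m + 1) → ℝ), Monotone t →
    iIndepFun (fun i : Fin m => ψ (t i.castSucc) (t i.succ)) μ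
  time_continuity : ∀ (f : C₀(M, ℝ)) (s t : ℝ), s ≤ t →
    TendstoUniformly
      (fun (q : ℝ × ℝ) (x : M) => ∫ ω, (f ((ψ q.1 q.2 ω).1 x) - f ((ψ s t ω).1 x)) ^ 2 ∂μ)
      (fun _ => 0) (𝓝[{q : ℝ × ℝ | q.1 ≤ q.2}] (s, t))
  space_continuity : ∀ (f : C₀(M, ℝ)) (x : M) (s t : ℝ), s ≤ t →
    Tendsto (fun y => ∫ ω, (f ((ψ s t ω).1 y) - f ((ψ s t ω).1 x)) ^ 2 ∂μ) (𝓝 x) (𝓝 0)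
  vanishing : ∀ (f : C₀(M, ℝ)) (s t : ℝ), s ≤ t →
    Tendsto (fun y => ∫ ω, (f ((ψ s t ω).1 y)) ^ 2 ∂μ) (cocompact M) (𝓝 0)

/-- `ψ'` is a strong measurable continuous modification of the flow `ψ`. -/
structure IsStrongMeasurableContinuousModification {M : Type*} [MetricSpace M] [MeasurableSpace M]
    {Ω : Type*} [MeasurableSpace Ω] (μ : Measure Ω)
    (ψ : ℝ → ℝ → Ω → MeasMap M) (ψ' : ℝ → ℝ → Ω → M → M) : Prop where
  /-- the `ψ' s t` are random elements of the space of measurable mappings -/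
  measurable_map : ∀ s t, s ≤ t → ∀ ω, Measurable (ψ' s t ω)
  random_element : ∀ s t, s ≤ t → ∀ x, Measurable (fun ω => ψ' s t ω x)
  refl : ∀ s ω x, ψ' s s ω x = x
  modification : ∀ s t, s ≤ t → ∀ x, ∀ᵐ ω ∂μ, ψ' s t ω x = (ψ s t ω).1 x
  jointly_measurable :
    Measurable (fun q : {r : ℝ × ℝ // r.1 ≤ r.2} × M × Ω => ψ' q.1.1.1 q.1.1.2 q.2.2 q.2.1)
  continuous_trajectories : ∀ s x ω, ContinuousOn (fun t => ψ' s t ω x) (Ici s)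
  strong_flow : ∀ s t u, s ≤ t → t ≤ u → ∀ ω, ψ' s u ω = ψ' t u ω ∘ ψ' s t ω

/-! ### The space of continuous paths and skeletons -/

/-- The space `X` of continuous paths `f : [s, ∞) → M`, `s ∈ ℝ`. A path is recorded by its starting
time `i(f) = s` and its continuous extension `e(f) : ℝ → M`, constant on `(-∞, s]`. -/
structure PathSpace (M : Type*) [TopologicalSpace M] where
  /-- the starting time `i(f)` -/
  start : ℝ
  /-- the extension `e(f)` -/
  toMap : C(ℝ, M)
  const_left : ∀ t ≤ start, toMap t = toMap start

namespace PathSpace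

variable {M : Type*} [TopologicalSpace M]

/-- The topology of `X`, induced by `f ↦ (i(f), e(f))`, where `C(ℝ, M)` carries the topology of
uniform convergence on compact sets. -/
instance : TopologicalSpace (PathSpace M) :=
  TopologicalSpace.induced (fun f => (f.start, f.toMap)) inferInstance

instance : MeasurableSpace (PathSpace M) := borel _

instance : BorelSpace (PathSpace M) := ⟨rfl⟩

/-- The restriction `f[s, ∞)` of `e(f)` to `[s, ∞)`, as a path started at time `s`. -/
def restrict (f : PathSpace M) (s : ℝ) : PathSpace M where
  start := s
  toMap := ⟨fun t => f.toMap (max s t), by fun_prop⟩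
  const_left t ht := by simp [max_eq_left ht]

end PathSpace

/-- Skeletons: sequences of paths that satisfy (Sk1), (Sk2) and (Sk3). -/
structure IsSkeleton {M : Type*} [TopologicalSpace M] (φ : ℕ → PathSpace M) : Prop where
  coalescence : ∀ (s : ℝ) (m n : ℕ), (φ m).start ≤ s → (φ n).start ≤ s →
    (φ m).toMap s = (φ n).toMap s → ∀ t, s ≤ t → (φ m).toMap t = (φ n).toMap t
  dense : DenseRange (fun n => ((φ n).start, (φ n).toMap (φ n).start))
  relatively_compact : ∀ L : Set (ℝ × M), IsCompact L →
    IsCompact (closure {f : PathSpace M | ∃ (n : ℕ) (s : ℝ),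
      (φ n).start ≤ s ∧ (s, (φ n).toMap s) ∈ L ∧ f = (φ n).restrict s})

/-- `δ` is a distance on `C(ℝ, M)` which induces the topology of uniform convergence on compact
sets. -/
def IsCompactOpenDist {M : Type*} [TopologicalSpace M] (δ : C(ℝ, M) → C(ℝ, M) → ℝ) : Prop :=
  ∃ m : MetricSpace C(ℝ, M), (∀ f g, m.dist f g = δ f g) ∧
    m.toPseudoMetricSpace.toUniformSpace.toTopologicalSpace = ContinuousMap.compactOpen

/-- `ℓ : X^ℕ → X` is a measurable map that sends every relatively compact sequence to one of its
limit points. -/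
def IsLimitPointSelection {X : Type*} [TopologicalSpace X] [MeasurableSpace X]
    (ℓ : (ℕ → X) → X) : Prop :=
  Measurable ℓ ∧ ∀ f : ℕ → X, IsCompact (closure (range f)) → MapClusterPt (ℓ f) atTop f

/-! ### The family `θ` -/

section Theta

variable {M : Type*} [MetricSpace M]

/-- The extension `e(·)` of the `i`-th coordinate of a trajectory in `C([0,∞), Mⁿ)` to `ℝ`. -/
def coordPath {n : ℕ} (w : C(ℝ≥0, Fin n → M)) (i : Fin n) : C(ℝ, M) :=
  ⟨fun t => w t.toNNReal i, by fun_prop⟩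

/-- The functions `ε_k`:
`ε_k(x) = 2⁻ᵏ ∧ inf {r > 0 : sup_{y ∈ B̄(x,r)} ℙ_{(x,y)}[d₀(X,Y) ≥ 2⁻ᵏ] > 2⁻ᵏ}`, where
`d₀` is the distance of paths started at time `0` that is given by `δ`. -/
def epsilonSeq [MeasurableSpace M] (δ : C(ℝ, M) → C(ℝ, M) → ℝ)
    (P : (n : ℕ) → ℝ≥0 → Kernel (Fin n → M) (Fin n → M)) (k : ℕ) (x : M) : ℝ≥0∞ :=
  min ((2 : ℝ≥0∞)⁻¹ ^ k)
    (⨅ (r : ℝ) (_ : 0 < r ∧ (2 : ℝ≥0∞)⁻¹ ^ k < ⨆ y ∈ Metric.closedBall x r,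
      markovLaw (P 2) ![x, y]
        {w | (2 : ℝ)⁻¹ ^ k ≤ δ (coordPath w 0) (coordPath w 1)}), ENNReal.ofReal r)

/-- The index `n_k^{s,x} = inf {n : s_n ≤ s, ρ(φ_n(s), x) < ε_k(x)}`. -/
def approxIndex (ε : ℕ → M → ℝ≥0∞) (φ : ℕ → PathSpace M) (s : ℝ) (x : M) (k : ℕ) : ℕ :=
  sInf {n | (φ n).start ≤ s ∧ edist ((φ n).toMap s) x < ε k x}

/-- `Θ(s, x, φ) = ℓ((φ_{n_k^{s,x}}[s, ∞))_k)`. -/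
def Theta (ℓ : (ℕ → PathSpace M) → PathSpace M) (ε : ℕ → M → ℝ≥0∞)
    (s : ℝ) (x : M) (φ : ℕ → PathSpace M) : PathSpace M :=
  ℓ (fun k => (φ (approxIndex ε φ s x k)).restrict s)

/-- The random mappings `θ_{s,t}(ω, x) = Θ(s, x, Φ(ω))(t)`. -/
def theta [MeasurableSpace M] (δ : C(ℝ, M) → C(ℝ, M) → ℝ)
    (P : (n : ℕ) → ℝ≥0 → Kernel (Fin n → M) (Fin n → M))
    (ℓ : (ℕ → PathSpace M) → PathSpace M) {Ω : Type*} (Φ : Ω → ℕ → PathSpace M)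
    (s t : ℝ) (ω : Ω) (x : M) : M :=
  (Theta ℓ (epsilonSeq δ P) s x (Φ ω)).toMap t

/-- `Φ` is the random sequence of paths built from the flow `ψ` and the sequence
`D n = (s_n, x_n)`: `Φ_n` is a continuous modification of `ψ_{s_n,·}(x_n)` with
`Φ_n(s_n) = x_n`. -/
structure IsContinuousSequence [MeasurableSpace M] {Ω : Type*} [MeasurableSpace Ω] (μ : Measure Ω)
    (ψ : ℝ → ℝ → Ω → MeasMap M) (D : ℕ → ℝ × M) (Φ : Ω → ℕ → PathSpace M) : Prop where
  measurable : Measurable Φ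
  start_eq : ∀ ω n, (Φ ω n).start = (D n).1
  initial : ∀ ω n, (Φ ω n).toMap (D n).1 = (D n).2
  modification : ∀ (n : ℕ) (t : ℝ), (D n).1 ≤ t →
    ∀ᵐ ω ∂μ, (Φ ω n).toMap t = (ψ (D n).1 t ω).1 (D n).2

end Theta

end CoalescingFlow

end

/-! The main work is to show that, off a null set, the countable family `Φ` is tame (`IsTame`):
paths that meet stay together; the paths are equicontinuous, locally uniformly in time and place;
their starting points are dense; and the paths that remain in a suitable neighbourhood of a point
throughout [s, t] occupy only finitely many positions at time t. The assertions that hold for all s,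
t, x at once are then deduced path by path.

The probabilistic tool is an Ottaviani inequality for Markov processes observed along countably many
times (`IsMarkov.first_entry_le_two_mul`). Combined with path continuity it replaces the strong
Markov property. With (TF3) it yields continuous versions and the bound o(h) for the probability of
a displacement within time h. A related first-entry bound, with (TF2), yields coalescence
(`IsVersionFamily.ae_coalescence`).

Equicontinuity rests on one-dimensionality. Every point has a neighbourhood which is a star of
finitely many arms. On each arm some path of the family stands guard for a short while, and a path
that starts closer to the centre can pass a guard only by meeting it, after which the two coincide
(`IsStar.dist_le_of_trap`, `IsVersionFamily.ae_locally_equicontinuous`).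

Finiteness is a counting argument. Count one representative for each occupied position in a star. At
scale ε the star has O(1/ε) cells, so all but O(1/ε) representatives can be paired within distance
ε, and by (TF5) each pair loses a member with probability at least p within a time of order ε². Thus
the expected number is multiplied by 1 - p/2, up to an error O(1/ε). With scales shrinking
geometrically towards s the times add up to at most t - s and the errors remain summable, so the
bound does not depend on how many paths are counted
(`IsVersionFamily.exists_lintegral_card_reps_le`).

Tameness gives the skeleton property by Arzelà–Ascoli. After any t > s, a limit point of
approximating paths agrees with a single path of the family (`IsTame.exists_Theta_eq`), and Θ
restarted on such a path follows it (`IsTame.Theta_apply`); this is the flow identity. That θ is a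
modification follows from Borel–Cantelli, because ε_k(x) bounds by 2⁻ᵏ the probability that the k-th
approximating path is 2⁻ᵏ away from the trajectory of x. Positivity and measurability of ε_k come
from upper semicontinuity of that probability in the pair of starting points. -/

open MeasureTheory ProbabilityTheory Filter Topology Set
open scoped NNReal ENNReal ZeroAtInfty

set_option linter.unusedSectionVars false

noncomputable section

namespace CoalescingFlow

/-! ### Local structure of metric graphs -/

section Stars

variable {M : Type*} [MetricSpace M]

/-- The closed ball of radius `R` about `x` is covered by the finitely many isometric arms `γ i`,
which issue from `x` and meet only there. -/
structure IsStar (x : M) (R : ℝ) {N : ℕ} (γ : Fin N → ℝ → M) : Prop where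
  pos : 0 < R
  isom : ∀ i, ∀ t ∈ Icc 0 R, ∀ u ∈ Icc 0 R, dist (γ i t) (γ i u) = |t - u|
  zero : ∀ i, γ i 0 = x
  cover : Metric.closedBall x R ⊆ ⋃ i, γ i '' Icc 0 R
  disj : ∀ i j, ∀ t ∈ Ioc 0 R, ∀ u ∈ Ioc 0 R, γ i t = γ j u → i = j

namespace IsStar

variable {x : M} {R : ℝ} {N : ℕ} {γ : Fin N → ℝ → M}

lemma dist_arm (h : IsStar x R γ) (i : Fin N) {t : ℝ} (ht : t ∈ Icc 0 R) :
    dist x (γ i t) = t := by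
  rw [← h.zero i, h.isom i 0 ⟨le_rfl, h.pos.le⟩ t ht]
  simp [abs_of_nonneg ht.1]

lemma continuousOn (h : IsStar x R γ) (i : Fin N) : ContinuousOn (γ i) (Icc 0 R) := by
  rw [Metric.continuousOn_iff]
  intro b hb ε hε
  refine ⟨ε, hε, fun a ha hab => ?_⟩
  rw [h.isom i a ha b hb]
  exact hab

lemma isCompact_arm (h : IsStar x R γ) (i : Fin N) : IsCompact (γ i '' Icc 0 R) :=
  isCompact_Icc.image_of_continuousOn (h.continuousOn i)

lemma isConnected_ball (h : IsStar x R γ) : IsConnected (Metric.ball x R) := by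
  refine ⟨⟨x, Metric.mem_ball_self h.pos⟩, isPreconnected_of_forall x fun y hy => ?_⟩
  obtain ⟨i, t, ht, rfl⟩ := mem_iUnion.1 (h.cover (Metric.ball_subset_closedBall hy))
  rw [Metric.mem_ball', h.dist_arm i ht] at hy
  refine ⟨γ i '' Icc 0 t, ?_, ⟨0, ⟨le_rfl, ht.1⟩, h.zero i⟩, ⟨t, ⟨ht.1, le_rfl⟩, rfl⟩, ?_⟩
  · rintro _ ⟨u, hu, rfl⟩
    rw [Metric.mem_ball', h.dist_arm i ⟨hu.1, hu.2.trans ht.2⟩]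
    exact hu.2.trans_lt hy
  · exact isPreconnected_Icc.image _
      ((h.continuousOn i).mono (Icc_subset_Icc_right ht.2))

/-- This makes (TF5) applicable. A vertex in the closed ball can only be the centre, which is an
interior point of the ball, so no vertex lies on the frontier. -/
lemma isSimpleCompact (h : IsStar x R γ) {V : Set M} (hV : Metric.closedBall x R ∩ V ⊆ {x}) :
    IsSimpleCompact V (closure (Metric.ball x R)) := by
  refine ⟨Metric.ball x R, ⟨Metric.isBounded_ball, h.isConnected_ball, Metric.isOpen_ball, ?_, ?_⟩,
    rfl⟩
  · intro y hy z hz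
    have hy' := hV ⟨Metric.ball_subset_closedBall hy.1, hy.2⟩
    have hz' := hV ⟨Metric.ball_subset_closedBall hz.1, hz.2⟩
    rw [mem_singleton_iff.1 hy', mem_singleton_iff.1 hz']
  · refine eq_empty_of_forall_notMem fun y hy => ?_
    have hy' := hV ⟨Metric.closure_ball_subset_closedBall hy.1.1, hy.2⟩
    rw [mem_singleton_iff] at hy'
    subst hy'
    apply hy.1.2
    rw [Metric.isOpen_ball.interior_eq]
    exact Metric.mem_ball_self h.pos

/-- The number of balls of radius `ε` needed to cover a star is of order `ε⁻¹`. -/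
lemma exists_net (h : IsStar x R γ) : ∃ C : ℝ, 0 < C ∧ ∀ ε : ℝ, 0 < ε → ε ≤ 1 →
    ∃ F : Finset M, (F.card : ℝ) ≤ C / ε ∧ ∀ y ∈ Metric.closedBall x R, ∃ p ∈ F, dist y p ≤ ε := by
  classical
  have hR := h.pos
  -- Each arm carries at most R/ε + 1 multiples of ε, and 1 ≤ 1/ε absorbs the rounding.
  refine ⟨(N + 1) * (R + 1), by positivity, fun ε hε hε1 => ?_⟩
  refine ⟨(Finset.univ ×ˢ Finset.range (⌊R / ε⌋₊ + 1)).image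
    (fun q : Fin N × ℕ => γ q.1 (q.2 * ε)), ?_, fun y hy => ?_⟩
  · have h1 : ((⌊R / ε⌋₊ : ℕ) : ℝ) ≤ R / ε := Nat.floor_le (by positivity)
    calc _ ≤ (((Finset.univ ×ˢ Finset.range (⌊R / ε⌋₊ + 1) : Finset (Fin N × ℕ)).card : ℕ) : ℝ) :=
          by exact_mod_cast Finset.card_image_le
      _ = N * (⌊R / ε⌋₊ + 1) := by simp
      _ ≤ (N + 1) * (R / ε + 1 / ε) := by
          have h2 : (1 : ℝ) ≤ 1 / ε := by rw [le_div_iff₀ hε]; linarith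
          gcongr
          linarith
      _ = _ := by ring
  · obtain ⟨i, t, ht, rfl⟩ := mem_iUnion.1 (h.cover hy)
    have h1 : ((⌊t / ε⌋₊ : ℕ) : ℝ) ≤ t / ε := Nat.floor_le (div_nonneg ht.1 hε.le)
    have h2 : t / ε < ⌊t / ε⌋₊ + 1 := Nat.lt_floor_add_one _
    rw [le_div_iff₀ hε] at h1
    rw [div_lt_iff₀ hε] at h2
    refine ⟨γ i (⌊t / ε⌋₊ * ε), Finset.mem_image.2 ⟨(i, ⌊t / ε⌋₊), ?_, rfl⟩, ?_⟩
    · simp only [Finset.mem_product, Finset.mem_univ, Finset.mem_range, true_and]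
      have := Nat.floor_mono (div_le_div_of_nonneg_right ht.2 hε.le)
      omega
    · rw [h.isom i t ht _ ⟨by positivity, h1.trans ht.2⟩, abs_le]
      constructor <;> nlinarith

/-- Room for a guard on arm `i`: the other arms form a closed set which misses the point at distance
2ρ, so a path close enough to that point is forced to be on arm `i`, between the distances ρ and 3ρ.
-/
lemma exists_trap_radius (h : IsStar x R γ) {ρ : ℝ} (hρ : 0 < ρ) (hR : 3 * ρ ≤ R) (i : Fin N) :
    ∃ η : ℝ, 0 < η ∧ Metric.ball (γ i (2 * ρ)) η ⊆ γ i '' Ioo ρ (3 * ρ) := by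
  have h2 : 2 * ρ ∈ Icc 0 R := ⟨by linarith, by linarith⟩
  have hB : IsClosed (⋃ j ∈ {j : Fin N | j ≠ i}, γ j '' Icc 0 R) :=
    (Set.toFinite _).isClosed_biUnion fun j _ => (h.isCompact_arm j).isClosed
  have hnot : γ i (2 * ρ) ∈ (⋃ j ∈ {j : Fin N | j ≠ i}, γ j '' Icc 0 R)ᶜ := by
    intro hmem
    simp only [mem_iUnion] at hmem
    obtain ⟨j, hj, t, ht, hjt⟩ := hmem
    have e1 := h.dist_arm j ht
    rw [hjt, h.dist_arm i h2] at e1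
    subst e1
    exact hj (h.disj j i _ ⟨by linarith, h2.2⟩ _ ⟨by linarith, h2.2⟩ hjt)
  obtain ⟨η, hη, hsub⟩ := Metric.isOpen_iff.1 hB.isOpen_compl _ hnot
  refine ⟨min η ρ, lt_min hη hρ, fun y hy => ?_⟩
  have hy1 : dist y (γ i (2 * ρ)) < η := (Metric.mem_ball.1 hy).trans_le (min_le_left _ _)
  have hy2 : dist y (γ i (2 * ρ)) < ρ := (Metric.mem_ball.1 hy).trans_le (min_le_right _ _)
  have e1 := h.dist_arm i h2
  have hlt : dist x y < 3 * ρ := by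
    have := dist_triangle x (γ i (2 * ρ)) y
    rw [dist_comm (γ i (2 * ρ)) y] at this
    linarith
  have hgt : ρ < dist x y := by
    have := dist_triangle x y (γ i (2 * ρ))
    linarith
  obtain ⟨j, t, ht, rfl⟩ := mem_iUnion.1 (h.cover (Metric.mem_closedBall'.2 (hlt.le.trans hR)))
  rw [h.dist_arm j ht] at hlt hgt
  by_cases hj : j = i
  · subst hj
    exact ⟨t, ⟨hgt, hlt⟩, rfl⟩
  · exact absurd (mem_biUnion (show j ∈ {j : Fin N | j ≠ i} from hj) (mem_image_of_mem (γ j) ht))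
      (hsub (Metric.mem_ball.2 hy1))

/-- A path which coalesces with the paths `b i` whenever it meets them, and which starts closer
to `x` than these, cannot get past them. -/
lemma dist_le_of_trap (h : IsStar x R γ) {ρ : ℝ} (hρ : 0 < ρ) (hR : 3 * ρ ≤ R) {s v : ℝ}
    {f : ℝ → M} (hf : Continuous f) (hs : dist x (f s) ≤ ρ) {b : Fin N → ℝ → M}
    (hb : ∀ i, Continuous (b i)) (hbi : ∀ i, ∀ u ∈ Icc s v, b i u ∈ γ i '' Ioo ρ (3 * ρ))
    (hcoal : ∀ i, ∀ u ∈ Icc s v, f u = b i u → f v = b i v) (hsv : s ≤ v) :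
    dist x (f v) ≤ 3 * ρ := by
  have hbd : ∀ i, ∀ u ∈ Icc s v, ρ < dist x (b i u) ∧ dist x (b i u) < 3 * ρ := by
    intro i u hu
    obtain ⟨t, ht, e⟩ := hbi i u hu
    rw [← e, h.dist_arm i ⟨by linarith [ht.1], by linarith [ht.2]⟩]
    exact ht
  by_cases hmeet : ∃ i, ∃ u ∈ Icc s v, f u = b i u
  · obtain ⟨i, u, hu, e⟩ := hmeet
    rw [hcoal i u hu e]
    exact (hbd i v ⟨hsv, le_rfl⟩).2.le
  push Not at hmeet
  set B : Fin N → Set M := fun i => ⋃ j ∈ {j : Fin N | j ≠ i}, γ j '' Icc 0 R with hBdef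
  have hB : ∀ i, IsClosed (B i) := fun i =>
    (Set.toFinite _).isClosed_biUnion fun j _ => (h.isCompact_arm j).isClosed
  have hAB : ∀ i, ∀ y ∈ Metric.closedBall x R, y ∉ γ i '' Icc 0 R → y ∈ B i := by
    intro i y hy hyi
    obtain ⟨j, hj⟩ := mem_iUnion.1 (h.cover hy)
    refine mem_biUnion (show j ∈ {j : Fin N | j ≠ i} from ?_) hj
    rintro rfl
    exact hyi hj
  -- Continuous induction on the statement that f is beyond the guard on no arm. Being off arm `i`
  -- is expressed by `B i`, the union of the other arms, since this makes S closed.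
  set S : Set ℝ := {u | dist x (f u) ≤ 3 * ρ ∧ ∀ i, f u ∈ B i ∨ dist x (f u) ≤ dist x (b i u)}
    with hSdef
  have hdist : ∀ g : ℝ → M, Continuous g → Continuous fun u => dist x (g u) := fun g hg => by
    fun_prop
  have hSc : IsClosed S := by
    have : S = {u | dist x (f u) ≤ 3 * ρ} ∩ ⋂ i, (f ⁻¹' B i ∪ {u | dist x (f u) ≤ dist x (b i u)}) := by
      ext u
      simp [hSdef]
    rw [this]
    refine (isClosed_le (hdist f hf) continuous_const).inter (isClosed_iInter fun i => ?_)
    exact ((hB i).preimage hf).union (isClosed_le (hdist f hf) (hdist _ (hb i)))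
  have hsub : Icc s v ⊆ S := by
    refine IsClosed.Icc_subset_of_forall_exists_gt (hSc.inter isClosed_Icc) ?_ ?_
    · exact ⟨by linarith, fun i => Or.inr (hs.trans (hbd i s ⟨le_rfl, hsv⟩).1.le)⟩
    rintro u ⟨⟨hu1, hu2⟩, hu⟩ y hy
    have huI : u ∈ Icc s v := ⟨hu.1, hu.2.le⟩
    -- Without a meeting the inequality is strict whenever f is on arm `i`: two points of one arm at
    -- the same distance from x coincide. Unlike the condition in S, this one is open, so it
    -- persists for a while.
    have key : ∀ i, f u ∉ γ i '' Icc 0 R ∨ dist x (f u) < dist x (b i u) := by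
      intro i
      by_contra! hcon
      obtain ⟨⟨t, ht, e⟩, hle⟩ := hcon
      obtain ⟨t', ht', e'⟩ := hbi i u huI
      have ht'R : t' ∈ Icc 0 R := ⟨by linarith [ht'.1], by linarith [ht'.2]⟩
      rw [← e, ← e', h.dist_arm i ht, h.dist_arm i ht'R] at hle
      rcases hu2 i with hBi | hle2
      · simp only [hBdef, mem_iUnion] at hBi
        obtain ⟨j, hj, w, hw, ew⟩ := hBi
        have e1 := h.dist_arm j hw
        rw [ew, ← e, h.dist_arm i ht] at e1
        subst e1
        have : 0 < t := by linarith [ht'.1]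
        exact hj (h.disj j i _ ⟨this, ht.2⟩ _ ⟨this, ht.2⟩ (ew.trans e.symm))
      · rw [← e, ← e', h.dist_arm i ht, h.dist_arm i ht'R] at hle2
        have : t = t' := le_antisymm hle2 hle
        subst this
        exact hmeet i u huI (e.symm.trans e')
    have hlt : dist x (f u) < 3 * ρ := by
      obtain ⟨j, hj⟩ := mem_iUnion.1 (h.cover (Metric.mem_closedBall'.2 (hu1.trans hR)))
      rcases key j with h1 | h1
      · exact absurd hj h1
      · exact h1.trans (hbd j u huI).2
    have ev1 : ∀ᶠ w in 𝓝 u, dist x (f w) < 3 * ρ :=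
      (hdist f hf).continuousAt.eventually_lt continuousAt_const hlt
    have ev2 : ∀ᶠ w in 𝓝 u, ∀ i, f w ∉ γ i '' Icc 0 R ∨ dist x (f w) < dist x (b i w) := by
      rw [eventually_all]
      intro i
      rcases key i with h1 | h1
      · filter_upwards [hf.continuousAt.eventually
          ((h.isCompact_arm i).isClosed.isOpen_compl.mem_nhds h1)] with w hw using Or.inl hw
      · filter_upwards [(hdist f hf).continuousAt.eventually_lt (hdist _ (hb i)).continuousAt h1]
          with w hw using Or.inr hw
    have ev3 : ∀ᶠ w in 𝓝[>] u, w ∈ Ioc u y := Ioc_mem_nhdsGT hy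
    obtain ⟨w, ⟨hw1, hw2⟩, hw3⟩ :=
      (((ev1.and ev2).filter_mono nhdsWithin_le_nhds).and ev3).exists
    refine ⟨w, ⟨hw1.le, fun i => ?_⟩, hw3⟩
    rcases hw2 i with h1 | h1
    · exact Or.inl (hAB i _ (Metric.mem_closedBall'.2 (hw1.le.trans hR)) h1)
    · exact Or.inr h1.le
  exact (hsub ⟨hsv, le_rfl⟩).1

end IsStar

/-- The parametrization of an edge of a metric graph. -/
lemma IsMetricGraph.exists_param {V : Set M} {𝓔 : Set (Set M)} (hM : IsMetricGraph V 𝓔) {E : Set M}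
    (hE : E ∈ 𝓔) : ∃ L : EReal, 0 < L ∧ ∃ g : ℝ → M,
      (∀ t u : ℝ, 0 < t → (t : EReal) < L → 0 < u → (u : EReal) < L → dist (g t) (g u) = |t - u|) ∧
      (∀ y, y ∈ E ↔ ∃ t : ℝ, 0 < t ∧ (t : EReal) < L ∧ g t = y) := by
  obtain ⟨L, hL, e, he, hr⟩ := hM.edge_isometry E hE
  classical
  have hne : Nonempty {t : ℝ // 0 < t ∧ (t : EReal) < L} := by
    obtain ⟨z, hz0, hzL⟩ := EReal.lt_iff_exists_real_btwn.1 hL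
    exact ⟨⟨z, by exact_mod_cast hz0, hzL⟩⟩
  obtain ⟨t0⟩ := hne
  refine ⟨L, hL, fun t => if h : 0 < t ∧ (t : EReal) < L then e ⟨t, h⟩ else e t0, ?_, ?_⟩
  · intro t u ht1 ht2 hu1 hu2
    simp only [ht1, ht2, hu1, hu2, and_self, dite_true]
    rw [he.dist_eq]
    rfl
  · intro y
    rw [← hr]
    constructor
    · rintro ⟨⟨t, ht⟩, rfl⟩
      exact ⟨t, ht.1, ht.2, by simp [ht.1, ht.2]⟩
    · rintro ⟨t, h1, h2, h3⟩
      exact ⟨⟨t, h1, h2⟩, by simpa [h1, h2] using h3⟩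

/-- Inside an edge the two arms are the two directions of the parametrization. The bounds t₀/2 and
t₁ - t₀ on R keep them in the parameter interval, and r/2 keeps the closed ball in the edge, away
from all vertices. -/
lemma IsMetricGraph.exists_star_of_mem_edge {V : Set M} {𝓔 : Set (Set M)} (hM : IsMetricGraph V 𝓔)
    {E : Set M} (hE : E ∈ 𝓔) {x : M} (hx : x ∈ E) :
    ∃ (R : ℝ) (N : ℕ) (γ : Fin N → ℝ → M), IsStar x R γ ∧ Metric.closedBall x R ∩ V ⊆ {x} := by
  obtain ⟨L, hL, g, hg, hgE⟩ := hM.exists_param hE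
  obtain ⟨t0, h0, hL0, rfl⟩ := (hgE x).1 hx
  obtain ⟨t1, ht01, ht1L⟩ := EReal.lt_iff_exists_real_btwn.1 hL0
  have ht01 : t0 < t1 := by exact_mod_cast ht01
  obtain ⟨r, hr, hrE⟩ := Metric.isOpen_iff.1 (hM.isOpen_edge E hE) _ hx
  set R := min (r / 2) (min (t0 / 2) (t1 - t0)) with hRdef
  have hR1 : R ≤ r / 2 := min_le_left _ _
  have hR2 : R ≤ t0 / 2 := (min_le_right _ _).trans (min_le_left _ _)
  have hR3 : R ≤ t1 - t0 := (min_le_right _ _).trans (min_le_right _ _)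
  have hR0 : 0 < R := lt_min (by linarith) (lt_min (by linarith) (by linarith))
  have hsubE : Metric.closedBall (g t0) R ⊆ E :=
    (Metric.closedBall_subset_ball (by linarith)).trans hrE
  have hlt : ∀ u : ℝ, u ≤ t1 → (u : EReal) < L := fun u hu =>
    lt_of_le_of_lt (by exact_mod_cast hu) ht1L
  have hdist : ∀ u : ℝ, 0 < u → (u : EReal) < L → dist (g t0) (g u) = |t0 - u| := fun u hu huL =>
    hg t0 u h0 hL0 hu huL
  refine ⟨R, 2, ![fun t => g (t0 + t), fun t => g (t0 - t)], ⟨hR0, ?_, ?_, ?_, ?_⟩, ?_⟩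
  · rw [Fin.forall_fin_two]
    constructor
    · intro t ht u hu
      simp only [Matrix.cons_val_zero]
      rw [hg _ _ (by linarith [ht.1]) (hlt _ (by linarith [ht.2])) (by linarith [hu.1])
        (hlt _ (by linarith [hu.2]))]
      congr 1; ring
    · intro t ht u hu
      simp only [Matrix.cons_val_one, Matrix.cons_val_fin_one]
      rw [hg _ _ (by linarith [ht.2]) (hlt _ (by linarith [ht.1])) (by linarith [hu.2])
        (hlt _ (by linarith [hu.1])), abs_sub_comm]
      congr 1; ring
  · rw [Fin.forall_fin_two]
    simp
  · intro y hy
    obtain ⟨u, hu0, huL, rfl⟩ := (hgE y).1 (hsubE hy)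
    rw [Metric.mem_closedBall', hdist u hu0 huL, abs_le] at hy
    rcases le_total t0 u with h1 | h1
    · exact mem_iUnion.2 ⟨0, u - t0, ⟨by linarith, by linarith [hy.1]⟩, by simp⟩
    · exact mem_iUnion.2 ⟨1, t0 - u, ⟨by linarith, by linarith [hy.2]⟩, by simp⟩
  · have key : ∀ t ∈ Ioc 0 R, ∀ u ∈ Ioc 0 R, g (t0 + t) ≠ g (t0 - u) := by
      intro t ht u hu he
      have := hg (t0 + t) (t0 - u) (by linarith [ht.1]) (hlt _ (by linarith [ht.2]))
        (by linarith [hu.2]) (hlt _ (by linarith [hu.1]))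
      rw [he, dist_self, eq_comm, abs_eq_zero] at this
      linarith [ht.1, hu.1]
    simp only [Fin.forall_fin_two]
    refine ⟨⟨fun _ _ _ _ _ => trivial, fun t ht u hu e => ?_⟩, fun t ht u hu e => ?_,
      fun _ _ _ _ _ => trivial⟩
    · exact absurd e (key t ht u hu)
    · exact absurd e.symm (key u hu t ht)
  · rintro y ⟨hy, hyV⟩
    have : y ∈ Vᶜ := by
      rw [← hM.sUnion_edges]
      exact ⟨E, hE, hsubE hy⟩
    exact absurd hyV this

/-- An edge with end point `v` contains an isometric arm issuing from `v`. -/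
lemma IsMetricGraph.exists_arm {V : Set M} {𝓔 : Set (Set M)} (hM : IsMetricGraph V 𝓔)
    {E : Set M} (hE : E ∈ 𝓔) {v : M} (hv : v ∈ frontier E) :
    ∃ (r : ℝ) (a : ℝ → M), 0 < r ∧ a 0 = v ∧ (∀ t ∈ Ioc 0 r, a t ∈ E) ∧
      (∀ t ∈ Icc 0 r, ∀ u ∈ Icc 0 r, dist (a t) (a u) = |t - u|) ∧
      E ∩ Metric.closedBall v r ⊆ a '' Icc 0 r := by
  obtain ⟨L, hL, g, hg, hgE⟩ := hM.exists_param hE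
  have hvE : v ∉ E := by
    have := hv.2
    rwa [(hM.isOpen_edge E hE).interior_eq] at this
  obtain ⟨y, hyE, hyv⟩ := mem_closure_iff_seq_limit.1 hv.1
  choose t ht0 htL hty using fun k => (hgE (y k)).1 (hyE k)
  -- Points of the edge that converge to v have Cauchy parameters. The limit τ is an end of the
  -- parameter interval, for otherwise v would be the point of E with parameter τ, while E is open
  -- and v is on its frontier.
  have hcau : CauchySeq t := by
    rw [Metric.cauchySeq_iff]
    intro ε hε
    obtain ⟨n, hn⟩ := Metric.cauchySeq_iff.1 hyv.cauchySeq ε hε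
    refine ⟨n, fun k hk l hl => ?_⟩
    have := hn k hk l hl
    rwa [← hty, ← hty, hg _ _ (ht0 k) (htL k) (ht0 l) (htL l), ← Real.dist_eq] at this
  obtain ⟨τ, hτ⟩ := cauchySeq_tendsto_of_complete hcau
  have hd : ∀ u : ℝ, 0 < u → (u : EReal) < L → dist v (g u) = |τ - u| := by
    intro u hu huL
    refine tendsto_nhds_unique (hyv.dist tendsto_const_nhds) ?_
    have : ∀ k, dist (y k) (g u) = |t k - u| := fun k => by
      rw [← hty, hg _ _ (ht0 k) (htL k) hu huL]
    simp only [this]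
    exact (hτ.sub_const u).abs
  have hτ0 : 0 ≤ τ := ge_of_tendsto' hτ fun k => (ht0 k).le
  have hτL : (τ : EReal) ≤ L :=
    le_of_tendsto' ((continuous_coe_real_ereal.tendsto τ).comp hτ) fun k => (htL k).le
  have hor : τ = 0 ∨ (τ : EReal) = L := by
    by_contra! hcon
    have h1 : 0 < τ := lt_of_le_of_ne hτ0 (Ne.symm hcon.1)
    have h2 : (τ : EReal) < L := lt_of_le_of_ne hτL hcon.2
    have h3 := hd τ h1 h2
    rw [sub_self, abs_zero, dist_eq_zero] at h3
    exact hvE ((hgE v).2 ⟨τ, h1, h2, h3.symm⟩)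
  obtain ⟨r, hr0, hrL⟩ := EReal.lt_iff_exists_real_btwn.1 hL
  have hr0 : 0 < r := by exact_mod_cast hr0
  have hle : ∀ u : ℝ, u ≤ r → (u : EReal) < L := fun u hu =>
    lt_of_le_of_lt (by exact_mod_cast hu) hrL
  -- the parametrization starting from `v`
  obtain ⟨w, hw1, hw2⟩ : ∃ w : ℝ → ℝ, (∀ u ∈ Ioc 0 r, 0 < w u ∧ (w u : EReal) < L ∧ |τ - w u| = u ∧
      ∀ u' ∈ Ioc 0 r, |w u - w u'| = |u - u'|) ∧
      ∀ u : ℝ, 0 < u → (u : EReal) < L → 0 < |τ - u| ∧ w |τ - u| = u := by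
    rcases hor with h0 | hL'
    · refine ⟨id, fun u hu => ⟨hu.1, hle u hu.2, by simp [h0, abs_of_pos hu.1], by simp⟩,
        fun u hu _ => ?_⟩
      rw [h0, zero_sub, abs_neg, abs_of_pos hu]
      exact ⟨hu, rfl⟩
    · have hrτ : r < τ := by rw [← hL'] at hrL; exact_mod_cast hrL
      refine ⟨fun u => τ - u, fun u hu => ⟨by linarith [hu.2], ?_, ?_, ?_⟩, fun u hu huL => ?_⟩
      · rw [← hL']
        exact_mod_cast (by linarith [hu.1] : τ - u < τ)
      · rw [sub_sub_cancel, abs_of_pos hu.1]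
      · intro u' _
        rw [sub_sub_sub_cancel_left, abs_sub_comm]
      · rw [← hL'] at huL
        have : u < τ := by exact_mod_cast huL
        rw [abs_of_pos (by linarith)]
        exact ⟨by linarith, by ring⟩
  classical
  refine ⟨r, fun u => if u = 0 then v else g (w u), hr0, by simp, ?_, ?_, ?_⟩
  · intro u hu
    obtain ⟨h1, h2, -⟩ := hw1 u hu
    simp only [hu.1.ne', if_false]
    exact (hgE _).2 ⟨_, h1, h2, rfl⟩
  · intro u hu u' hu'
    rcases hu.1.eq_or_lt with h0 | h0
    · rcases hu'.1.eq_or_lt with h0' | h0'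
      · simp [← h0, ← h0']
      · obtain ⟨h1, h2, h3, -⟩ := hw1 u' ⟨h0', hu'.2⟩
        simp only [← h0, h0'.ne', if_true, if_false]
        rw [hd _ h1 h2, h3, zero_sub, abs_neg, abs_of_pos h0']
    · obtain ⟨h1, h2, h3, h4⟩ := hw1 u ⟨h0, hu.2⟩
      rcases hu'.1.eq_or_lt with h0' | h0'
      · simp only [← h0', h0.ne', if_true, if_false]
        rw [dist_comm, hd _ h1 h2, h3, sub_zero, abs_of_pos h0]
      · obtain ⟨h1', h2', -⟩ := hw1 u' ⟨h0', hu'.2⟩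
        simp only [h0.ne', h0'.ne', if_false]
        rw [hg _ _ h1 h2 h1' h2', h4 u' ⟨h0', hu'.2⟩]
  · rintro z ⟨hzE, hz⟩
    obtain ⟨u, hu0, huL, rfl⟩ := (hgE z).1 hzE
    obtain ⟨h1, h2⟩ := hw2 u hu0 huL
    rw [Metric.mem_closedBall', hd u hu0 huL] at hz
    refine ⟨|τ - u|, ⟨h1.le, hz⟩, ?_⟩
    simp only [h1.ne', if_false]
    rw [h2]

/-- Only finitely many edges end at v, so a single radius works for one arm in each of them and for
the neighbourhood in `star_mem_nhds`. The arms meet only at v because the edges are disjoint. -/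
lemma IsMetricGraph.exists_star_of_mem_vertices {V : Set M} {𝓔 : Set (Set M)}
    (hM : IsMetricGraph V 𝓔) {v : M} (hv : v ∈ V) :
    ∃ (R : ℝ) (N : ℕ) (γ : Fin N → ℝ → M), IsStar v R γ ∧ Metric.closedBall v R ∩ V ⊆ {v} := by
  set J : Set (Set M) := {E ∈ 𝓔 | v ∈ frontier E} with hJ
  have hfin : J.Finite := hM.adjacent_finite v hv
  have hne : J.Nonempty := hM.adjacent_nonempty v hv
  have : Nonempty M := ⟨v⟩
  choose! r a hr ha0 haE hai hac using fun E (hE : E ∈ J) => hM.exists_arm hE.1 hE.2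
  obtain ⟨ε, hε, hball⟩ := Metric.nhds_basis_closedBall.mem_iff.1 (hM.star_mem_nhds v hv)
  obtain ⟨R, ⟨hRr, hRε⟩, hR0⟩ : ∃ R : ℝ, ((∀ E ∈ J, R ≤ r E) ∧ R ≤ ε) ∧ 0 < R := by
    have h1 : ∀ᶠ R : ℝ in 𝓝[>] 0, ∀ E ∈ J, R ≤ r E := by
      rw [eventually_all_finite hfin]
      intro E hE
      filter_upwards [Ioc_mem_nhdsGT (hr E hE)] with R hR using hR.2
    have h2 : ∀ᶠ R : ℝ in 𝓝[>] 0, R ≤ ε := by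
      filter_upwards [Ioc_mem_nhdsGT hε] with R hR using hR.2
    exact ((h1.and h2).and self_mem_nhdsWithin).exists
  have : Finite J := hfin
  let eq := (Finite.equivFin J).symm
  have hmono : Icc 0 R ⊆ Icc 0 ε := Icc_subset_Icc_right hRε
  have hmonoJ : ∀ E ∈ J, Icc 0 R ⊆ Icc 0 (r E) := fun E hE => Icc_subset_Icc_right (hRr E hE)
  refine ⟨R, Nat.card J, fun i => a (eq i), ⟨hR0, ?_, ?_, ?_, ?_⟩, ?_⟩
  · intro i t ht u hu
    exact hai _ (eq i).2 t (hmonoJ _ (eq i).2 ht) u (hmonoJ _ (eq i).2 hu)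
  · exact fun i => ha0 _ (eq i).2
  · intro y hy
    rcases hball (Metric.closedBall_subset_closedBall hRε hy) with h1 | ⟨E, hE, hyE⟩
    · obtain ⟨E, hE⟩ := hne
      refine mem_iUnion.2 ⟨eq.symm ⟨E, hE⟩, 0, ⟨le_rfl, hR0.le⟩, ?_⟩
      rw [mem_singleton_iff.1 h1]
      exact ha0 _ (eq _).2
    · obtain ⟨t, ht, e⟩ := hac E hE ⟨hyE, Metric.closedBall_subset_closedBall (hRr E hE) hy⟩
      refine mem_iUnion.2 ⟨eq.symm ⟨E, hE⟩, t, ⟨ht.1, ?_⟩, ?_⟩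
      · rw [Metric.mem_closedBall', ← e, ← ha0 E hE, hai E hE 0 ⟨le_rfl, (hr E hE).le⟩ t ht,
          zero_sub, abs_neg, abs_of_nonneg ht.1] at hy
        exact hy
      · rw [Equiv.apply_symm_apply]
        exact e
  · intro i j t ht u hu e
    have h1 := haE _ (eq i).2 t ⟨ht.1, ht.2.trans (hRr _ (eq i).2)⟩
    have h2 := haE _ (eq j).2 u ⟨hu.1, hu.2.trans (hRr _ (eq j).2)⟩
    by_contra hij
    have hne : ((eq i : J) : Set M) ≠ (eq j : J) := fun h =>
      hij (eq.injective (Subtype.ext h))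
    have hdis := hM.pairwise_disjoint (eq i).2.1 (eq j).2.1 hne
    refine Set.disjoint_left.1 hdis h1 ?_
    rw [e]
    exact h2
  · rintro y ⟨hy, hyV⟩
    rcases hball (Metric.closedBall_subset_closedBall hRε hy) with h1 | ⟨E, hE, hyE⟩
    · exact h1
    · have : y ∈ Vᶜ := by
        rw [← hM.sUnion_edges]
        exact ⟨E, hE.1, hyE⟩
      exact absurd hyV this

/-- Every point of a metric graph has a neighbourhood which is a star. -/
lemma IsMetricGraph.exists_star {V : Set M} {𝓔 : Set (Set M)} (hM : IsMetricGraph V 𝓔) (x : M) :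
    ∃ (R : ℝ) (N : ℕ) (γ : Fin N → ℝ → M), IsStar x R γ ∧ Metric.closedBall x R ∩ V ⊆ {x} := by
  by_cases hx : x ∈ V
  · exact hM.exists_star_of_mem_vertices hx
  · have : x ∈ ⋃₀ 𝓔 := by rwa [hM.sUnion_edges]
    obtain ⟨E, hE, hxE⟩ := this
    exact hM.exists_star_of_mem_edge hE hxE

end Stars

/-! ### Markov processes -/

section Markov

/-- `Z` is a Markov process with transition function `P` with respect to the filtration `𝓖`. -/
structure IsMarkov {Ω E : Type*} {mΩ : MeasurableSpace Ω} [MeasurableSpace E]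
    (μ : Measure Ω) (𝓖 : Filtration ℝ≥0 mΩ) (P : ℝ≥0 → Kernel E E) (Z : ℝ≥0 → Ω → E) : Prop where
  adapted : ∀ t, Measurable[𝓖 t] (Z t)
  markov : ∀ (s t : ℝ≥0) (A : Set Ω) (B : Set E), MeasurableSet[𝓖 s] A → MeasurableSet B →
    μ (A ∩ Z (s + t) ⁻¹' B) = ∫⁻ ω in A, P t (Z s ω) B ∂μ

namespace IsMarkov

variable {Ω E : Type*} {mΩ : MeasurableSpace Ω} [MeasurableSpace E]
  {μ : Measure Ω} {𝓖 : Filtration ℝ≥0 mΩ} {P : ℝ≥0 → Kernel E E} {Z : ℝ≥0 → Ω → E}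

lemma measurable (h : IsMarkov μ 𝓖 P Z) (t : ℝ≥0) : Measurable (Z t) :=
  (h.adapted t).mono (𝓖.le t) le_rfl

lemma setLIntegral (h : IsMarkov μ 𝓖 P Z) (s t : ℝ≥0) {A : Set Ω}
    (hA : MeasurableSet[𝓖 s] A) {f : E → ℝ≥0∞} (hf : Measurable f) :
    ∫⁻ ω in A, f (Z (s + t) ω) ∂μ = ∫⁻ ω in A, ∫⁻ y, f y ∂(P t (Z s ω)) ∂μ := by
  have key : (μ.restrict A).map (Z (s + t)) = ((μ.restrict A).map (Z s)).bind (P t) := by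
    ext B hB
    rw [Measure.map_apply (h.measurable _) hB, Measure.bind_apply hB (P t).aemeasurable,
      lintegral_map ((P t).measurable_coe hB) (h.measurable _),
      Measure.restrict_apply (h.measurable _ hB), inter_comm]
    exact h.markov s t A B hA hB
  rw [← lintegral_map hf (h.measurable _), key, Measure.lintegral_bind (P t).aemeasurable
    hf.aemeasurable, lintegral_map hf.lintegral_kernel (h.measurable _)]

lemma measure_inter_preimage_le (h : IsMarkov μ 𝓖 P Z) {s T : ℝ≥0} (hs : s ≤ T) {A : Set Ω}
    (hA : MeasurableSet[𝓖 s] A) {B : Set E} (hB : MeasurableSet B) {η : ℝ≥0∞}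
    (hη : ∀ ω ∈ A, P (T - s) (Z s ω) B ≤ η) : μ (A ∩ Z T ⁻¹' B) ≤ η * μ A := by
  have := h.markov s (T - s) A B hA hB
  rw [add_tsub_cancel_of_le hs] at this
  rw [this]
  calc _ ≤ ∫⁻ _ in A, η ∂μ := setLIntegral_mono measurable_const hη
    _ = _ := by simp

/-- If the set `B` is unlikely to be reached at time `T` after `U t` has been entered at time `t`,
then it is unlikely that some `U t` is entered and `B` is reached. -/
lemma first_entry_finset (h : IsMarkov μ 𝓖 P Z) {T : ℝ≥0} {U : ℝ≥0 → Set E}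
    (hU : ∀ t, MeasurableSet (U t)) {B : Set E} (hB : MeasurableSet B) {η : ℝ≥0∞}
    (C : Finset ℝ≥0) : ∀ r : ℝ≥0, (∀ t ∈ C, r ≤ t) → (∀ t ∈ C, t ≤ T) →
      (∀ t ∈ C, ∀ z ∈ U t, P (T - t) z B ≤ η) → ∀ A, MeasurableSet[𝓖 r] A →
      μ (A ∩ (⋃ t ∈ C, Z t ⁻¹' U t) ∩ Z T ⁻¹' B) ≤ η * μ (A ∩ ⋃ t ∈ C, Z t ⁻¹' U t) := by
  -- The smallest time a is split off. On the part where `U a` is entered the Markov property at a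
  -- applies; the complementary part is an event known at a, to which the induction hypothesis
  -- applies. This is why r and A are arbitrary.
  induction C using Finset.induction_on_min with
  | empty => simp
  | insert a C ha ih =>
    intro r hr hT hη A hA
    have hra : r ≤ a := hr a (Finset.mem_insert_self _ _)
    have hA' : MeasurableSet[𝓖 a] A := 𝓖.mono hra _ hA
    have hUa : MeasurableSet[𝓖 a] (Z a ⁻¹' U a) := h.adapted a (hU a)
    have hsplit : (⋃ t ∈ insert a C, Z t ⁻¹' U t) = Z a ⁻¹' U a ∪ ⋃ t ∈ C, Z t ⁻¹' U t := by
      ext ω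
      simp
    rw [hsplit]
    have e1 : A ∩ (Z a ⁻¹' U a ∪ ⋃ t ∈ C, Z t ⁻¹' U t) ∩ Z a ⁻¹' U a = A ∩ Z a ⁻¹' U a := by
      grind
    have e2 : (A ∩ (Z a ⁻¹' U a ∪ ⋃ t ∈ C, Z t ⁻¹' U t)) \ Z a ⁻¹' U a =
        (A \ Z a ⁻¹' U a) ∩ ⋃ t ∈ C, Z t ⁻¹' U t := by
      ext ω
      simp only [Set.mem_sdiff, mem_inter_iff, mem_union]
      tauto
    rw [← measure_inter_add_sdiff (A ∩ (Z a ⁻¹' U a ∪ ⋃ t ∈ C, Z t ⁻¹' U t)) (𝓖.le a _ hUa), e1, e2,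
      mul_add]
    have h1 := h.measure_inter_preimage_le (hT a (Finset.mem_insert_self _ _)) (hA'.inter hUa) hB
      (η := η) (fun ω hω => hη a (Finset.mem_insert_self _ _) _ hω.2)
    have h2 := ih a (fun t ht => (ha t ht).le) (fun t ht => hT t (Finset.mem_insert_of_mem ht))
      (fun t ht => hη t (Finset.mem_insert_of_mem ht)) (A \ Z a ⁻¹' U a) (hA'.diff hUa)
    refine le_trans (measure_mono ?_) ((measure_union_le _ _).trans (add_le_add h1 h2))
    intro ω hω
    by_cases hωa : ω ∈ Z a ⁻¹' U a
    · exact Or.inl ⟨⟨hω.1.1, hωa⟩, hω.2⟩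
    · exact Or.inr ⟨⟨⟨hω.1.1, hωa⟩, hω.1.2.resolve_left hωa⟩, hω.2⟩

lemma first_entry (h : IsMarkov μ 𝓖 P Z) {T : ℝ≥0} {U : ℝ≥0 → Set E}
    (hU : ∀ t, MeasurableSet (U t)) {B : Set E} (hB : MeasurableSet B) {η : ℝ≥0∞}
    {C : Set ℝ≥0} (hC : C.Countable) (hT : ∀ t ∈ C, t ≤ T)
    (hη : ∀ t ∈ C, ∀ z ∈ U t, P (T - t) z B ≤ η) {A : Set Ω} (hA : MeasurableSet[𝓖 0] A) :
    μ (A ∩ (⋃ t ∈ C, Z t ⁻¹' U t) ∩ Z T ⁻¹' B) ≤ η * μ (A ∩ ⋃ t ∈ C, Z t ⁻¹' U t) := by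
  classical
  rcases C.eq_empty_or_nonempty with rfl | hne
  · simp
  obtain ⟨u, rfl⟩ := hC.exists_eq_range hne
  set H : ℕ → Set Ω := fun n => ⋃ t ∈ (Finset.range n).image u, Z t ⁻¹' U t with hH
  have hmono : Monotone H := fun m n hmn => biUnion_mono
    (fun t ht => Finset.image_subset_image (Finset.range_mono hmn) ht) fun _ _ => Subset.rfl
  have hunion : (⋃ t ∈ range u, Z t ⁻¹' U t) = ⋃ n, H n := by
    ext ω
    simp only [hH, mem_iUnion, Finset.mem_image, Finset.mem_range]
    constructor
    · rintro ⟨_, ⟨n, rfl⟩, hn⟩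
      exact ⟨n + 1, u n, ⟨n, n.lt_succ_self, rfl⟩, hn⟩
    · rintro ⟨n, _, ⟨k, _, rfl⟩, hk⟩
      exact ⟨u k, ⟨k, rfl⟩, hk⟩
  rw [hunion]
  have e : A ∩ (⋃ n, H n) ∩ Z T ⁻¹' B = ⋃ n, A ∩ H n ∩ Z T ⁻¹' B := by
    rw [inter_iUnion, iUnion_inter]
  rw [e, Monotone.measure_iUnion]
  · refine iSup_le fun n => ?_
    have hsub : ∀ t ∈ (Finset.range n).image u, t ∈ range u := fun t ht => by
      obtain ⟨k, -, rfl⟩ := Finset.mem_image.1 ht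
      exact ⟨k, rfl⟩
    refine (h.first_entry_finset hU hB _ 0 (fun _ _ => zero_le) (fun t ht => hT t (hsub t ht))
      (fun t ht => hη t (hsub t ht)) A hA).trans ?_
    gcongr
    exact subset_iUnion H n
  · intro m n hmn
    exact inter_subset_inter_left _ (inter_subset_inter_right _ (hmono hmn))

/-- Ottaviani's inequality: at most half of the mass of the entry event is in B at time T, so at
least half is outside. Entries at countably many times are thus controlled by the position at one
fixed time. -/
lemma first_entry_le_two_mul [IsFiniteMeasure μ] (h : IsMarkov μ 𝓖 P Z) {T : ℝ≥0}
    {U : ℝ≥0 → Set E} (hU : ∀ t, MeasurableSet (U t)) {B : Set E} (hB : MeasurableSet B)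
    {C : Set ℝ≥0} (hC : C.Countable) (hT : ∀ t ∈ C, t ≤ T)
    (hη : ∀ t ∈ C, ∀ z ∈ U t, P (T - t) z B ≤ 2⁻¹) {A : Set Ω} (hA : MeasurableSet[𝓖 0] A) :
    μ (A ∩ (⋃ t ∈ C, Z t ⁻¹' U t)) ≤ 2 * μ (A ∩ Z T ⁻¹' Bᶜ) := by
  have h1 := h.first_entry hU hB hC hT hη hA
  set H := A ∩ (⋃ t ∈ C, Z t ⁻¹' U t)
  have h2 := measure_inter_add_sdiff H (h.measurable T hB) (μ := μ)
  have h3 : μ (H \ Z T ⁻¹' B) ≤ μ (A ∩ Z T ⁻¹' Bᶜ) :=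
    measure_mono fun ω hω => ⟨hω.1.1, hω.2⟩
  have hfin : μ H ≠ ∞ := measure_ne_top _ _
  have h4 : μ H ≤ 2⁻¹ * μ H + μ (A ∩ Z T ⁻¹' Bᶜ) := by
    calc μ H = _ := h2.symm
      _ ≤ _ := add_le_add h1 h3
  have h5 : μ H = 2⁻¹ * μ H + 2⁻¹ * μ H := by
    rw [← add_mul, ENNReal.inv_two_add_inv_two, one_mul]
  have h6 : 2⁻¹ * μ H ≤ μ (A ∩ Z T ⁻¹' Bᶜ) := by
    have hf : 2⁻¹ * μ H ≠ ∞ := ENNReal.mul_ne_top (by simp) hfin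
    rw [h5] at h4
    rw [← h5] at h4
    exact (ENNReal.add_le_add_iff_left hf).1 (by rwa [← h5])
  calc μ H = 2 * (2⁻¹ * μ H) := by
        rw [← mul_assoc, ENNReal.mul_inv_cancel (by simp) (by simp), one_mul]
    _ ≤ _ := by gcongr

/-- One step in the computation of the finite dimensional distributions. -/
lemma measure_cylinder_insert (h : IsMarkov μ 𝓖 P Z) {r a : ℝ≥0} (hra : r ≤ a)
    {F : Finset ℝ≥0} {B : ℝ≥0 → Set E} (hB : ∀ t, MeasurableSet (B t)) {φ : E → ℝ≥0∞}
    (hφ : Measurable φ)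
    (hF : ∀ A, MeasurableSet[𝓖 a] A → μ (A ∩ ⋂ t ∈ F, Z t ⁻¹' B t) = ∫⁻ ω in A, φ (Z a ω) ∂μ)
    {A : Set Ω} (hA : MeasurableSet[𝓖 r] A) :
    μ (A ∩ ⋂ t ∈ insert a F, Z t ⁻¹' B t) =
      ∫⁻ ω in A, ∫⁻ y, (B a).indicator φ y ∂(P (a - r) (Z r ω)) ∂μ := by
  have e : A ∩ ⋂ t ∈ insert a F, Z t ⁻¹' B t = (A ∩ Z a ⁻¹' B a) ∩ ⋂ t ∈ F, Z t ⁻¹' B t := by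
    ext ω
    simp [and_assoc]
  have hBa : MeasurableSet[𝓖 a] (Z a ⁻¹' B a) := h.adapted a (hB a)
  rw [e, hF _ ((𝓖.mono hra _ hA).inter hBa), ← h.setLIntegral r (a - r) hA (hφ.indicator (hB a)),
    add_tsub_cancel_of_le hra, inter_comm, ← setLIntegral_indicator (𝓖.le a _ hBa)]
  rfl

/-- The function φ is built from P alone, so one φ serves for Z and simultaneously for all the
processes W under `ν j`. This identifies laws with each other and also gives their measurability in
the starting point. -/
lemma exists_fdd {Ω' J : Type*} {mΩ' : MeasurableSpace Ω'} {ν : J → Measure Ω'}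
    {𝓗 : Filtration ℝ≥0 mΩ'} {W : ℝ≥0 → Ω' → E} (h : IsMarkov μ 𝓖 P Z)
    (hW : ∀ j, IsMarkov (ν j) 𝓗 P W) {B : ℝ≥0 → Set E} (hB : ∀ t, MeasurableSet (B t))
    (F : Finset ℝ≥0) : ∀ r : ℝ≥0, (∀ t ∈ F, r ≤ t) → ∃ φ : E → ℝ≥0∞, Measurable φ ∧
      (∀ A, MeasurableSet[𝓖 r] A → μ (A ∩ ⋂ t ∈ F, Z t ⁻¹' B t) = ∫⁻ ω in A, φ (Z r ω) ∂μ) ∧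
      ∀ j A, MeasurableSet[𝓗 r] A →
        ν j (A ∩ ⋂ t ∈ F, W t ⁻¹' B t) = ∫⁻ ω in A, φ (W r ω) ∂(ν j) := by
  induction F using Finset.induction_on_min with
  | empty => exact fun r _ => ⟨1, measurable_const, by simp, by simp⟩
  | insert a F ha ih =>
    intro r hr
    obtain ⟨φ, hφ, h1, h2⟩ := ih a fun t ht => (ha t ht).le
    have hra := hr a (Finset.mem_insert_self _ _)
    exact ⟨fun z => ∫⁻ y, (B a).indicator φ y ∂(P (a - r) z),
      (hφ.indicator (hB a)).lintegral_kernel,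
      fun A hA => h.measure_cylinder_insert hra hB hφ h1 hA,
      fun j A hA => (hW j).measure_cylinder_insert hra hB hφ (h2 j) hA⟩

end IsMarkov

end Markov

/-! ### The Borel `σ`-field of the space of trajectories -/

section Trajectories

variable {E : Type*} [MetricSpace E] [SecondCountableTopology E] [MeasurableSpace E] [BorelSpace E]

/-- For compact K and open U, a path maps K into U iff its distance from Uᶜ is bounded below on a
countable dense subset of K. Hence the subbasic open sets are determined by countably many
evaluations. An empty Uᶜ is treated apart, because `Metric.infDist` to the empty set is 0. -/
lemma borel_continuousMap_eq_comap :
    (borel C(ℝ≥0, E)) = MeasurableSpace.comap (fun (w : C(ℝ≥0, E)) t => w t) inferInstance := by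
  apply le_antisymm
  · rw [borel_eq_generateFrom_of_subbasis (ContinuousMap.compactOpen_eq (X := ℝ≥0) (Y := E))]
    refine MeasurableSpace.generateFrom_le ?_
    rintro _ ⟨K, hK, U, hU, rfl⟩
    set m : MeasurableSpace C(ℝ≥0, E) :=
      MeasurableSpace.comap (fun (w : C(ℝ≥0, E)) t => w t) inferInstance with hm
    have hev : ∀ t, Measurable[m] fun w : C(ℝ≥0, E) => w t := fun t =>
      (measurable_pi_apply t).comp (comap_measurable _)
    rcases K.eq_empty_or_nonempty with rfl | hKne
    · simp [mapsTo_empty]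
    rcases (Uᶜ).eq_empty_or_nonempty with hUe | hUne
    · rw [compl_empty_iff] at hUe
      simp [hUe]
    obtain ⟨Q, hQK, hQc, hQd⟩ := (TopologicalSpace.IsSeparable.of_separableSpace K).exists_countable_dense_subset
    have : {w : C(ℝ≥0, E) | MapsTo w K U} =
        ⋃ n : ℕ, ⋂ q ∈ Q, {w | 1 / ((n : ℝ) + 1) ≤ Metric.infDist (w q) Uᶜ} := by
      ext w
      simp only [mem_iUnion, mem_iInter]
      constructor
      · intro hw
        obtain ⟨q0, hq0, hmin⟩ := hK.exists_isMinOn hKne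
          ((Metric.continuous_infDist_pt Uᶜ).comp w.continuous).continuousOn
        have hpos : 0 < Metric.infDist (w q0) Uᶜ :=
          (hU.isClosed_compl.notMem_iff_infDist_pos hUne).1 fun hc => hc (hw hq0)
        obtain ⟨n, hn⟩ := exists_nat_one_div_lt hpos
        exact ⟨n, fun q hq => hn.le.trans (hmin (hQK hq))⟩
      · rintro ⟨n, hn⟩ q hq
        have hcl : IsClosed {t : ℝ≥0 | 1 / ((n : ℝ) + 1) ≤ Metric.infDist (w t) Uᶜ} :=
          isClosed_le continuous_const ((Metric.continuous_infDist_pt Uᶜ).comp w.continuous)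
        have h1 : q ∈ {t : ℝ≥0 | 1 / ((n : ℝ) + 1) ≤ Metric.infDist (w t) Uᶜ} :=
          closure_minimal (fun q hq => hn q hq) hcl (hQd hq)
        by_contra hcon
        have h2 : Metric.infDist (w q) Uᶜ = 0 := Metric.infDist_zero_of_mem hcon
        have h3 : (0 : ℝ) < 1 / ((n : ℝ) + 1) := by positivity
        have h4 : 1 / ((n : ℝ) + 1) ≤ Metric.infDist (w q) Uᶜ := h1
        linarith
    change MeasurableSet[m] {w : C(ℝ≥0, E) | MapsTo w K U}
    rw [this]
    refine MeasurableSet.iUnion fun n => MeasurableSet.biInter hQc fun q _ => ?_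
    exact measurableSet_le measurable_const
      ((Metric.continuous_infDist_pt Uᶜ).measurable.comp (hev q))
  · rw [← measurable_iff_comap_le]
    refine @measurable_pi_lambda _ _ _ (borel _) _ _ fun t => ?_
    exact (continuous_eval_const t).borel_measurable.mono le_rfl
      (BorelSpace.measurable_eq (α := E)).le

omit [SecondCountableTopology E] in
lemma measurable_eval (t : ℝ≥0) : Measurable fun w : C(ℝ≥0, E) => w t :=
  (continuous_eval_const t).measurable

lemma measurable_continuousMap_iff {Ω : Type*} [MeasurableSpace Ω] {g : Ω → C(ℝ≥0, E)} :
    Measurable g ↔ ∀ t, Measurable fun ω => g ω t := by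
  refine ⟨fun h t => (measurable_eval t).comp h, fun h => ?_⟩
  change @Measurable _ _ _ (borel _) g
  rw [borel_continuousMap_eq_comap, measurable_comap_iff]
  exact measurable_pi_lambda _ h

variable (E) in
/-- The cylinder sets of the space of trajectories. -/
def cylinders : Set (Set C(ℝ≥0, E)) :=
  {S | ∃ (F : Finset ℝ≥0) (B : ℝ≥0 → Set E), (∀ t, MeasurableSet (B t)) ∧
    S = ⋂ t ∈ F, (fun w : C(ℝ≥0, E) => w t) ⁻¹' B t}

omit [SecondCountableTopology E] [BorelSpace E] in
lemma cylinders_eq : cylinders E = {S | ∃ S' ∈ squareCylinders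
    (fun _ : ℝ≥0 => {B : Set E | MeasurableSet B}), (fun (w : C(ℝ≥0, E)) t => w t) ⁻¹' S' = S} := by
  ext S
  constructor
  · rintro ⟨F, B, hB, rfl⟩
    exact ⟨(F : Set ℝ≥0).pi B, ⟨F, B, fun t _ => hB t, rfl⟩, by ext w; simp [Set.mem_pi]⟩
  · rintro ⟨_, ⟨F, B, hB, rfl⟩, rfl⟩
    exact ⟨F, B, fun t => hB t trivial, by ext w; simp [Set.mem_pi]⟩

omit [SecondCountableTopology E] [BorelSpace E] in
lemma isPiSystem_cylinders : IsPiSystem (cylinders E) := by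
  rw [cylinders_eq]
  exact (isPiSystem_squareCylinders (fun _ => MeasurableSpace.isPiSystem_measurableSet)
    fun _ => MeasurableSet.univ).comap _

lemma generateFrom_cylinders :
    (inferInstance : MeasurableSpace C(ℝ≥0, E)) = MeasurableSpace.generateFrom (cylinders E) := by
  change borel _ = _
  rw [borel_continuousMap_eq_comap, cylinders_eq, ← generateFrom_squareCylinders,
    MeasurableSpace.comap_generateFrom]
  rfl

/-- The natural filtration of the canonical process. -/
def canonicalFiltration (E : Type*) [MetricSpace E] [MeasurableSpace E] [BorelSpace E] :
    Filtration ℝ≥0 (inferInstance : MeasurableSpace C(ℝ≥0, E)) where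
  seq s := ⨆ r : Iic s, MeasurableSpace.comap (fun w : C(ℝ≥0, E) => w r) inferInstance
  mono' _ t hst := iSup_le fun r => le_iSup_of_le (⟨r.1, le_trans r.2 hst⟩ : Iic t) le_rfl
  le' _ := iSup_le fun r => (measurable_eval (r : ℝ≥0)).comap_le

variable {P : ℝ≥0 → Kernel E E}

omit [SecondCountableTopology E] in
lemma IsMarkovLaw.isMarkov {x : E} {Q : Measure C(ℝ≥0, E)} (h : IsMarkovLaw P x Q) :
    IsMarkov Q (canonicalFiltration E) P (fun t w => w t) where
  adapted t := by
    rw [measurable_iff_comap_le]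
    exact le_iSup_of_le (⟨t, self_mem_Iic⟩ : Iic t) le_rfl
  markov s t A B hA hB := h.markov s t A B hA hB

section Laws

variable {Ω : Type*} {mΩ : MeasurableSpace Ω} {μ : Measure Ω} [IsProbabilityMeasure μ]
  {𝓖 : Filtration ℝ≥0 mΩ} {g : Ω → C(ℝ≥0, E)}

lemma IsMarkov.isMarkovLaw_map (h : IsMarkov μ 𝓖 P (fun t ω => g ω t)) {x : E}
    (hx : ∀ ω, g ω 0 = x) : IsMarkovLaw P x (μ.map g) := by
  have hg : Measurable g := measurable_continuousMap_iff.2 fun t => h.measurable t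
  refine ⟨Measure.isProbabilityMeasure_map hg.aemeasurable, ?_, ?_⟩
  · exact (ae_map_iff (p := fun w : C(ℝ≥0, E) => w 0 = x) hg.aemeasurable
      (measurable_eval 0 (measurableSet_singleton x))).2 (Eventually.of_forall hx)
  · intro s t A B hA hB
    have hgs : MeasurableSet[𝓖 s] (g ⁻¹' A) := by
      have hle : MeasurableSpace.comap g (⨆ r : Iic s,
          MeasurableSpace.comap (fun w : C(ℝ≥0, E) => w r) inferInstance) ≤ 𝓖 s := by
        rw [MeasurableSpace.comap_iSup]
        refine iSup_le fun r => ?_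
        rw [MeasurableSpace.comap_comp, ← measurable_iff_comap_le]
        exact (h.adapted r).mono (𝓖.mono r.2) le_rfl
      exact hle _ ⟨A, hA, rfl⟩
    have hA' : MeasurableSet A := (canonicalFiltration E).le s _ hA
    have hev := measurable_eval (E := E) (s + t) hB
    change μ.map g (A ∩ (fun w => w (s + t)) ⁻¹' B) = _
    rw [Measure.map_apply hg (hA'.inter hev), setLIntegral_map hA'
      (f := fun w : C(ℝ≥0, E) => P t (w s) B)
      (((P t).measurable_coe hB).comp (measurable_eval s)) hg]
    exact h.markov s t _ B hgs hB

omit [SecondCountableTopology E] [BorelSpace E] in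
lemma isMarkovLaw_markovLaw {x : E} (h : ∃ Q, IsMarkovLaw P x Q) :
    IsMarkovLaw P x (markovLaw P x) := by
  rw [markovLaw, dif_pos h]
  exact h.choose_spec

/-- On a cylinder set the law is a measurable function of the starting point by
`IsMarkov.exists_fdd`, and the cylinders are a generating π-system. -/
lemma measurable_markovLaw (hex : ∀ x : E, ∃ Q, IsMarkovLaw P x Q) {S : Set C(ℝ≥0, E)}
    (hS : MeasurableSet S) : Measurable fun x => markovLaw P x S := by
  have hprob : ∀ x, IsProbabilityMeasure (markovLaw P x) := fun x =>
    (isMarkovLaw_markovLaw (hex x)).prob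
  have hproc := fun x => (isMarkovLaw_markovLaw (hex x)).isMarkov
  refine (Measure.measurable_coe hS).comp
    (Measurable.measure_of_isPiSystem_of_isProbabilityMeasure generateFrom_cylinders
      isPiSystem_cylinders ?_)
  rintro _ ⟨F, B, hB, rfl⟩
  rcases isEmpty_or_nonempty E with hE | ⟨⟨x0⟩⟩
  · exact measurable_of_empty _
  obtain ⟨φ, hφ, -, h2⟩ := (hproc x0).exists_fdd hproc hB F 0 fun _ _ => zero_le
  convert hφ using 2 with x
  have := h2 x univ MeasurableSet.univ
  rw [univ_inter, Measure.restrict_univ] at this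
  rw [this, lintegral_congr_ae ((isMarkovLaw_markovLaw (hex x)).start.mono
    fun w (hw : w 0 = x) => by rw [hw])]
  simp

/-- The Markov property at time `0`, for the whole trajectory. -/
lemma IsMarkov.measure_inter_preimage_path (h : IsMarkov μ 𝓖 P (fun t ω => g ω t))
    (hex : ∀ x : E, ∃ Q, IsMarkovLaw P x Q) {A : Set Ω} (hA : MeasurableSet[𝓖 0] A)
    {S : Set C(ℝ≥0, E)} (hS : MeasurableSet S) :
    μ (A ∩ g ⁻¹' S) = ∫⁻ ω in A, markovLaw P (g ω 0) S ∂μ := by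
  have hg : Measurable g := measurable_continuousMap_iff.2 fun t => h.measurable t
  have hprob : ∀ x, IsProbabilityMeasure (markovLaw P x) := fun x =>
    (isMarkovLaw_markovLaw (hex x)).prob
  have hproc := fun x => (isMarkovLaw_markovLaw (hex x)).isMarkov
  have hA' : MeasurableSet A := 𝓖.le 0 _ hA
  have hmeas : Measurable (markovLaw P) := Measure.measurable_of_measurable_coe _
    fun S hS => measurable_markovLaw hex hS
  have key : (μ.restrict A).map g = ((μ.restrict A).map (fun ω => g ω 0)).bind (markovLaw P) := by
    refine ext_of_generate_finite (cylinders E) generateFrom_cylinders isPiSystem_cylinders ?_ ?_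
    · rintro _ ⟨F, B, hB, rfl⟩
      have hcyl : MeasurableSet (⋂ t ∈ F, (fun w : C(ℝ≥0, E) => w t) ⁻¹' B t) :=
        Finset.measurableSet_biInter _ fun t _ => measurable_eval t (hB t)
      obtain ⟨φ, hφ, h1, h2⟩ := h.exists_fdd hproc hB F 0 fun _ _ => zero_le
      have h3 : ∀ x, markovLaw P x (⋂ t ∈ F, (fun w : C(ℝ≥0, E) => w t) ⁻¹' B t) = φ x := by
        intro x
        have := h2 x univ MeasurableSet.univ
        rw [univ_inter, Measure.restrict_univ] at this
        rw [this, lintegral_congr_ae ((isMarkovLaw_markovLaw (hex x)).start.mono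
          fun w (hw : w 0 = x) => by rw [hw])]
        simp
      rw [Measure.map_apply hg hcyl, Measure.bind_apply hcyl hmeas.aemeasurable,
        lintegral_map (measurable_markovLaw hex hcyl) (h.measurable 0),
        Measure.restrict_apply (hg hcyl), inter_comm]
      simp only [h3]
      rw [← h1 A hA]
      congr 2
      ext ω
      simp
    · rw [Measure.map_apply hg MeasurableSet.univ, Measure.bind_apply MeasurableSet.univ
        hmeas.aemeasurable, lintegral_map (measurable_markovLaw hex MeasurableSet.univ)
        (h.measurable 0)]
      simp
  have := congrArg (fun m => m S) key
  rw [Measure.map_apply hg hS, Measure.bind_apply hS hmeas.aemeasurable,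
    lintegral_map (measurable_markovLaw hex hS) (h.measurable 0),
    Measure.restrict_apply (hg hS), inter_comm] at this
  exact this

end Laws

end Trajectories

/-! ### The Markov property of the point motions of a flow -/

section Flow

/-- `Y i` is a version of the trajectory `t ↦ ψ (s i) t (x i)`, where `D i = (s i, x i)`, extended
by `x i` to the left of `s i`. -/
structure IsVersionFamily {M Ω I : Type*} [MeasurableSpace M] [MeasurableSpace Ω] (μ : Measure Ω)
    (ψ : ℝ → ℝ → Ω → MeasMap M) (D : I → ℝ × M) (Y : I → ℝ → Ω → M) : Prop where
  measurable : ∀ i t, Measurable (Y i t)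
  before : ∀ i t ω, t ≤ (D i).1 → Y i t ω = (D i).2
  modification : ∀ i t, (D i).1 ≤ t → ∀ᵐ ω ∂μ, Y i t ω = (ψ (D i).1 t ω).1 (D i).2

/-- The `σ`-field generated by the family `Y` up to time `s`. -/
@[reducible]
def pastSigma {M Ω I : Type*} [MeasurableSpace M] (Y : I → ℝ → Ω → M) (s : ℝ) :
    MeasurableSpace Ω :=
  ⨆ q ∈ {q : I × ℝ | q.2 ≤ s}, MeasurableSpace.comap (Y q.1 q.2) inferInstance

lemma measurable_pastSigma {M Ω I : Type*} [MeasurableSpace M] (Y : I → ℝ → Ω → M) (i : I)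
    {r s : ℝ} (hr : r ≤ s) : Measurable[pastSigma Y s] (Y i r) := by
  rw [measurable_iff_comap_le]
  exact le_iSup₂_of_le (i, r) hr le_rfl

/-- The filtration generated by the family `Y` after time `a`. -/
def pastFiltration {M Ω I : Type*} [MeasurableSpace M] {mΩ : MeasurableSpace Ω}
    (Y : I → ℝ → Ω → M) (hY : ∀ i t, Measurable (Y i t)) (a : ℝ) : Filtration ℝ≥0 mΩ where
  seq t := pastSigma Y (a + t)
  mono' s t hst := biSup_mono fun q (hq : q.2 ≤ a + s) => by
    have : (s : ℝ) ≤ t := by exact_mod_cast hst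
    exact hq.trans (by linarith)
  le' _ := iSup₂_le fun q _ => (hY q.1 q.2).comap_le

/-- The `σ`-field generated by the first `k` increments of the flow along `τ`. -/
@[reducible]
def incrementSigma {M Ω : Type*} [MeasurableSpace M] (ψ : ℝ → ℝ → Ω → MeasMap M) (τ : ℕ → ℝ)
    (k : ℕ) : MeasurableSpace Ω :=
  ⨆ j ∈ {j : ℕ | j < k}, MeasurableSpace.comap (ψ (τ j) (τ (j + 1))) inferInstance

lemma incrementSigma_mono {M Ω : Type*} [MeasurableSpace M] (ψ : ℝ → ℝ → Ω → MeasMap M)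
    (τ : ℕ → ℝ) {k l : ℕ} (hkl : k ≤ l) : incrementSigma ψ τ k ≤ incrementSigma ψ τ l :=
  biSup_mono fun _ hj => lt_of_lt_of_le hj hkl

/-- The increments of a flow are independent along monotone sequences of times, so the finitely many
times involved in a past event are arranged in one, with s followed immediately by t. -/
lemma exists_grid (R : Finset ℝ) {s t : ℝ} (hs : s ∈ R) (hR : ∀ r ∈ R, r ≤ s) (hst : s ≤ t) :
    ∃ τ : ℕ → ℝ, Monotone τ ∧ ∃ k, τ k = s ∧ τ (k + 1) = t ∧ ∀ r ∈ R, ∃ a ≤ k, τ a = r := by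
  set c := R.card with hc
  have hc0 : 0 < c := Finset.card_pos.2 ⟨s, hs⟩
  set e := R.orderEmbOfFin hc.symm
  have he : ∀ j, e j ≤ s := fun j => hR _ (R.orderEmbOfFin_mem hc.symm j)
  have hr : ∀ r ∈ R, ∃ j, e j = r := fun r hr => by
    have : r ∈ range e := by rw [R.range_orderEmbOfFin hc.symm]; exact hr
    exact this
  refine ⟨fun j => if h : j < c then e ⟨j, h⟩ else t, ?_, c - 1, ?_, ?_, ?_⟩
  · intro i j hij
    by_cases hj : j < c
    · simp only [hj, lt_of_le_of_lt hij hj, dite_true]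
      exact e.monotone hij
    · simp only [hj, dite_false]
      split_ifs with hi
      · exact (he _).trans hst
      · exact le_rfl
  · have hlt : c - 1 < c := by omega
    simp only [hlt, dite_true]
    obtain ⟨j, hj⟩ := hr s hs
    refine le_antisymm (he _) ?_
    rw [← hj]
    exact e.monotone (Fin.le_def.2 (by have := j.2; simp only; omega))
  · have hnlt : ¬ (c - 1 + 1 < c) := by omega
    simp only [hnlt, dite_false]
  · intro r hrR
    obtain ⟨j, hj⟩ := hr r hrR
    exact ⟨j, by have := j.2; omega, by simp only [j.2, dite_true]; exact hj⟩

variable {M : Type*} [MetricSpace M] [ProperSpace M] [MeasurableSpace M] [BorelSpace M]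
  {P : (n : ℕ) → ℝ≥0 → Kernel (Fin n → M) (Fin n → M)}
  {Ω : Type*} {𝓘 : MeasurableSpace Ω} [mΩ : MeasurableSpace Ω] {μ : Measure Ω} [IsProbabilityMeasure μ]
  {ψ : ℝ → ℝ → Ω → MeasMap M}

omit [ProperSpace M] [BorelSpace M] [IsProbabilityMeasure μ] in
lemma IsStochasticFlow.measurable_apply (hψ : IsStochasticFlow P μ ψ) {s t : ℝ} (hst : s ≤ t)
    (x : M) : Measurable fun ω => (ψ s t ω).1 x :=
  (measurable_pi_apply x).comp (measurable_subtype_coe.comp (hψ.measurable s t hst))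

lemma measure_ext_of_C0 {E : Type*} [MetricSpace E] [ProperSpace E] [MeasurableSpace E]
    [BorelSpace E] {m₁ m₂ : Measure E} [IsFiniteMeasure m₁] [IsFiniteMeasure m₂]
    (h : ∀ f : C₀(E, ℝ), ∫ x, f x ∂m₁ = ∫ x, f x ∂m₂) : m₁ = m₂ := by
  refine Measure.ext_of_integral_eq_on_compactlySupported fun f => ?_
  exact h ⟨f.toContinuousMap, f.hasCompactSupport.is_zero_at_infty⟩

lemma IsStochasticFlow.map_eq (hψ : IsStochasticFlow P μ ψ)
    (hP : ∀ n, IsFellerTransition (P n)) {s t : ℝ} (hst : s ≤ t) {n : ℕ} (x : Fin n → M) :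
    μ.map (fun ω i => (ψ s t ω).1 (x i)) = P n (t - s).toNNReal x := by
  have := (hP n).markov (t - s).toNNReal
  have hm : Measurable fun ω i => (ψ s t ω).1 (x i) :=
    measurable_pi_lambda _ fun i => hψ.measurable_apply hst (x i)
  have := Measure.isProbabilityMeasure_map (μ := μ) hm.aemeasurable
  refine measure_ext_of_C0 fun f => ?_
  rw [integral_map hm.aemeasurable (map_continuous f).aestronglyMeasurable]
  exact hψ.finite_point_motion s t hst n x f

omit [ProperSpace M] [BorelSpace M] [IsProbabilityMeasure μ] in
/-- The maps `J` in the definition of a flow. -/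
lemma IsStochasticFlow.exists_J (hψ : IsStochasticFlow P μ ψ) :
    ∃ J : ℝ≥0 → MeasMap M × M → M, (∀ t, Measurable (J t)) ∧
    ∀ s t u, s ≤ t → t ≤ u → ∀ x : M,
      (∀ᵐ ω ∂μ, J (t - s).toNNReal (ψ s t ω, x) = (ψ s t ω).1 x) ∧
      (∀ᵐ ω ∂μ, (ψ s u ω).1 x = J (u - t).toNNReal (ψ t u ω, (ψ s t ω).1 x)) := hψ.flow

omit [ProperSpace M] [BorelSpace M] [IsProbabilityMeasure μ] in
lemma IsStochasticFlow.indep_past (hψ : IsStochasticFlow P μ ψ) {τ : ℕ → ℝ} (hτ : Monotone τ)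
    (k : ℕ) : Indep (incrementSigma ψ τ k)
      (MeasurableSpace.comap (ψ (τ k) (τ (k + 1))) inferInstance) μ := by
  have h1 := hψ.indep (k + 1) (fun i => τ i) fun i j hij => hτ hij
  have h2 : iIndep (fun i : Fin (k + 1) =>
      MeasurableSpace.comap (ψ (τ i) (τ (i + 1))) inferInstance) μ := h1
  have h3 := indep_iSup_of_disjoint (fun i : Fin (k + 1) =>
    (hψ.measurable (τ i) (τ (i + 1)) (hτ (Nat.le_succ _))).comap_le) h2
    (S := {i : Fin (k + 1) | (i : ℕ) < k}) (T := {Fin.last k}) (by simp)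
  refine indep_of_indep_of_le_right (indep_of_indep_of_le_left h3 ?_) ?_
  · refine iSup₂_le fun j hj => ?_
    have hj : j < k := hj
    exact le_iSup₂_of_le (⟨j, by omega⟩ : Fin (k + 1)) hj le_rfl
  · exact le_iSup₂_of_le (Fin.last k) rfl le_rfl

omit [ProperSpace M] [BorelSpace M] [IsProbabilityMeasure μ] in
/-- The random variables `ψ (τ a) (τ b) x` are determined, up to null sets, by the increments. -/
lemma IsStochasticFlow.exists_past_version (hψ : IsStochasticFlow P μ ψ) {τ : ℕ → ℝ}
    (hτ : Monotone τ) {a b : ℕ} (hab : a ≤ b) (x : M) : ∃ Y : Ω → M,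
      Measurable[incrementSigma ψ τ b] Y ∧
      ∀ᵐ ω ∂μ, Y ω = (ψ (τ a) (τ b) ω).1 x := by
  obtain ⟨J, hJ, hflow⟩ := hψ.exists_J
  induction b, hab using Nat.le_induction with
  | base => exact ⟨fun _ => x, measurable_const, Eventually.of_forall fun ω => (hψ.refl _ _ _).symm⟩
  | succ b hab ih =>
    obtain ⟨Y, hY, hYψ⟩ := ih
    refine ⟨fun ω => J (τ (b + 1) - τ b).toNNReal (ψ (τ b) (τ (b + 1)) ω, Y ω), ?_, ?_⟩
    · refine (hJ _).comp (Measurable.prodMk ?_ (hY.mono ?_ le_rfl))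
      · rw [measurable_iff_comap_le]
        exact le_iSup₂_of_le b (Nat.lt_succ_self b) le_rfl
      · exact incrementSigma_mono ψ τ (Nat.le_succ b)
    · filter_upwards [hYψ, (hflow (τ a) (τ b) (τ (b + 1)) (hτ hab) (hτ (Nat.le_succ b)) x).2]
        with ω h1 h2
      rw [h1, h2]

/-- The Markov property with respect to a `σ`-field which is independent of the flow. -/
lemma IsStochasticFlow.measure_inter_of_indep (hψ : IsStochasticFlow P μ ψ)
    (hP : ∀ n, IsFellerTransition (P n)) {J : ℝ≥0 → MeasMap M × M → M} (hJ : ∀ t, Measurable (J t))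
    (hJψ : ∀ s t, s ≤ t → ∀ x : M, ∀ᵐ ω ∂μ, J (t - s).toNNReal (ψ s t ω, x) = (ψ s t ω).1 x)
    {s t : ℝ} (hst : s ≤ t) (h𝓘 : 𝓘 ≤ mΩ)
    (hind : Indep 𝓘 (MeasurableSpace.comap (ψ s t) inferInstance) μ) {n : ℕ} {y : Ω → Fin n → M}
    (hy : Measurable[𝓘] y) {A : Set Ω} (hA : MeasurableSet[𝓘] A) {B : Set (Fin n → M)}
    (hB : MeasurableSet B) :
    μ (A ∩ {ω | (fun j => J (t - s).toNNReal (ψ s t ω, y ω j)) ∈ B}) =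
      ∫⁻ ω in A, P n (t - s).toNNReal (y ω) B ∂μ := by
  -- The event A is carried along as a `Prop`-valued coordinate. Independence then makes the law of
  -- (A, y) and `ψ s t` a product, and the jointly measurable J allows evaluation at the random
  -- point y.
  set X : Ω → Prop × (Fin n → M) := fun ω => (ω ∈ A, y ω) with hX
  have hX𝓘 : Measurable[𝓘] X := 
    Measurable.prodMk ((@measurableSet_setOfPred Ω 𝓘 (fun ω => ω ∈ A)).1 hA) hy
  have hXm : Measurable X := hX𝓘.mono h𝓘 le_rfl
  have hψm := hψ.measurable s t hst
  have hXψ : IndepFun X (ψ s t) μ := indep_of_indep_of_le_left hind hX𝓘.comap_le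
  have hmap := (indepFun_iff_map_prod_eq_prod_map_map hXm.aemeasurable hψm.aemeasurable).1 hXψ
  set S : Set ((Prop × (Fin n → M)) × MeasMap M) :=
    {q | q.1.1 ∧ (fun j => J (t - s).toNNReal (q.2, q.1.2 j)) ∈ B} with hS
  have hSm : MeasurableSet S := by
    refine MeasurableSet.inter (measurableSet_setOfPred.2 (measurable_fst.comp measurable_fst)) ?_
    refine (measurable_pi_lambda _ fun j => (hJ _).comp (measurable_snd.prodMk ?_)) hB
    exact (measurable_pi_apply j).comp (measurable_snd.comp measurable_fst)
  have h1 : μ (A ∩ {ω | (fun j => J (t - s).toNNReal (ψ s t ω, y ω j)) ∈ B}) =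
      μ.map (fun ω => (X ω, ψ s t ω)) S := by
    rw [Measure.map_apply (hXm.prodMk hψm) hSm]
    rfl
  have hdet : ∀ z : Fin n → M, μ.map (ψ s t) {m | (fun j => J (t - s).toNNReal (m, z j)) ∈ B} =
      P n (t - s).toNNReal z B := by
    intro z
    have hz : MeasurableSet {m : MeasMap M | (fun j => J (t - s).toNNReal (m, z j)) ∈ B} :=
      (measurable_pi_lambda _ fun j => (hJ _).comp (measurable_id.prodMk measurable_const)) hB
    rw [Measure.map_apply hψm hz, ← hψ.map_eq hP hst z, Measure.map_apply
      (measurable_pi_lambda _ fun i => hψ.measurable_apply hst (z i)) hB]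
    refine measure_congr ?_
    filter_upwards [ae_all_iff.2 fun j => hJψ s t hst (z j)] with ω hω
    refine eq_iff_iff.2 ?_
    change (fun j => J (t - s).toNNReal (ψ s t ω, z j)) ∈ B ↔ (fun i => (ψ s t ω).1 (z i)) ∈ B
    simp only [hω]
  rw [h1, hmap, Measure.prod_apply hSm, lintegral_map (measurable_measure_prodMk_left hSm) hXm,
    ← lintegral_indicator (h𝓘 _ hA)]
  refine lintegral_congr fun ω => ?_
  by_cases hω : ω ∈ A
  · rw [indicator_of_mem hω, ← hdet]
    congr 1
    ext m
    simp [hS, hX, hω]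
  · rw [indicator_of_notMem hω]
    have : Prod.mk (X ω) ⁻¹' S = ∅ := by
      ext m
      simp [hS, hX, hω]
    rw [this, measure_empty]

variable {I : Type*} {D : I → ℝ × M} {Y : I → ℝ → Ω → M}

/-- The Markov property relative to the past of the whole family, not only of the n chosen
trajectories. Past positions are, up to null sets, functions of increments before s, and these are
independent of `ψ s t`. -/
lemma IsVersionFamily.measure_inter (hY : IsVersionFamily μ ψ D Y) (hψ : IsStochasticFlow P μ ψ)
    (hP : ∀ n, IsFellerTransition (P n)) {n : ℕ} (idx : Fin n → I) {s t : ℝ}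
    (hs : ∀ j, (D (idx j)).1 ≤ s) (hst : s ≤ t) {A : Set Ω} (hA : MeasurableSet[pastSigma Y s] A)
    {B : Set (Fin n → M)} (hB : MeasurableSet B) :
    μ (A ∩ {ω | (fun j => Y (idx j) t ω) ∈ B}) =
      ∫⁻ ω in A, P n (t - s).toNNReal (fun j => Y (idx j) s ω) B ∂μ := by
  classical
  have hle : pastSigma Y s ≤ mΩ := iSup₂_le fun q _ => (hY.measurable q.1 q.2).comap_le
  have hTm : MeasurableSet {ω | (fun j => Y (idx j) t ω) ∈ B} :=
    (measurable_pi_lambda _ fun j => hY.measurable (idx j) t) hB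
  have hgm : Measurable fun ω => P n (t - s).toNNReal (fun j => Y (idx j) s ω) B :=
    (Kernel.measurable_coe _ hB).comp (measurable_pi_lambda _ fun j => hY.measurable (idx j) s)
  have := (hP n).markov (t - s).toNNReal
  obtain ⟨J, hJ, hflow⟩ := hψ.exists_J
  -- the claim for finite intersections
  have key : ∀ (F : Finset (I × ℝ)), (∀ q ∈ F, q.2 ≤ s) → ∀ C : I × ℝ → Set M,
      (∀ q, MeasurableSet (C q)) →
      μ ((⋂ q ∈ F, Y q.1 q.2 ⁻¹' C q) ∩ {ω | (fun j => Y (idx j) t ω) ∈ B}) =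
      ∫⁻ ω in ⋂ q ∈ F, Y q.1 q.2 ⁻¹' C q, P n (t - s).toNNReal (fun j => Y (idx j) s ω) B ∂μ := by
    intro F hF C hC
    -- The starting times belong to the grid, so that each trajectory is composed of increments
    -- along it. Times after s are dropped: a trajectory that has not started by s is constant up to
    -- s.
    set R : Finset ℝ := (insert s (F.image (fun q => q.2) ∪ F.image (fun q => (D q.1).1) ∪
      Finset.univ.image (fun j => (D (idx j)).1))).filter (· ≤ s) with hR
    obtain ⟨τ, hτ, k, hk, hk1, hτR⟩ := exists_grid R (s := s) (t := t)
      (by simp [hR]) (fun r hr => (Finset.mem_filter.1 hr).2) hst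
    have h𝓘 : incrementSigma ψ τ k ≤ mΩ := iSup₂_le fun j _ =>
      (hψ.measurable _ _ (hτ (Nat.le_succ j))).comap_le
    have hind : Indep (incrementSigma ψ τ k) (MeasurableSpace.comap (ψ s t) inferInstance) μ := by
      have := hψ.indep_past hτ k
      rwa [hk, hk1] at this
    have hver : ∀ (i : I) (r : ℝ), (D i).1 ∈ R → r ∈ R → ∃ Z : Ω → M, Measurable[incrementSigma ψ τ k] Z ∧
        ∀ᵐ ω ∂μ, Z ω = Y i r ω := by
      intro i r hi hr
      rcases le_total r (D i).1 with hri | hri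
      · exact ⟨fun _ => (D i).2, measurable_const,
          Eventually.of_forall fun ω => (hY.before i r ω hri).symm⟩
      obtain ⟨a, hak, ha⟩ := hτR _ hi
      obtain ⟨b, hbk, hb⟩ := hτR _ hr
      rcases hri.eq_or_lt with heq | hlt
      · exact ⟨fun _ => (D i).2, measurable_const,
          Eventually.of_forall fun ω => (hY.before i r ω heq.symm.le).symm⟩
      have hab : a ≤ b := by
        by_contra! hcon
        have := hτ hcon.le
        rw [ha, hb] at this
        linarith
      obtain ⟨Z, hZ, hZψ⟩ := hψ.exists_past_version hτ hab (D i).2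
      refine ⟨Z, hZ.mono (incrementSigma_mono ψ τ hbk) le_rfl, ?_⟩
      rw [ha, hb] at hZψ
      filter_upwards [hZψ, hY.modification i r hri] with ω h1 h2
      rw [h1, h2]
    have hver' : ∀ q, ∃ Z : Ω → M, q ∈ F → Measurable[incrementSigma ψ τ k] Z ∧
        ∀ᵐ ω ∂μ, Z ω = Y q.1 q.2 ω := by
      intro q
      by_cases hq : q ∈ F
      swap
      · exact ⟨Y q.1 q.2, fun h => absurd h hq⟩
      by_cases hi : (D q.1).1 ≤ s
      · obtain ⟨Z, hZ⟩ := hver q.1 q.2 (by rw [hR]; grind) (by rw [hR]; grind)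
        exact ⟨Z, fun _ => hZ⟩
      · exact ⟨fun _ => (D q.1).2, fun _ => ⟨measurable_const, Eventually.of_forall fun ω =>
          (hY.before q.1 q.2 ω ((hF q hq).trans (not_le.1 hi).le)).symm⟩⟩
    choose Z hZ using hver'
    have hidx : ∀ j, ∃ Z : Ω → M, Measurable[incrementSigma ψ τ k] Z ∧ ∀ᵐ ω ∂μ, Z ω = Y (idx j) s ω := fun j =>
      hver (idx j) s (by rw [hR]; have := hs j; simp [this]) (by simp [hR])
    choose W hWm hWe using hidx
    set A' : Set Ω := ⋂ q ∈ F, Z q ⁻¹' C q with hA'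
    have hA'm : MeasurableSet[incrementSigma ψ τ k] A' :=
      Finset.measurableSet_biInter _ fun q hq => (hZ q hq).1 (hC q)
    have hWm' : Measurable[incrementSigma ψ τ k] fun ω j => W j ω :=
      @measurable_pi_lambda _ _ _ (incrementSigma ψ τ k) _ _ hWm
    have hmain := hψ.measure_inter_of_indep hP hJ
      (fun s t hst x => (hflow s t t hst le_rfl x).1) hst h𝓘 hind hWm' hA'm hB
    have hAA' : (⋂ q ∈ F, Y q.1 q.2 ⁻¹' C q : Set Ω) =ᵐ[μ] A' := by
      have : ∀ᵐ ω ∂μ, ∀ q ∈ F, Z q ω = Y q.1 q.2 ω := by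
        rw [Filter.eventually_all_finset]
        exact fun q hq => (hZ q hq).2
      filter_upwards [this] with ω hω
      refine eq_iff_iff.2 ?_
      change ω ∈ (⋂ q ∈ F, Y q.1 q.2 ⁻¹' C q : Set Ω) ↔ ω ∈ A'
      simp only [hA', mem_iInter, mem_preimage]
      exact forall₂_congr fun q hq => by rw [hω q hq]
    have hWall := ae_all_iff.2 hWe
    rw [setLIntegral_congr hAA']
    calc _ = μ (A' ∩ {ω | (fun j => J (t - s).toNNReal (ψ s t ω, W j ω)) ∈ B}) := by
          refine measure_congr (hAA'.inter ?_)
          have hYt : ∀ j, ∀ᵐ ω ∂μ, Y (idx j) t ω = J (t - s).toNNReal (ψ s t ω, Y (idx j) s ω) := by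
            intro j
            filter_upwards [hY.modification (idx j) t ((hs j).trans hst),
              hY.modification (idx j) s (hs j), (hflow _ s t (hs j) hst (D (idx j)).2).2]
              with ω h1 h2 h3
            rw [h1, h2, h3]
          filter_upwards [hWall, ae_all_iff.2 hYt] with ω h1 h2
          refine eq_iff_iff.2 ?_
          change (fun j => Y (idx j) t ω) ∈ B ↔
            (fun j => J (t - s).toNNReal (ψ s t ω, W j ω)) ∈ B
          simp only [h1, h2]
      _ = _ := hmain
      _ = _ := by
          refine lintegral_congr_ae (ae_restrict_of_ae ?_)
          filter_upwards [hWall] with ω h1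
          simp only [h1]
  -- extension to the generated `σ`-field
  set m₁ := (μ.restrict {ω | (fun j => Y (idx j) t ω) ∈ B}).trim hle with hm₁
  set m₂ := (μ.withDensity fun ω => P n (t - s).toNNReal (fun j => Y (idx j) s ω) B).trim hle
    with hm₂
  have hm : m₁ = m₂ := by
    have heq : ∀ C, MeasurableSet[pastSigma Y s] C →
        μ (C ∩ {ω | (fun j => Y (idx j) t ω) ∈ B}) =
          ∫⁻ ω in C, P n (t - s).toNNReal (fun j => Y (idx j) s ω) B ∂μ → m₁ C = m₂ C := by
      intro C hC hCe
      rw [hm₁, hm₂, trim_measurableSet_eq hle hC, trim_measurableSet_eq hle hC,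
        Measure.restrict_apply (hle _ hC), withDensity_apply _ (hle _ hC)]
      exact hCe
    have hgen := generateFrom_piiUnionInter_measurableSet
      (fun q : I × ℝ => MeasurableSpace.comap (Y q.1 q.2) inferInstance) {q : I × ℝ | q.2 ≤ s}
    refine @ext_of_generate_finite _ (pastSigma Y s) m₁ m₂ _ hgen.symm
      (isPiSystem_piiUnionInter _ (fun q => @MeasurableSpace.isPiSystem_measurableSet _ (_)) _) ?_ ?_ ?_
    · rw [hm₁]; infer_instance
    · rintro C hC
      refine heq C (measurableSet_iSup_of_mem_piiUnionInter _ _ _ hC) ?_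
      obtain ⟨F, hF, f, hf, rfl⟩ := hC
      choose! g hg hgf using hf
      have e : (⋂ q ∈ F, f q) = ⋂ q ∈ F, Y q.1 q.2 ⁻¹' (if q ∈ F then g q else univ) := by
        refine iInter₂_congr fun q hq => ?_
        rw [if_pos hq, hgf q hq]
      rw [e]
      refine key F (fun q hq => hF hq) _ fun q => ?_
      split_ifs with hq
      · exact hg q hq
      · exact MeasurableSet.univ
    · refine heq _ MeasurableSet.univ ?_
      have := key ∅ (by simp) (fun _ => univ) (fun _ => MeasurableSet.univ)
      simpa using this
  have := congrArg (fun m => m A) hm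
  simp only [hm₁, hm₂] at this
  rw [trim_measurableSet_eq hle hA, trim_measurableSet_eq hle hA,
    Measure.restrict_apply (hle _ hA), withDensity_apply _ (hle _ hA)] at this
  exact this

/-- The point motions of a flow are Markov processes. -/
lemma IsVersionFamily.isMarkov (hY : IsVersionFamily μ ψ D Y)
    (hψ : IsStochasticFlow P μ ψ) (hP : ∀ n, IsFellerTransition (P n)) {n : ℕ} (idx : Fin n → I)
    {a : ℝ} (ha : ∀ j, (D (idx j)).1 ≤ a) :
    IsMarkov μ (pastFiltration Y hY.measurable a) (P n)
      (fun t ω j => Y (idx j) (a + t) ω) where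
  adapted t := @measurable_pi_lambda _ _ _ (pastSigma Y (a + t)) _ _
    fun j => measurable_pastSigma Y (idx j) le_rfl
  markov s t A B hA hB := by
    have h := hY.measure_inter hψ hP idx (s := a + s) (t := a + (s + t : ℝ≥0))
      (fun j => (ha j).trans (by simp)) (by push_cast; simp [← add_assoc]) hA hB
    have e : (a + ((s + t : ℝ≥0) : ℝ) - (a + s)).toNNReal = t := by
      push_cast
      rw [show a + ((s : ℝ) + t) - (a + s) = t by ring, Real.toNNReal_coe]
    rw [e] at h
    exact h

end Flow

/-! ### Estimates for Feller processes -/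

section Feller

variable {E : Type*} [MetricSpace E] [ProperSpace E] [MeasurableSpace E] [BorelSpace E]

/-- A continuous function which vanishes outside a compact set. -/
def C0OfClosedBall (f : C(E, ℝ)) (o : E) (R : ℝ) (hf : ∀ y, R < dist y o → f y = 0) : C₀(E, ℝ) :=
  ⟨f, by
    refine tendsto_const_nhds.congr' ?_
    filter_upwards [(isCompact_closedBall o R).compl_mem_cocompact] with y hy
    rw [mem_compl_iff, Metric.mem_closedBall, not_le] at hy
    exact (hf y hy).symm⟩

omit [MeasurableSpace E] [BorelSpace E] in
lemma exists_bump (o : E) {a b : ℝ} (hab : a < b) : ∃ f : C₀(E, ℝ), (∀ y, 0 ≤ f y) ∧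
    (∀ y, f y ≤ 1) ∧ (∀ y, dist y o ≤ a → f y = 1) ∧ ∀ y, b ≤ dist y o → f y = 0 := by
  have hba : 0 < b - a := sub_pos.2 hab
  let g : C(E, ℝ) := ⟨fun y => max 0 (min 1 ((b - dist y o) / (b - a))), by fun_prop⟩
  have hg0 : ∀ y, b ≤ dist y o → g y = 0 := fun y hy => by
    refine max_eq_left ((min_le_right _ _).trans ?_)
    exact div_nonpos_of_nonpos_of_nonneg (by linarith) hba.le
  refine ⟨C0OfClosedBall g o b fun y hy => hg0 y hy.le, fun y => le_max_left _ _,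
    fun y => max_le zero_le_one (min_le_left _ _), fun y hy => ?_, hg0⟩
  have : (1 : ℝ) ≤ (b - dist y o) / (b - a) := by
    rw [le_div_iff₀ hba]
    linarith
  change max 0 (min 1 ((b - dist y o) / (b - a))) = 1
  rw [min_eq_left this, max_eq_right zero_le_one]

omit [ProperSpace E] [MeasurableSpace E] [BorelSpace E] in
lemma exists_truncation (f : C₀(E, ℝ)) {c : ℝ} (hc : 0 < c) : ∃ g : C₀(E, ℝ), (∀ y, 0 ≤ g y) ∧
    (∀ y, g y ≤ 1) ∧ (∀ y, 2 * c ≤ f y → g y = 1) ∧ ∀ y, f y ≤ c → g y = 0 := by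
  have hg0 : ∀ y, f y ≤ c → max 0 (min 1 ((f y - c) / c)) = 0 := fun y hy => by
    refine max_eq_left ((min_le_right _ _).trans ?_)
    exact div_nonpos_of_nonpos_of_nonneg (by linarith) hc.le
  have hf : Continuous f := map_continuous f
  refine ⟨⟨⟨fun y => max 0 (min 1 ((f y - c) / c)), by fun_prop⟩, ?_⟩, fun y => le_max_left _ _,
    fun y => max_le zero_le_one (min_le_left _ _), fun y hy => ?_, hg0⟩
  · refine tendsto_const_nhds.congr' ?_
    filter_upwards [(zero_at_infty f).eventually (gt_mem_nhds hc)] with y hy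
    exact (hg0 y hy.le).symm
  · have : (1 : ℝ) ≤ (f y - c) / c := by
      rw [le_div_iff₀ hc]
      linarith
    change max 0 (min 1 ((f y - c) / c)) = 1
    rw [min_eq_left this, max_eq_right zero_le_one]

omit [ProperSpace E] in
lemma integrable_C0 (f : C₀(E, ℝ)) (m : Measure E) [IsFiniteMeasure m] : Integrable f m :=
  BoundedContinuousFunction.integrable m f.toBCF

lemma measure_le_integral {m : Measure E} [IsFiniteMeasure m] (f : C₀(E, ℝ)) (h0 : ∀ y, 0 ≤ f y)
    {B : Set E} (hB : MeasurableSet B) {c : ℝ} (hc : 0 < c) (h1 : ∀ y ∈ B, c ≤ f y) :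
    m B ≤ ENNReal.ofReal ((∫ y, f y ∂m) / c) := by
  rw [← integral_div, ofReal_integral_eq_lintegral_ofReal ((integrable_C0 f m).div_const c)
    (Eventually.of_forall fun y => div_nonneg (h0 y) hc.le), ← lintegral_indicator_one hB]
  refine lintegral_mono fun y => ?_
  by_cases hy : y ∈ B
  · rw [indicator_of_mem hy, Pi.one_apply, ENNReal.one_le_ofReal, le_div_iff₀ hc, one_mul]
    exact h1 y hy
  · rw [indicator_of_notMem hy]
    exact zero_le

variable {P : ℝ≥0 → Kernel E E}

omit [ProperSpace E] [BorelSpace E] in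
lemma IsFellerTransition.continuous_integral (hP : IsFellerTransition P) (f : C₀(E, ℝ)) (t : ℝ≥0) :
    Continuous fun z => ∫ y, f y ∂(P t z) := by
  obtain ⟨g, hg⟩ := hP.maps_C0 t f
  simp only [hg]
  exact map_continuous g

/-- The difference is the integral of `P u f - f` under `P s z`, and probability measures do not
increase the sup norm. So strong continuity at time 0 is uniform in s and z. -/
lemma IsFellerTransition.exists_uniform (hP : IsFellerTransition P) (f : C₀(E, ℝ)) {η : ℝ}
    (hη : 0 < η) : ∃ h : ℝ≥0, 0 < h ∧ ∀ s u, u ≤ h → ∀ z,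
      |∫ y, f y ∂(P (s + u) z) - ∫ y, f y ∂(P s z)| ≤ η := by
  have h1 := Metric.tendstoUniformly_iff.1 (hP.strongly_continuous f) η hη
  obtain ⟨h, hh, hsub⟩ := mem_nhdsGT_iff_exists_Ioc_subset.1 h1
  refine ⟨h, hh, fun s u hu z => ?_⟩
  have := hP.markov s
  have := hP.markov u
  have := hP.markov (s + u)
  rcases eq_zero_or_pos u with rfl | hu0
  · simp [hη.le]
  have hu' : ∀ y, |∫ y', f y' ∂(P u y) - f y| ≤ η := fun y => by
    have : u ∈ {x : ℝ≥0 | ∀ y, dist (f y) (∫ y', f y' ∂(P x y)) < η} := hsub ⟨hu0, hu⟩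
    have := this y
    rw [dist_comm, Real.dist_eq] at this
    exact this.le
  obtain ⟨g, hg⟩ := hP.maps_C0 u f
  have e : ∫ y, f y ∂(P (s + u) z) = ∫ y, g y ∂(P s z) := by
    have hint : Integrable f ((P u ∘ₖ P s) z) := by
      rw [← hP.semigroup]
      exact integrable_C0 f _
    rw [hP.semigroup, Kernel.integral_comp hint]
    simp only [hg]
  rw [e, ← integral_sub (integrable_C0 g _) (integrable_C0 f _)]
  calc |∫ y, (g y - f y) ∂(P s z)| ≤ ∫ y, |g y - f y| ∂(P s z) := abs_integral_le_integral_abs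
    _ ≤ ∫ _, η ∂(P s z) := by
        refine integral_mono ((integrable_C0 g _).sub (integrable_C0 f _)).abs
          (integrable_const _) fun y => ?_
        rw [← hg]
        exact hu' y
    _ = η := by simp

lemma IsFellerTransition.continuous_integral_prod (hP : IsFellerTransition P) (f : C₀(E, ℝ)) :
    Continuous fun q : ℝ≥0 × E => ∫ y, f y ∂(P q.1 q.2) := by
  rw [continuous_iff_continuousAt]
  rintro ⟨t, z⟩
  rw [ContinuousAt, Metric.tendsto_nhds]
  intro ε hε
  obtain ⟨h, hh, hu⟩ := hP.exists_uniform f (show (0 : ℝ) < ε / 2 by positivity)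
  have h1 : ∀ᶠ z' in 𝓝 z, dist (∫ y, f y ∂(P t z')) (∫ y, f y ∂(P t z)) < ε / 2 :=
    Metric.tendsto_nhds.1 (hP.continuous_integral f t).continuousAt _ (by positivity)
  have h2 : ∀ᶠ t' in 𝓝 t, dist t' t < h := Metric.ball_mem_nhds t (by exact_mod_cast hh)
  rw [nhds_prod_eq]
  filter_upwards [h2.prod_mk h1] with ⟨t', z'⟩ ⟨h3, h4⟩
  have h5 : dist (∫ y, f y ∂(P t' z')) (∫ y, f y ∂(P t z')) ≤ ε / 2 := by
    rw [NNReal.dist_eq] at h3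
    rcases le_total t t' with htt | htt
    · have hle : t' - t ≤ h := by
        rw [← NNReal.coe_le_coe, NNReal.coe_sub htt]
        exact (le_abs_self _).trans h3.le
      have := hu t (t' - t) hle z'
      rwa [add_tsub_cancel_of_le htt, ← Real.dist_eq] at this
    · have hle : t - t' ≤ h := by
        rw [← NNReal.coe_le_coe, NNReal.coe_sub htt]
        rw [abs_sub_comm] at h3
        exact (le_abs_self _).trans h3.le
      have := hu t' (t - t') hle z'
      rwa [add_tsub_cancel_of_le htt, ← Real.dist_eq, dist_comm] at this
  calc _ ≤ _ := dist_triangle _ (∫ y, f y ∂(P t z')) _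
    _ < ε / 2 + ε / 2 := add_lt_add_of_le_of_lt h5 h4
    _ = ε := add_halves ε

/-- Supplies the bound 1/2 that is required by `IsMarkov.first_entry_le_two_mul`. -/
lemma IsFellerTransition.measure_le_half (hP : IsFellerTransition P) (f : C₀(E, ℝ))
    (hf0 : ∀ y, 0 ≤ f y) {t : ℝ≥0} {z : E} (hz : ∫ y, f y ∂(P t z) ≤ 1 / 2) {B : Set E}
    (hB : MeasurableSet B) (hfB : ∀ y ∈ B, f y = 1) : P t z B ≤ 2⁻¹ := by
  have := hP.markov t
  refine (measure_le_integral f hf0 hB one_pos fun y hy => (hfB y hy).ge).trans ?_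
  rw [div_one]
  calc _ ≤ ENNReal.ofReal (1 / 2) := ENNReal.ofReal_le_ofReal hz
    _ = 2⁻¹ := by
      rw [one_div, ENNReal.ofReal_inv_of_pos (by norm_num)]
      simp

/-- A point far away from a given ball is unlikely to reach it up to time `T`. -/
lemma IsFellerTransition.exists_far (hP : IsFellerTransition P) (f : C₀(E, ℝ)) (o : E) (T : ℝ≥0) :
    ∃ R : ℝ, ∀ s ≤ T, ∀ z, R < dist z o → ∫ y, f y ∂(P s z) ≤ 1 / 2 := by
  -- At the finitely many multiples of h up to T the integral is below 1/4 off a compact set;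
  -- between neighbouring multiples it changes by at most 1/4.
  obtain ⟨h, hh, hu⟩ := hP.exists_uniform f (show (0 : ℝ) < 1 / 4 by norm_num)
  choose g hg using fun t => hP.maps_C0 t f
  have h1 : ∀ᶠ z in cocompact E, ∀ i ∈ Finset.range (⌊T / h⌋₊ + 1), g (i * h) z < 1 / 4 := by
    rw [Filter.eventually_all_finset]
    exact fun i _ => (zero_at_infty (g (i * h))).eventually (gt_mem_nhds (by norm_num))
  obtain ⟨K, hK, hKs⟩ := mem_cocompact.1 h1
  obtain ⟨R, hR⟩ := hK.isBounded.subset_closedBall o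
  refine ⟨R, fun s hs z hz => ?_⟩
  have hzK : z ∈ Kᶜ := fun hc => by
    have := hR hc
    rw [Metric.mem_closedBall] at this
    linarith
  have h2 := hKs hzK
  set i := ⌊s / h⌋₊ with hi
  have hiT : i ∈ Finset.range (⌊T / h⌋₊ + 1) := by
    rw [Finset.mem_range]
    exact Nat.lt_succ_of_le (Nat.floor_mono (by gcongr))
  have h3 : (i : ℝ≥0) * h ≤ s := by
    have := Nat.floor_le (zero_le (a := s / h))
    rwa [le_div_iff₀ hh] at this
  have h4 : s - i * h ≤ h := by
    have := (Nat.lt_floor_add_one (s / h)).le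
    rw [div_le_iff₀ hh, add_mul, one_mul] at this
    rw [tsub_le_iff_left]
    exact this
  have h5 := hu (i * h) (s - i * h) h4 z
  rw [add_tsub_cancel_of_le h3, hg (i * h) z] at h5
  have h6 : g (i * h) z < 1 / 4 := h2 i hiT
  have := (abs_le.1 h5).2
  linarith

namespace IsMarkov

variable {Ω : Type*} {mΩ : MeasurableSpace Ω} {μ : Measure Ω} [IsProbabilityMeasure μ]
  {𝓖 : Filtration ℝ≥0 mΩ} {Z : ℝ≥0 → Ω → E}

/-- The filtration after time `a`. -/
def _root_.CoalescingFlow.shiftFiltration {Ω : Type*} {mΩ : MeasurableSpace Ω}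
    (𝓖 : Filtration ℝ≥0 mΩ) (a : ℝ≥0) : Filtration ℝ≥0 mΩ where
  seq t := 𝓖 (a + t)
  mono' _ _ hst := 𝓖.mono (by gcongr)
  le' _ := 𝓖.le _

omit [MetricSpace E] [ProperSpace E] [BorelSpace E] [IsProbabilityMeasure μ] in
lemma shift (h : IsMarkov μ 𝓖 P Z) (a : ℝ≥0) :
    IsMarkov μ (shiftFiltration 𝓖 a) P (fun t => Z (a + t)) where
  adapted t := h.adapted (a + t)
  markov s t A B hA hB := by
    have := h.markov (a + s) t A B hA hB
    rwa [add_assoc] at this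

/-- Compact containment. -/
lemma exists_containment (h : IsMarkov μ 𝓖 P Z) (hP : IsFellerTransition P) (o : E)
    (T : ℝ≥0) {ε : ℝ≥0∞} (hε : ε ≠ 0) : ∃ R : ℝ, ∀ C : Set ℝ≥0, C.Countable → (∀ t ∈ C, t ≤ T) →
      μ (⋃ t ∈ C, Z t ⁻¹' (Metric.closedBall o R)ᶜ) ≤ ε := by
  have hε2 : ε / 2 ≠ 0 := by simpa using hε
  obtain ⟨n, hn⟩ : ∃ n : ℕ, μ (Z T ⁻¹' (Metric.closedBall o n)ᶜ) ≤ ε / 2 := by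
    have hanti : Antitone fun n : ℕ => Z T ⁻¹' (Metric.closedBall o n)ᶜ := fun m n hmn =>
      preimage_mono (compl_subset_compl.2 (Metric.closedBall_subset_closedBall (by exact_mod_cast hmn)))
    have hlim := tendsto_measure_iInter_atTop (μ := μ) (fun n : ℕ =>
      (h.measurable T Metric.isClosed_closedBall.measurableSet.compl).nullMeasurableSet) hanti
      ⟨0, measure_ne_top _ _⟩
    have hempty : ⋂ n : ℕ, Z T ⁻¹' (Metric.closedBall o n)ᶜ = ∅ := by
      refine eq_empty_of_forall_notMem fun ω hω => ?_
      obtain ⟨n, hn⟩ := exists_nat_ge (dist (Z T ω) o)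
      exact mem_iInter.1 hω n (Metric.mem_closedBall.2 hn)
    rw [hempty, measure_empty] at hlim
    exact (hlim.eventually (ge_mem_nhds (pos_iff_ne_zero.2 hε2))).exists
  obtain ⟨f, hf0, -, hf1, -⟩ := exists_bump o (show (n : ℝ) < n + 1 by linarith)
  obtain ⟨R, hR⟩ := hP.exists_far f o T
  refine ⟨R, fun C hC hCT => ?_⟩
  -- From outside radius R there is at most an even chance to be back in the ball of radius n at
  -- time T. Leaving the large ball is therefore at most twice as likely as being outside the small
  -- one at T.
  have h1 := h.first_entry_le_two_mul (T := T) (U := fun _ => (Metric.closedBall o R)ᶜ)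
    (fun _ => Metric.isClosed_closedBall.measurableSet.compl)
    (B := Metric.closedBall o n) Metric.isClosed_closedBall.measurableSet hC hCT
    (fun t _ z hz => hP.measure_le_half f hf0
      (hR (T - t) tsub_le_self z (by simpa using hz))
      Metric.isClosed_closedBall.measurableSet fun y hy => hf1 y hy) (A := univ) MeasurableSet.univ
  rw [univ_inter, univ_inter] at h1
  calc _ ≤ _ := h1
    _ ≤ 2 * (ε / 2) := by gcongr
    _ = ε := ENNReal.mul_div_cancel (by simp) (by simp)

/-- The time interval is cut into steps of length h₀. Within a step the maximal inequality refers
the event f ≥ 2c to the event f > c at the end of the step, which Markov's inequality bounds. A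
supremum over time is thus controlled by finitely many expectations. -/
lemma measure_sup_le (h : IsMarkov μ 𝓖 P Z) (hP : IsFellerTransition P) (f : C₀(E, ℝ))
    (hf0 : ∀ y, 0 ≤ f y) {c : ℝ} (hc : 0 < c) (T : ℝ≥0) {h₀ : ℝ≥0}
    (hh : 0 < h₀) (hu : ∀ u ≤ h₀, ∀ z, 2 * c ≤ f z → P u z {y | f y ≤ c} ≤ 2⁻¹) {z₀ : E}
    (hz : ∀ ω, Z 0 ω = z₀) {C : Set ℝ≥0} (hC : C.Countable) (hCT : ∀ t ∈ C, t ≤ T) :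
    μ (⋃ t ∈ C, Z t ⁻¹' {y | 2 * c ≤ f y}) ≤ ∑ i ∈ Finset.range (⌊T / h₀⌋₊ + 1),
      2 * ENNReal.ofReal ((∫ y, f y ∂(P ((i + 1) * h₀) z₀)) / c) := by
  have hfc : Continuous f := map_continuous f
  have hU : MeasurableSet {y | 2 * c ≤ f y} := (isClosed_le continuous_const hfc).measurableSet
  have hB : MeasurableSet {y | f y ≤ c} := (isClosed_le hfc continuous_const).measurableSet
  have hsub : (⋃ t ∈ C, Z t ⁻¹' {y | 2 * c ≤ f y}) ⊆ ⋃ i ∈ Finset.range (⌊T / h₀⌋₊ + 1),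
      ⋃ u ∈ {u : ℝ≥0 | i * h₀ + u ∈ C ∧ u ≤ h₀}, Z (i * h₀ + u) ⁻¹' {y | 2 * c ≤ f y} := by
    refine iUnion₂_subset fun t ht ω hω => ?_
    have h3 : (⌊t / h₀⌋₊ : ℝ≥0) * h₀ ≤ t := by
      have := Nat.floor_le (zero_le (a := t / h₀))
      rwa [le_div_iff₀ hh] at this
    have h4 : t - ⌊t / h₀⌋₊ * h₀ ≤ h₀ := by
      have := (Nat.lt_floor_add_one (t / h₀)).le
      rw [div_le_iff₀ hh, add_mul, one_mul] at this
      rw [tsub_le_iff_left]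
      exact this
    have h5 := add_tsub_cancel_of_le h3
    refine mem_biUnion (x := ⌊t / h₀⌋₊) ?_ (mem_biUnion (x := t - ⌊t / h₀⌋₊ * h₀) ⟨?_, h4⟩ ?_)
    · have := hCT t ht
      exact Finset.mem_coe.2 (Finset.mem_range.2 (Nat.lt_succ_of_le (Nat.floor_mono (by gcongr))))
    · rwa [h5]
    · rwa [h5]
  refine (measure_mono hsub).trans ((measure_biUnion_finset_le _ _).trans
    (Finset.sum_le_sum fun i _ => ?_))
  have hinj : Function.Injective fun u : ℝ≥0 => (i : ℝ≥0) * h₀ + u := add_right_injective _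
  have h1 := (h.shift (i * h₀)).first_entry_le_two_mul (T := h₀) (U := fun _ => {y | 2 * c ≤ f y})
    (fun _ => hU) hB (C := {u : ℝ≥0 | i * h₀ + u ∈ C ∧ u ≤ h₀})
    ((hC.preimage hinj).mono fun u hu => hu.1) (fun u hu => hu.2)
    (fun u _ z hz => hu _ tsub_le_self z hz) (A := univ) MeasurableSet.univ
  rw [univ_inter, univ_inter] at h1
  refine h1.trans ?_
  gcongr
  have e : (i : ℝ≥0) * h₀ + h₀ = (i + 1) * h₀ := by ring
  have := hP.markov ((i + 1) * h₀)
  have h2 := h.markov 0 ((i + 1) * h₀) univ {y | f y ≤ c}ᶜ MeasurableSet.univ hB.compl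
  rw [univ_inter, zero_add, Measure.restrict_univ] at h2
  rw [e, h2]
  simp only [hz, lintegral_const, measure_univ, mul_one]
  exact measure_le_integral f hf0 hB.compl hc fun y hy =>
    (not_le.1 (show ¬ f y ≤ c from hy)).le

/-- In a short time, a Markov process that satisfies (TF3) does not move far. -/
lemma _root_.CoalescingFlow.IsFellerTransition.exists_small_time (hP : IsFellerTransition P)
    (hT : ∀ K : Set E, IsCompact K → ∀ r : ℝ, 0 < r →
      Tendsto (fun t : ℝ≥0 => (t : ℝ≥0∞)⁻¹ * ⨆ x ∈ K, P t x {y | r < dist x y}) (𝓝[>] 0) (𝓝 0))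
    {Ω : Type*} {mΩ : MeasurableSpace Ω} (μ : Measure Ω) [IsProbabilityMeasure μ]
    {K : Set E} (hK : IsCompact K) {r : ℝ} (hr : 0 < r) {κ : ℝ≥0} (hκ : 0 < κ) :
    ∃ h₀ : ℝ≥0, 0 < h₀ ∧ ∀ h : ℝ≥0, 0 < h → h ≤ h₀ → ∀ (𝓖 : Filtration ℝ≥0 mΩ) (Z : ℝ≥0 → Ω → E),
      IsMarkov μ 𝓖 P Z → ∀ C : Set ℝ≥0, C.Countable → (∀ t ∈ C, t ≤ h) →
      μ ({ω | Z 0 ω ∈ K ∧ ∃ t ∈ C, r < dist (Z t ω) (Z 0 ω)}) ≤ κ * h := by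
  -- The radii are nested around fixed centres c: the process starts within r/8 of c, and a
  -- displacement by r takes it to distance at least r/2. From there it is back within r/4 at time h
  -- with probability at most 1/2. Being outside r/4 at time h requires a displacement beyond r/8,
  -- which is what (TF3) controls.
  obtain ⟨F, -, hF⟩ := hK.elim_nhds_subcover (fun c => Metric.ball c (r / 8))
    fun c _ => Metric.ball_mem_nhds c (by positivity)
  have hbump := fun c : E => exists_bump c (show r / 4 < r / 2 by linarith)
  choose f hf0 hf1 hfB hfU using hbump
  have hunif := fun c : E => hP.exists_uniform (f c) (show (0 : ℝ) < 1 / 2 by norm_num)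
  choose hc hc0 hcu using hunif
  -- The divisor pays for the factor 2 of the maximal inequality and for the sum over F; the summand
  -- 1 keeps it positive.
  set κ' : ℝ≥0 := κ / (2 * F.card + 1) with hκ'
  have hκ'0 : 0 < κ' := by positivity
  have hev : ∀ᶠ t : ℝ≥0 in 𝓝[>] 0, (⨆ x ∈ K, P t x {y | r / 8 < dist x y}) ≤ κ' * t := by
    filter_upwards [(hT K hK (r / 8) (by positivity)).eventually
      (ge_mem_nhds (show (0 : ℝ≥0∞) < κ' by exact_mod_cast hκ'0)), self_mem_nhdsWithin] with t ht ht0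
    have ht0' : (t : ℝ≥0∞) ≠ 0 := by exact_mod_cast (ne_of_gt ht0)
    calc (⨆ x ∈ K, P t x {y | r / 8 < dist x y})
        = t * ((t : ℝ≥0∞)⁻¹ * ⨆ x ∈ K, P t x {y | r / 8 < dist x y}) := by
          rw [← mul_assoc, ENNReal.mul_inv_cancel ht0' (by simp), one_mul]
      _ ≤ t * κ' := by gcongr
      _ = _ := mul_comm _ _
  have hev2 : ∀ᶠ t : ℝ≥0 in 𝓝[>] 0, ∀ c ∈ F, t ≤ hc c := by
    rw [Filter.eventually_all_finset]
    intro c _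
    filter_upwards [Ioc_mem_nhdsGT (hc0 c)] with t ht using ht.2
  obtain ⟨h₀, hh₀, hsub⟩ := mem_nhdsGT_iff_exists_Ioc_subset.1 (hev.and hev2)
  refine ⟨h₀, hh₀, fun h hh0 hh 𝓖 Z hZ C hC hCh => ?_⟩
  obtain ⟨hsup, hhc⟩ := hsub ⟨hh0, hh⟩
  have hcover : {ω | Z 0 ω ∈ K ∧ ∃ t ∈ C, r < dist (Z t ω) (Z 0 ω)} ⊆
      ⋃ c ∈ F, (Z 0 ⁻¹' (K ∩ Metric.ball c (r / 8))) ∩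
        ⋃ t ∈ C, Z t ⁻¹' {y | r / 2 ≤ dist y c} := by
    rintro ω ⟨hω, t, ht, hd⟩
    obtain ⟨c, hc, hωc⟩ := mem_iUnion₂.1 (hF hω)
    refine mem_biUnion (Finset.mem_coe.2 hc) ⟨⟨hω, hωc⟩, mem_biUnion ht ?_⟩
    have := dist_triangle_right (Z t ω) (Z 0 ω) c
    rw [Metric.mem_ball] at hωc
    change r / 2 ≤ dist (Z t ω) c
    linarith
  refine (measure_mono hcover).trans ((measure_biUnion_finset_le _ _).trans ?_)
  have hone : ∀ c ∈ F, μ ((Z 0 ⁻¹' (K ∩ Metric.ball c (r / 8))) ∩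
      ⋃ t ∈ C, Z t ⁻¹' {y | r / 2 ≤ dist y c}) ≤ 2 * (κ' * h) := by
    intro c hcF
    have hA : MeasurableSet[𝓖 0] (Z 0 ⁻¹' (K ∩ Metric.ball c (r / 8))) :=
      hZ.adapted 0 (hK.isClosed.measurableSet.inter Metric.isOpen_ball.measurableSet)
    have hUm : MeasurableSet {y | r / 2 ≤ dist y c} :=
      (isClosed_le continuous_const (continuous_id.dist continuous_const)).measurableSet
    have hBm : MeasurableSet (Metric.closedBall c (r / 4)) := Metric.isClosed_closedBall.measurableSet
    have h1 := hZ.first_entry_le_two_mul (T := h) (U := fun _ => {y | r / 2 ≤ dist y c})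
      (fun _ => hUm) hBm hC hCh (fun t _ z hz => by
        refine hP.measure_le_half (f c) (hf0 c) ?_ hBm fun y hy => hfB c y hy
        have h2 := hcu c 0 (h - t) (tsub_le_self.trans (hhc c hcF)) z
        rw [zero_add, hP.zero, Kernel.id_apply, integral_dirac, hfU c z hz, sub_zero] at h2
        exact (le_abs_self _).trans h2) hA
    refine h1.trans ?_
    gcongr
    have hM := hP.markov h
    calc _ ≤ κ' * h * μ (Z 0 ⁻¹' (K ∩ Metric.ball c (r / 8))) := by
          refine hZ.measure_inter_preimage_le zero_le hA hBm.compl fun ω hω => ?_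
          rw [tsub_zero]
          refine le_trans (le_trans (measure_mono ?_) (le_iSup₂ (f := fun x (_ : x ∈ K) =>
            P h x {y | r / 8 < dist x y}) (Z 0 ω) hω.1)) hsup
          intro y hy
          have h3 : r / 4 < dist y c := by simpa using hy
          have h4 : dist (Z 0 ω) c < r / 8 := hω.2
          have := dist_triangle_left y c (Z 0 ω)
          change r / 8 < dist (Z 0 ω) y
          linarith
      _ ≤ κ' * h * 1 := by gcongr; exact prob_le_one
      _ = _ := mul_one _
  calc _ ≤ ∑ _ ∈ F, 2 * ((κ' : ℝ≥0∞) * h) := Finset.sum_le_sum hone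
    _ = ((F.card * (2 * (κ' * h)) : ℝ≥0) : ℝ≥0∞) := by simp
    _ ≤ ((κ * h : ℝ≥0) : ℝ≥0∞) := by
        rw [ENNReal.coe_le_coe]
        calc (F.card : ℝ≥0) * (2 * (κ' * h)) = (2 * F.card * κ') * h := by ring
          _ ≤ ((2 * F.card + 1) * κ') * h := by gcongr; simp
          _ = κ * h := by rw [hκ', mul_div_cancel₀ _ (by positivity)]
    _ = _ := by simp

/-- Uniform continuity along countably many times. -/
lemma ae_uniformContinuous (h : IsMarkov μ 𝓖 P Z) (hP : IsFellerTransition P)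
    (hT : ∀ K : Set E, IsCompact K → ∀ r : ℝ, 0 < r →
      Tendsto (fun t : ℝ≥0 => (t : ℝ≥0∞)⁻¹ * ⨆ x ∈ K, P t x {y | r < dist x y}) (𝓝[>] 0) (𝓝 0))
    {C : Set ℝ≥0} (hC : C.Countable) (T : ℕ) {r : ℝ} (hr : 0 < r) :
    ∀ᵐ ω ∂μ, ∃ d : ℝ, 0 < d ∧ ∀ u ∈ C, ∀ v ∈ C, u ≤ T → v ≤ T → dist u v < d →
      dist (Z u ω) (Z v ω) ≤ r := by
  rcases isEmpty_or_nonempty E with hE | ⟨⟨o⟩⟩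
  · exact Eventually.of_forall fun ω => (hE.false (Z 0 ω)).elim
  have key : ∀ ε : ℝ≥0, 0 < ε → μ {ω | ¬ ∃ d : ℝ, 0 < d ∧ ∀ u ∈ C, ∀ v ∈ C, u ≤ T → v ≤ T →
      dist u v < d → dist (Z u ω) (Z v ω) ≤ r} ≤ ε := by
    intro ε hε
    obtain ⟨R, hR⟩ := h.exists_containment hP o T
      (show ((ε / 2 : ℝ≥0) : ℝ≥0∞) ≠ 0 by exact_mod_cast (half_pos hε).ne')
    obtain ⟨h₀, hh₀, hsm⟩ := hP.exists_small_time hT μ (isCompact_closedBall o R)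
      (show 0 < r / 2 by positivity) (show 0 < ε / (4 * (T + 1)) by positivity)
    -- Windows of length 2d start at the multiples of d, so two times less than d apart lie in a
    -- common window. The n + 1 windows have total length at most 2(T + 1), hence total failure
    -- probability at most ε/2.
    set d : ℝ≥0 := min (h₀ / 2) 1 with hd
    have hd0 : 0 < d := lt_min (by positivity) one_pos
    have h2d : 2 * d ≤ h₀ := by
      calc 2 * d ≤ 2 * (h₀ / 2) := by gcongr; exact min_le_left _ _
        _ = h₀ := by rw [mul_div_cancel₀ _ (by norm_num)]
    set n := ⌊(T : ℝ≥0) / d⌋₊ with hn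
    have hnd : (n : ℝ≥0) * d ≤ T := by
      have := Nat.floor_le (zero_le (a := (T : ℝ≥0) / d))
      rwa [le_div_iff₀ hd0] at this
    set G : Set ℝ≥0 := {t | t ≤ T} ∩ range (fun i : ℕ => (i : ℝ≥0) * d) with hG
    have hsub : {ω | ¬ ∃ d : ℝ, 0 < d ∧ ∀ u ∈ C, ∀ v ∈ C, u ≤ T → v ≤ T →
        dist u v < d → dist (Z u ω) (Z v ω) ≤ r} ⊆
        (⋃ t ∈ G, Z t ⁻¹' (Metric.closedBall o R)ᶜ) ∪ ⋃ i ∈ Finset.range (n + 1),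
        {ω | Z (i * d + 0) ω ∈ Metric.closedBall o R ∧ ∃ u ∈ {u : ℝ≥0 | i * d + u ∈ C ∧ u ≤ 2 * d},
          r / 2 < dist (Z (i * d + u) ω) (Z (i * d + 0) ω)} := by
      intro ω hω
      by_contra hcon
      rw [mem_union, not_or] at hcon
      obtain ⟨h1, h2⟩ := hcon
      simp only [mem_iUnion, not_exists] at h1 h2
      refine hω ⟨d, by exact_mod_cast hd0, ?_⟩
      have main : ∀ u ∈ C, ∀ v ∈ C, u ≤ T → v ≤ T → u ≤ v → dist u v < d →
          dist (Z u ω) (Z v ω) ≤ r := by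
        intro u hu v hv huT hvT huv huvd
        set i := ⌊u / d⌋₊ with hi
        have h3 : (i : ℝ≥0) * d ≤ u := by
          have := Nat.floor_le (zero_le (a := u / d))
          rwa [le_div_iff₀ hd0] at this
        have h4 : u ≤ i * d + d := by
          have := (Nat.lt_floor_add_one (u / d)).le
          rwa [div_le_iff₀ hd0, add_mul, one_mul] at this
        have hin : i ∈ Finset.range (n + 1) :=
          Finset.mem_range.2 (Nat.lt_succ_of_le (Nat.floor_mono (by gcongr)))
        have h5 : v ≤ u + d := by
          rw [dist_comm, NNReal.dist_eq] at huvd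
          rw [← NNReal.coe_le_coe, NNReal.coe_add]
          linarith [le_abs_self ((v : ℝ) - u)]
        have hK : Z (i * d + 0) ω ∈ Metric.closedBall o R := by
          by_contra hK
          exact h1 (i * d) ⟨h3.trans huT, i, rfl⟩ (by simpa using hK)
        have hi2 := h2 i hin
        have key : ∀ w ∈ C, i * d ≤ w → w ≤ i * d + 2 * d →
            dist (Z w ω) (Z (i * d + 0) ω) ≤ r / 2 := by
          intro w hw hw1 hw2
          by_contra! hcon
          refine hi2 ⟨hK, w - i * d, ⟨?_, ?_⟩, ?_⟩
          · rwa [add_tsub_cancel_of_le hw1]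
          · rwa [tsub_le_iff_left]
          · rwa [add_tsub_cancel_of_le hw1]
        have e : (i : ℝ≥0) * d + d + d = i * d + 2 * d := by ring
        have h6 := key u hu h3 (h4.trans (by rw [← e]; exact le_self_add))
        have h7 := key v hv (h3.trans huv) (h5.trans (by rw [← e]; gcongr))
        have := dist_triangle_right (Z u ω) (Z v ω) (Z (i * d + 0) ω)
        linarith
      intro u hu v hv huT hvT huv
      rcases le_total u v with hle | hle
      · exact main u hu v hv huT hvT hle huv
      · rw [dist_comm] at huv ⊢
        exact main v hv u hu hvT huT hle huv
    refine (measure_mono hsub).trans ((measure_union_le _ _).trans ?_)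
    have hbound2 : ∀ i ∈ Finset.range (n + 1),
        μ {ω | Z (i * d + 0) ω ∈ Metric.closedBall o R ∧
          ∃ u ∈ {u : ℝ≥0 | i * d + u ∈ C ∧ u ≤ 2 * d},
          r / 2 < dist (Z (i * d + u) ω) (Z (i * d + 0) ω)} ≤
        ((ε / (4 * (T + 1)) * (2 * d) : ℝ≥0) : ℝ≥0∞) := by
      intro i _
      have := hsm (2 * d) (by positivity) h2d _ _ (h.shift (i * d))
        {u : ℝ≥0 | i * d + u ∈ C ∧ u ≤ 2 * d}
        ((hC.preimage (add_right_injective ((i : ℝ≥0) * d))).mono fun u hu => hu.1)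
        (fun u hu => hu.2)
      simpa using this
    calc _ ≤ ((ε / 2 : ℝ≥0) : ℝ≥0∞) +
          ∑ _ ∈ Finset.range (n + 1), ((ε / (4 * (T + 1)) * (2 * d) : ℝ≥0) : ℝ≥0∞) :=
          add_le_add (hR G ((countable_range _).mono inter_subset_right) fun t ht => ht.1)
            ((measure_biUnion_finset_le _ _).trans (Finset.sum_le_sum hbound2))
      _ = ((ε / 2 + (n + 1) * (ε / (4 * (T + 1)) * (2 * d)) : ℝ≥0) : ℝ≥0∞) := by
          rw [Finset.sum_const, Finset.card_range, nsmul_eq_mul]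
          push_cast
          rfl
      _ ≤ (ε : ℝ≥0∞) := by
          rw [ENNReal.coe_le_coe]
          calc ε / 2 + (n + 1) * (ε / (4 * (T + 1)) * (2 * d))
              = ε / 2 + (n * d + d) * (ε / (2 * (T + 1))) := by
                field_simp
                ring
            _ ≤ ε / 2 + (T + 1) * (ε / (2 * (T + 1))) := by
                gcongr
                exact min_le_right _ _
            _ = ε := by
                field_simp
                norm_num
  rw [ae_iff]
  by_contra hne
  obtain ⟨ε, hε0, hε⟩ := ENNReal.lt_iff_exists_nnreal_btwn.1 (pos_iff_ne_zero.2 hne)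
  exact absurd (key ε (by exact_mod_cast hε0)) (not_le.2 hε)

end IsMarkov

end Feller

/-! ### Continuous versions of the trajectories -/

section Versions

variable {M : Type*} [MetricSpace M] [ProperSpace M] [MeasurableSpace M] [BorelSpace M]
  {P : (n : ℕ) → ℝ≥0 → Kernel (Fin n → M) (Fin n → M)}
  {Ω : Type*} [mΩ : MeasurableSpace Ω] {μ : Measure Ω} [IsProbabilityMeasure μ]
  {ψ : ℝ → ℝ → Ω → MeasMap M}

omit [ProperSpace M] [BorelSpace M] in
lemma dist_fin_one (x y : Fin 1 → M) : dist x y = dist (x 0) (y 0) := by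
  rw [dist_pi_def]
  simp

lemma TF3.tendsto (hTF3 : TF3 P) (K : Set (Fin 1 → M)) (hK : IsCompact K) (r : ℝ) (hr : 0 < r) :
    Tendsto (fun t : ℝ≥0 => (t : ℝ≥0∞)⁻¹ * ⨆ x ∈ K, P 1 t x {y | r < dist x y}) (𝓝[>] 0) (𝓝 0) := by
  have h := hTF3 ((fun x : Fin 1 → M => x 0) '' K) (hK.image (continuous_apply 0)) r hr
  refine tendsto_of_tendsto_of_tendsto_of_le_of_le tendsto_const_nhds h (fun _ => zero_le) ?_
  intro t
  dsimp only
  gcongr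
  refine iSup₂_le fun x hx => ?_
  have e : x = fun _ => x 0 := funext fun i => by rw [Subsingleton.elim i 0]
  have e2 : {y : Fin 1 → M | r < dist x y} = {y | r < dist (x 0) (y 0)} := by
    ext y
    simp only [mem_ofPred_eq, dist_fin_one]
  rw [e2]
  conv_lhs => rw [e]
  exact le_iSup₂ (f := fun (x : M) (_ : x ∈ (fun x : Fin 1 → M => x 0) '' K) =>
    P 1 t (fun _ => x) {y | r < dist x (y 0)}) (x 0) ⟨x, hx, rfl⟩

lemma exists_tendsto_of_uniform {F : ℚ → M}
    (hF : ∀ (T : ℕ) (k : ℕ), ∃ d : ℝ, 0 < d ∧ ∀ u v : ℚ, |(u : ℝ)| ≤ T → |(v : ℝ)| ≤ T →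
      dist (u : ℝ) v < d → dist (F u) (F v) ≤ 1 / ((k : ℝ) + 1)) (b : ℝ) :
    ∃ c, Tendsto F (comap (fun q : ℚ => (q : ℝ)) (𝓝 b)) (𝓝 c) := by
  have hne : (comap (fun q : ℚ => (q : ℝ)) (𝓝 b)).NeBot :=
    Rat.isDenseEmbedding_coe_real.isDenseInducing.comap_nhds_neBot b
  apply CompleteSpace.complete
  rw [Metric.cauchy_iff]
  refine ⟨hne.map _, fun ε hε => ?_⟩
  obtain ⟨k, hk⟩ := exists_nat_one_div_lt hε
  obtain ⟨T, hT⟩ := exists_nat_ge (|b| + 1)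
  obtain ⟨d, hd, hdF⟩ := hF T k
  refine ⟨F '' ((fun q : ℚ => (q : ℝ)) ⁻¹' Metric.ball b (min (d / 2) 1)),
    image_mem_map (preimage_mem_comap (Metric.ball_mem_nhds b (lt_min (by positivity) one_pos))), ?_⟩
  rintro _ ⟨u, hu, rfl⟩ _ ⟨v, hv, rfl⟩
  have hb : ∀ w : ℚ, (w : ℝ) ∈ Metric.ball b (min (d / 2) 1) → |(w : ℝ)| ≤ T ∧ dist (w : ℝ) b < d / 2 := by
    intro w hw
    have h1 : dist (w : ℝ) b < d / 2 := lt_of_lt_of_le hw (min_le_left _ _)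
    have h2 : dist (w : ℝ) b < 1 := lt_of_lt_of_le hw (min_le_right _ _)
    rw [Real.dist_eq] at h2
    have := abs_sub_abs_le_abs_sub (w : ℝ) b
    exact ⟨by linarith, h1⟩
  have := dist_triangle_right (u : ℝ) v b
  exact (hdF u v (hb u hu).1 (hb v hv).1 (by linarith [(hb u hu).2, (hb v hv).2])).trans_lt hk

/-- Every trajectory of the flow has a continuous modification. -/
lemma IsStochasticFlow.exists_continuous_version (hψ : IsStochasticFlow P μ ψ)
    (hP : ∀ n, IsFellerTransition (P n)) (hTF3 : TF3 P) (s : ℝ) (x : M) :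
    ∃ Y : Ω → C(ℝ, M), (∀ t, Measurable fun ω => Y ω t) ∧ (∀ ω t, t ≤ s → Y ω t = x) ∧
      ∀ t, s ≤ t → ∀ᵐ ω ∂μ, Y ω t = (ψ s t ω).1 x := by
  classical
  set Y₀ : Unit → ℝ → Ω → M := fun _ t ω => if t ≤ s then x else (ψ s t ω).1 x with hY₀
  have hver : IsVersionFamily μ ψ (fun _ => (s, x)) Y₀ := by
    refine ⟨fun _ t => ?_, fun _ t ω ht => if_pos ht, fun _ t ht => Eventually.of_forall fun ω => ?_⟩
    · by_cases ht : t ≤ s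
      · simp only [hY₀, ht, if_true]
        exact measurable_const
      · simp only [hY₀, ht, if_false]
        exact hψ.measurable_apply (not_le.1 ht).le x
    · simp only [hY₀]
      split_ifs with h
      · have : t = s := le_antisymm h ht
        subst this
        exact (hψ.refl _ _ _).symm
      · rfl
  have hZ := hver.isMarkov hψ hP (n := 1) (fun _ => ()) (a := s) fun _ => le_rfl
  -- the modulus of continuity along countably many times
  have hmod : ∀ C : Set ℝ, C.Countable → ∀ᵐ ω ∂μ, ∀ (T : ℕ) (k : ℕ), ∃ d : ℝ, 0 < d ∧
      ∀ u ∈ C, ∀ v ∈ C, |u| ≤ T → |v| ≤ T → dist u v < d →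
      dist (Y₀ () u ω) (Y₀ () v ω) ≤ 1 / ((k : ℝ) + 1) := by
    intro C hC
    obtain ⟨N, hN⟩ := exists_nat_ge |s|
    have h1 : ∀ T k : ℕ, ∀ᵐ ω ∂μ, ∃ d : ℝ, 0 < d ∧ ∀ u ∈ (fun u : ℝ => (u - s).toNNReal) '' C,
        ∀ v ∈ (fun u : ℝ => (u - s).toNNReal) '' C, u ≤ (T + N : ℕ) → v ≤ (T + N : ℕ) →
        dist u v < d → dist (fun _ : Fin 1 => Y₀ () (s + u) ω) (fun _ => Y₀ () (s + v) ω) ≤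
          1 / ((k : ℝ) + 1) := fun T k =>
      hZ.ae_uniformContinuous (hP 1) hTF3.tendsto (hC.image _) (T + N) (by positivity)
    filter_upwards [ae_all_iff.2 fun T => ae_all_iff.2 (h1 T)] with ω hω T k
    obtain ⟨d, hd, hdu⟩ := hω T k
    refine ⟨d, hd, fun u hu v hv huT hvT huv => ?_⟩
    have hle : ∀ w : ℝ, |w| ≤ T → (w - s).toNNReal ≤ (T + N : ℕ) := fun w hw => by
      rw [Real.toNNReal_le_iff_le_coe]
      push_cast
      have := abs_le.1 hw
      have := abs_le.1 hN
      linarith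
    have hY : ∀ w : ℝ, Y₀ () (s + (w - s).toNNReal) ω = Y₀ () w ω := fun w => by
      rcases le_total w s with h | h
      · rw [Real.toNNReal_of_nonpos (by linarith), hver.before () w ω h,
          hver.before () _ ω (by simp)]
      · rw [Real.coe_toNNReal _ (by linarith)]
        rw [add_sub_cancel]
    have hd' : dist (u - s).toNNReal (v - s).toNNReal < d := by
      refine lt_of_le_of_lt ?_ huv
      rw [NNReal.dist_eq, Real.coe_toNNReal', Real.coe_toNNReal', Real.dist_eq]
      refine (abs_max_sub_max_le_abs _ _ _).trans ?_
      rw [sub_sub_sub_cancel_right]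
    have := hdu _ ⟨u, hu, rfl⟩ _ ⟨v, hv, rfl⟩ (hle u huT) (hle v hvT) hd'
    rwa [dist_fin_one, hY, hY] at this
  set Q : Set ℝ := range fun q : ℚ => (q : ℝ) with hQ
  set bad : Set Ω := {ω | ¬ ∀ (T : ℕ) (k : ℕ), ∃ d : ℝ, 0 < d ∧
      ∀ u ∈ Q, ∀ v ∈ Q, |u| ≤ T → |v| ≤ T → dist u v < d →
      dist (Y₀ () u ω) (Y₀ () v ω) ≤ 1 / ((k : ℝ) + 1)} with hbad
  have hbad0 : μ bad = 0 := hmod Q (countable_range _)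
  -- A measurable set on which the trajectory extends continuously from the rational times;
  -- elsewhere Y is the constant path, so that Y is measurable everywhere.
  set G : Set Ω := (toMeasurable μ bad)ᶜ with hG
  have hGm : MeasurableSet G := (measurableSet_toMeasurable _ _).compl
  have hGae : ∀ᵐ ω ∂μ, ω ∈ G := by
    rw [ae_iff]
    simp only [hG, mem_compl_iff, not_not]
    exact (measure_toMeasurable bad).trans hbad0
  have hlim : ∀ ω ∈ G, ∀ b : ℝ, ∃ c, Tendsto (fun q : ℚ => Y₀ () q ω)
      (comap (fun q : ℚ => (q : ℝ)) (𝓝 b)) (𝓝 c) := by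
    intro ω hω b
    refine exists_tendsto_of_uniform (fun T k => ?_) b
    have : ω ∉ bad := fun h => hω (subset_toMeasurable μ bad h)
    simp only [hbad, mem_ofPred_eq, not_not] at this
    obtain ⟨d, hd, h⟩ := this T k
    exact ⟨d, hd, fun u v hu hv huv => h _ ⟨u, rfl⟩ _ ⟨v, rfl⟩ hu hv huv⟩
  have hdi := Rat.isDenseEmbedding_coe_real.isDenseInducing
  have hx : Nonempty M := ⟨x⟩
  set Y : Ω → C(ℝ, M) := fun ω => if h : ω ∈ G then
    ⟨hdi.extend (fun q : ℚ => Y₀ () q ω), hdi.continuous_extend (hlim ω h)⟩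
    else ContinuousMap.const ℝ x with hY
  have hYlim : ∀ ω ∈ G, ∀ (q : ℕ → ℚ) (b : ℝ), Tendsto (fun k => (q k : ℝ)) atTop (𝓝 b) →
      Tendsto (fun k => Y₀ () (q k) ω) atTop (𝓝 (Y ω b)) := by
    intro ω hω q b hq
    obtain ⟨c, hc⟩ := hlim ω hω b
    have e : Y ω b = c := by
      simp only [hY, hω, dite_true]
      exact hdi.extend_eq_of_tendsto hc
    rw [e]
    exact hc.comp (tendsto_comap_iff.2 hq)
  refine ⟨Y, fun t => ?_, fun ω t ht => ?_, fun t ht => ?_⟩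
  · obtain ⟨q, -, -, hq⟩ := Real.exists_seq_rat_strictMono_tendsto t
    refine measurable_of_tendsto_metrizable (f := fun k ω => if ω ∈ G then Y₀ () (q k) ω else x)
      (fun k => Measurable.ite hGm (hver.measurable () _) measurable_const) ?_
    rw [tendsto_pi_nhds]
    intro ω
    by_cases hω : ω ∈ G
    · simpa only [hω, if_true] using hYlim ω hω q t hq
    · simp [hω, hY]
  · by_cases hω : ω ∈ G
    · obtain ⟨q, -, hqt, hq⟩ := Real.exists_seq_rat_strictMono_tendsto t
      refine tendsto_nhds_unique (hYlim ω hω q t hq) ?_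
      have : ∀ k, Y₀ () (q k) ω = x := fun k => hver.before () _ ω ((hqt k).le.trans ht)
      simp only [this]
      exact tendsto_const_nhds
    · simp [hω, hY]
  -- The time t is adjoined to the rational times: the modulus of continuity along the enlarged set
  -- forces the value at t to be the limit of the values at rational times.
  · filter_upwards [hGae, hmod (insert t Q) ((countable_range _).insert t),
      hver.modification () t ht] with ω hω h1 h2
    rw [← h2]
    obtain ⟨q, -, -, hq⟩ := Real.exists_seq_rat_strictMono_tendsto t
    refine tendsto_nhds_unique (hYlim ω hω q t hq) ?_
    rw [Metric.tendsto_atTop]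
    intro ε hε
    obtain ⟨k, hk⟩ := exists_nat_one_div_lt hε
    obtain ⟨T, hT⟩ := exists_nat_ge (|t| + 1)
    obtain ⟨d, hd, hdu⟩ := h1 T k
    obtain ⟨n, hn⟩ := Metric.tendsto_atTop.1 hq (min d 1) (lt_min hd one_pos)
    refine ⟨n, fun m hm => (hdu _ (mem_insert_of_mem _ ⟨q m, rfl⟩) _ (mem_insert _ _) ?_ ?_
      ((hn m hm).trans_le (min_le_left _ _))).trans_lt hk⟩
    · have h3 := (hn m hm).trans_le (min_le_right _ _)
      rw [Real.dist_eq] at h3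
      have := abs_sub_abs_le_abs_sub (q m : ℝ) t
      linarith
    · linarith

/-- The trajectory of several continuous paths from time `a` on. -/
def jointPath {n : ℕ} (y : Fin n → C(ℝ, M)) (a : ℝ) : C(ℝ≥0, Fin n → M) :=
  ⟨fun t j => y j (a + t), by fun_prop⟩

variable {I : Type*} {D : I → ℝ × M} {Y : I → Ω → C(ℝ, M)}

lemma IsVersionFamily.isMarkov_jointPath
    (hY : IsVersionFamily μ ψ D (fun i t ω => Y i ω t)) (hψ : IsStochasticFlow P μ ψ)
    (hP : ∀ n, IsFellerTransition (P n)) {n : ℕ} (idx : Fin n → I) {a : ℝ}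
    (ha : ∀ j, (D (idx j)).1 ≤ a) :
    IsMarkov μ (pastFiltration (fun i t ω => Y i ω t) hY.measurable a) (P n)
      (fun t ω => jointPath (fun j => Y (idx j) ω) a t) :=
  hY.isMarkov hψ hP idx ha

lemma IsVersionFamily.measurable_jointPath
    (hY : IsVersionFamily μ ψ D (fun i t ω => Y i ω t)) {n : ℕ} (idx : Fin n → I) (a : ℝ) :
    Measurable fun ω => jointPath (fun j => Y (idx j) ω) a :=
  measurable_continuousMap_iff.2 fun _ => measurable_pi_lambda _ fun j => hY.measurable (idx j) _

/-- Continuous versions of the trajectories which start at time `0`. -/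
lemma IsStochasticFlow.exists_version_zero (hψ : IsStochasticFlow P μ ψ)
    (hP : ∀ n, IsFellerTransition (P n)) (hTF3 : TF3 P) : ∃ X : M → Ω → C(ℝ, M),
      IsVersionFamily μ ψ (fun x : M => ((0 : ℝ), x)) (fun x t ω => X x ω t) := by
  choose X h1 h2 h3 using hψ.exists_continuous_version hP hTF3 0
  exact ⟨X, ⟨h1, fun i t ω ht => h2 i ω t ht, h3⟩⟩

/-- Ensures that `markovLaw` is not the default value 0. The law is realized by the continuous
n-point motion of the flow itself. -/
lemma IsStochasticFlow.exists_isMarkovLaw (hψ : IsStochasticFlow P μ ψ)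
    (hP : ∀ n, IsFellerTransition (P n)) (hTF3 : TF3 P) {n : ℕ} (z : Fin n → M) :
    ∃ Q, IsMarkovLaw (P n) z Q := by
  obtain ⟨X, hX⟩ := hψ.exists_version_zero hP hTF3
  exact ⟨_, (hX.isMarkov_jointPath hψ hP z (a := 0) fun _ => le_rfl).isMarkovLaw_map
    fun ω => funext fun j => hX.before (z j) _ ω (by simp)⟩

/-! ### Continuity of the laws of the two-point motions -/

/-- A function in `C₀` that vanishes exactly on the diagonal. -/
def gapFun (o : M) : C₀(Fin 2 → M, ℝ) :=
  ⟨⟨fun z => min (dist (z 0) (z 1)) 1 / (1 + dist z fun _ => o), by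
      refine Continuous.div (by fun_prop) (by fun_prop) fun z => ?_
      have := dist_nonneg (x := z) (y := fun _ => o)
      positivity⟩, by
    have h1 : Tendsto (fun z : Fin 2 → M => 1 / (1 + dist z fun _ => o)) (cocompact _) (𝓝 0) :=
      tendsto_const_nhds.div_atTop
        (tendsto_atTop_add_const_left _ _ (tendsto_dist_right_cocompact_atTop _))
    refine squeeze_zero (fun z => ?_) (fun z => ?_) h1
    · exact div_nonneg (le_min dist_nonneg zero_le_one) (by positivity)
    · exact div_le_div_of_nonneg_right (min_le_right _ _) (by positivity)⟩

lemma gapFun_apply (o : M) (z : Fin 2 → M) :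
    gapFun o z = min (dist (z 0) (z 1)) 1 / (1 + dist z fun _ => o) := rfl

lemma gapFun_nonneg (o : M) (z : Fin 2 → M) : 0 ≤ gapFun o z :=
  div_nonneg (le_min dist_nonneg zero_le_one) (by positivity)

lemma gapFun_eq_zero_iff (o : M) (z : Fin 2 → M) : gapFun o z = 0 ↔ z 0 = z 1 := by
  have h : (0 : ℝ) < 1 + dist z fun _ => o := by positivity
  rw [gapFun_apply, div_eq_zero_iff, or_iff_left h.ne']
  constructor
  · intro h1
    rw [← dist_eq_zero]
    rcases min_choice (dist (z 0) (z 1)) 1 with h2 | h2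
    · rwa [h2] at h1
    · rw [h2] at h1
      norm_num at h1
  · intro h1
    simp [h1]

lemma TF2.integral_gapFun (hTF2 : TF2 P) (hP : ∀ n, IsFellerTransition (P n)) (o x : M) (t : ℝ≥0) :
    ∫ z, gapFun o z ∂(P 2 t ![x, x]) = 0 := by
  have := (hP 2).markov t
  have hcl : MeasurableSet {y : Fin 2 → M | y 0 = y 1} :=
    (isClosed_eq (continuous_apply 0) (continuous_apply 1)).measurableSet
  have h : ∀ᵐ z ∂(P 2 t ![x, x]), z 0 = z 1 := by
    rw [ae_iff]
    have := (prob_compl_eq_zero_iff hcl).2 (hTF2 x t)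
    exact this
  rw [integral_eq_zero_of_ae]
  filter_upwards [h] with z hz
  exact (gapFun_eq_zero_iff o z).2 hz

/-- Paths that start close to each other stay close to each other, with large probability. -/
lemma IsVersionFamily.exists_gap_le {X : M → Ω → C(ℝ, M)}
    (hX : IsVersionFamily μ ψ (fun x : M => ((0 : ℝ), x)) (fun x t ω => X x ω t))
    (hψ : IsStochasticFlow P μ ψ) (hP : ∀ n, IsFellerTransition (P n)) (hTF2 : TF2 P) (o x : M)
    (T : ℕ) {c : ℝ} (hc : 0 < c) {η : ℝ≥0∞} (hη : 0 < η) : ∃ r : ℝ, 0 < r ∧ ∀ y, dist y x < r →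
      μ {ω | ∃ t : ℝ, 0 ≤ t ∧ t < T ∧ 2 * c < gapFun o ![X x ω t, X y ω t]} ≤ η := by
  obtain ⟨g, hg0, hgle, hg1, hgz⟩ := exists_truncation (gapFun o) hc
  obtain ⟨h₀, hh₀, hu⟩ := (hP 2).exists_uniform g (show (0 : ℝ) < 1 / 2 by norm_num)
  have hfc : Continuous (gapFun o) := map_continuous _
  have hB : MeasurableSet {z | gapFun o z ≤ c} := (isClosed_le hfc continuous_const).measurableSet
  -- The truncation g is 1 where the gap is at least 2c and 0 where it is at most c. Up to time h₀
  -- its expectation drops from 1 by at most 1/2.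
  have hhalf : ∀ u ≤ h₀, ∀ z, 2 * c ≤ gapFun o z → P 2 u z {y | gapFun o y ≤ c} ≤ 2⁻¹ := by
    intro u hu' z hz
    have := (hP 2).markov u
    have h1 := hu 0 u hu' z
    rw [zero_add, (hP 2).zero, Kernel.id_apply, integral_dirac, hg1 z hz] at h1
    have h2 : (1 : ℝ) / 2 ≤ ∫ y, g y ∂(P 2 u z) := by linarith [(abs_le.1 h1).1]
    have hint := integrable_C0 g (P 2 u z)
    have h3 : ∫ y, g y ∂(P 2 u z) ≤ (P 2 u z).real {y | gapFun o y ≤ c}ᶜ := by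
      rw [← integral_indicator_one hB.compl]
      refine integral_mono hint ((integrable_const (1 : ℝ)).indicator hB.compl) fun y => ?_
      by_cases hy : gapFun o y ≤ c
      · rw [hgz y hy]
        exact indicator_nonneg (fun _ _ => zero_le_one) _
      · rw [indicator_of_mem (show y ∈ {y | gapFun o y ≤ c}ᶜ from hy)]
        exact hgle y
    rw [measureReal_compl hB, probReal_univ] at h3
    have h4 : (P 2 u z).real {y | gapFun o y ≤ c} ≤ 1 / 2 := by linarith
    rw [measureReal_def] at h4
    calc _ = ENNReal.ofReal ((P 2 u z) {y | gapFun o y ≤ c}).toReal :=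
          (ENNReal.ofReal_toReal (measure_ne_top _ _)).symm
      _ ≤ ENNReal.ofReal (1 / 2) := ENNReal.ofReal_le_ofReal h4
      _ = 2⁻¹ := by
        rw [one_div, ENNReal.ofReal_inv_of_pos (by norm_num)]
        simp
  -- Finitely many expected gaps, each continuous in y by the Feller property and zero at y = x by
  -- (TF2).
  have hlim : Tendsto (fun y : M => ∑ i ∈ Finset.range (⌊(T : ℝ≥0) / h₀⌋₊ + 1),
      2 * ENNReal.ofReal ((∫ z, gapFun o z ∂(P 2 ((i + 1) * h₀) ![x, y])) / c)) (𝓝 x) (𝓝 0) := by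
    have hpair : Continuous fun y : M => (![x, y] : Fin 2 → M) := by fun_prop
    have : (0 : ℝ≥0∞) = ∑ i ∈ Finset.range (⌊(T : ℝ≥0) / h₀⌋₊ + 1),
      2 * ENNReal.ofReal ((∫ z, gapFun o z ∂(P 2 ((i + 1) * h₀) ![x, x])) / c) := by
      simp [hTF2.integral_gapFun hP]
    rw [this]
    refine tendsto_finsetSum _ fun i _ => ENNReal.Tendsto.const_mul ?_ (Or.inr (by simp))
    refine ENNReal.tendsto_ofReal (Tendsto.div_const ?_ c)
    exact (((hP 2).continuous_integral (gapFun o) ((i + 1) * h₀)).comp hpair).tendsto x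
  obtain ⟨r, hr, hball⟩ := Metric.eventually_nhds_iff.1 (hlim.eventually (ge_mem_nhds hη))
  refine ⟨r, hr, fun y hy => le_trans ?_ (hball hy)⟩
  have hZ := hX.isMarkov_jointPath hψ hP (![x, y] : Fin 2 → M) (a := 0) fun _ => le_rfl
  have hstart : ∀ ω, jointPath (fun j => X ((![x, y] : Fin 2 → M) j) ω) 0 0 = ![x, y] := fun ω =>
    funext fun j => hX.before ((![x, y] : Fin 2 → M) j) _ ω (by simp)
  obtain ⟨C, hCc, hCd⟩ := TopologicalSpace.exists_countable_dense ℝ≥0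
  refine le_trans (measure_mono ?_) (hZ.measure_sup_le (hP 2) (gapFun o) (gapFun_nonneg o) hc T hh₀
    hhalf hstart (C := C ∩ Iic (T : ℝ≥0)) (hCc.mono inter_subset_left) fun t ht => ht.2)
  rintro ω ⟨t, ht0, htT, ht⟩
  set w := jointPath (fun j => X ((![x, y] : Fin 2 → M) j) ω) 0 with hw
  have hwt : ∀ u : ℝ≥0, w u = ![X x ω u, X y ω u] := fun u => by
    funext j
    fin_cases j <;> simp [hw, jointPath]
  have hopen : IsOpen {u : ℝ≥0 | u < T ∧ 2 * c < gapFun o (w u)} :=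
    (isOpen_lt continuous_id continuous_const).inter
      (isOpen_lt continuous_const (hfc.comp w.continuous))
  obtain ⟨u, ⟨hu1, hu2⟩, huC⟩ := hCd.inter_open_nonempty _ hopen ⟨t.toNNReal, by
    refine ⟨?_, ?_⟩
    · rw [← NNReal.coe_lt_coe, Real.coe_toNNReal t ht0]
      simpa using htT
    · rw [hwt, Real.coe_toNNReal t ht0]
      exact ht⟩
  exact mem_biUnion (x := u) ⟨huC, hu1.le⟩ (show 2 * c ≤ gapFun o (w u) from hu2.le)

/-- `gapFun` is small also for pairs far away from o, so a small gap alone does not mean that the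
points are close. But at the first level r ≤ 1 that the distance would have to cross, the second
path is still within 1 of the bounded path a, and there the gap is bounded below. -/
lemma tendsto_of_gapFun (o : M) {a : C(ℝ, M)} {b : ℕ → C(ℝ, M)} (ha : ∀ t ≤ 0, a t = a 0)
    (hb : ∀ k, ∀ t ≤ 0, b k t = b k 0) (h0 : Tendsto (fun k => b k 0) atTop (𝓝 (a 0)))
    {c : ℕ → ℝ} (hc : Tendsto c atTop (𝓝 0))
    (h : ∀ᶠ k : ℕ in atTop, ∀ t : ℝ, 0 ≤ t → t < k → gapFun o ![a t, b k t] ≤ c k) :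
    Tendsto b atTop (𝓝 a) := by
  rw [ContinuousMap.tendsto_iff_forall_isCompact_tendstoUniformlyOn]
  intro K hK
  rw [Metric.tendstoUniformlyOn_iff]
  intro ε hε
  obtain ⟨r, hr0, hrε, hr1⟩ : ∃ r : ℝ, 0 < r ∧ r < ε ∧ r ≤ 1 :=
    ⟨min (ε / 2) 1, lt_min (by positivity) one_pos, (min_le_left _ _).trans_lt (by linarith),
      min_le_right _ _⟩
  obtain ⟨T, hT⟩ := hK.isBounded.bddAbove
  obtain ⟨N, hN⟩ := exists_nat_gt T
  obtain ⟨B, hB⟩ := ((isCompact_Icc (a := (0 : ℝ)) (b := N)).image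
    (a.continuous)).isBounded.subset_closedBall o
  have hB' : ∀ t : ℝ, 0 ≤ t → t ≤ N → dist (a t) o ≤ B := fun t h1 h2 => hB ⟨t, ⟨h1, h2⟩, rfl⟩
  have hB0 : 0 ≤ B := dist_nonneg.trans (hB' 0 le_rfl (by positivity))
  have hpos : 0 < r / (2 + B) := by positivity
  filter_upwards [h, hc.eventually (gt_mem_nhds hpos), eventually_ge_atTop N,
    Metric.tendsto_nhds.1 h0 r hr0] with k h1 h2 h3 h4 t ht
  have h4' : dist (a 0) (b k 0) < r := by rwa [dist_comm]
  rcases le_total t 0 with h0t | h0t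
  · rw [ha t h0t, hb k t h0t]
    exact h4'.trans hrε
  refine lt_of_lt_of_le ?_ hrε.le
  by_contra! hcon
  have hcont : ContinuousOn (fun u => dist (a u) (b k u)) (Icc 0 t) := by fun_prop
  obtain ⟨u, ⟨hu0, hut⟩, hu⟩ := intermediate_value_Icc h0t hcont ⟨h4'.le, hcon⟩
  have htN : t < N := lt_of_le_of_lt (hT ht) hN
  have hkN : (N : ℝ) ≤ k := by exact_mod_cast h3
  have h5 := h1 u hu0 (by linarith)
  have h6 : r / (2 + B) ≤ gapFun o ![a u, b k u] := by
    rw [gapFun_apply]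
    simp only [Matrix.cons_val_zero, Matrix.cons_val_one]
    have hu' : dist (a u) (b k u) = r := hu
    rw [hu', min_eq_left hr1]
    refine div_le_div_of_nonneg_left hr0.le (by positivity) ?_
    have : dist (![a u, b k u] : Fin 2 → M) (fun _ => o) ≤ 1 + B := by
      rw [dist_pi_le_iff (by positivity), Fin.forall_fin_two]
      have h7 := hB' u hu0 (by linarith)
      have h8 := dist_triangle_left (b k u) o (a u)
      simp only [Matrix.cons_val_zero, Matrix.cons_val_one]
      constructor <;> linarith
    linarith
  linarith

/-- Borel–Cantelli: the k-th point of the subsequence is chosen so close to x that the gap exceeds 2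
· 2⁻ᵏ before time k with probability at most 2⁻ᵏ. -/
lemma IsVersionFamily.exists_subseq_tendsto {X : M → Ω → C(ℝ, M)}
    (hX : IsVersionFamily μ ψ (fun x : M => ((0 : ℝ), x)) (fun x t ω => X x ω t))
    (hψ : IsStochasticFlow P μ ψ) (hP : ∀ n, IsFellerTransition (P n)) (hTF2 : TF2 P) {x : M}
    {y : ℕ → M} (hy : Tendsto y atTop (𝓝 x)) : ∃ φ : ℕ → ℕ, StrictMono φ ∧
      ∀ᵐ ω ∂μ, Tendsto (fun k => X (y (φ k)) ω) atTop (𝓝 (X x ω)) := by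
  choose r hr hrμ using fun k : ℕ => hX.exists_gap_le hψ hP hTF2 x x k
    (c := (1 / 2) ^ k) (by positivity) (η := 2⁻¹ ^ k) (by
      exact ENNReal.pow_pos (by simp) k)
  obtain ⟨φ, hφ, hφr⟩ := extraction_forall_of_eventually fun k =>
    Metric.tendsto_nhds.1 hy (r k) (hr k)
  refine ⟨φ, hφ, ?_⟩
  have hsum : ∑' k : ℕ, μ {ω | ∃ t : ℝ, 0 ≤ t ∧ t < k ∧
      2 * (1 / 2) ^ k < gapFun x ![X x ω t, X (y (φ k)) ω t]} ≠ ∞ := by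
    refine ne_top_of_le_ne_top ?_ (ENNReal.tsum_le_tsum fun k => hrμ k _ (hφr k))
    rw [ENNReal.tsum_geometric, ENNReal.one_sub_inv_two, inv_inv]
    simp
  filter_upwards [ae_eventually_notMem hsum] with ω hω
  have h0 : ∀ (z : M) (t : ℝ), t ≤ 0 → X z ω t = z := fun z t ht => hX.before z t ω ht
  refine tendsto_of_gapFun x (fun t ht => by rw [h0 _ t ht, h0 _ 0 le_rfl])
    (fun k t ht => by rw [h0 _ t ht, h0 _ 0 le_rfl]) ?_ (c := fun k => 2 * (1 / 2) ^ k) ?_ ?_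
  · simp only [h0 _ 0 le_rfl]
    exact hy.comp hφ.tendsto_atTop
  · simpa using (tendsto_pow_atTop_nhds_zero_of_lt_one (by norm_num : (0 : ℝ) ≤ 1 / 2)
      (by norm_num)).const_mul 2
  · filter_upwards [hω] with k hk t ht0 htk
    by_contra! hcon
    exact hk ⟨t, ht0, htk, hcon⟩

omit [MetricSpace M] [ProperSpace M] [MeasurableSpace M] [BorelSpace M] in
lemma IsCompactOpenDist.continuous [TopologicalSpace M] {δ : C(ℝ, M) → C(ℝ, M) → ℝ}
    (hδ : IsCompactOpenDist δ) :
    Continuous fun p : C(ℝ, M) × C(ℝ, M) => δ p.1 p.2 := by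
  obtain ⟨m, hm, htop⟩ := hδ
  have h := @continuous_dist _ m.toPseudoMetricSpace
  rw [htop] at h
  have e : (fun p : C(ℝ, M) × C(ℝ, M) => δ p.1 p.2) = fun p => m.dist p.1 p.2 := by
    funext p
    rw [hm]
  rw [e]
  exact h

omit [MetricSpace M] [ProperSpace M] [MeasurableSpace M] [BorelSpace M] in
lemma IsCompactOpenDist.self [TopologicalSpace M] {δ : C(ℝ, M) → C(ℝ, M) → ℝ}
    (hδ : IsCompactOpenDist δ) (f : C(ℝ, M)) : δ f f = 0 := by
  obtain ⟨m, hm, -⟩ := hδ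
  rw [← hm]
  exact m.dist_self f

omit [MetricSpace M] [ProperSpace M] [MeasurableSpace M] [BorelSpace M] in
/-- Convergence in the distance `δ` is convergence in the compact-open topology. -/
lemma IsCompactOpenDist.tendsto [TopologicalSpace M] {δ : C(ℝ, M) → C(ℝ, M) → ℝ}
    (hδ : IsCompactOpenDist δ) {f : C(ℝ, M)} {u : ℕ → C(ℝ, M)}
    (h : Tendsto (fun k => δ f (u k)) atTop (𝓝 0)) : Tendsto u atTop (𝓝 f) := by
  obtain ⟨m, hm, htop⟩ := hδ
  rw [← htop]
  refine (@tendsto_iff_dist_tendsto_zero _ _ m.toPseudoMetricSpace _ _ _).2 ?_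
  refine h.congr fun k => ?_
  rw [← hm, m.dist_comm]

lemma continuous_coordPath {n : ℕ} (i : Fin n) :
    Continuous fun w : C(ℝ≥0, Fin n → M) => coordPath w i := by
  have : (fun w : C(ℝ≥0, Fin n → M) => coordPath w i) = fun w =>
      ((⟨fun z : Fin n → M => z i, continuous_apply i⟩ : C(Fin n → M, M)).comp w).comp
        ⟨Real.toNNReal, continuous_real_toNNReal⟩ := rfl
  rw [this]
  exact (ContinuousMap.continuous_precomp _).comp (ContinuousMap.continuous_postcomp _)

lemma coordPath_jointPath {n : ℕ} (y : Fin n → C(ℝ, M)) (a : ℝ) (i : Fin n) (t : ℝ) :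
    coordPath (jointPath y a) i t = y i (a + max t 0) := by
  simp [coordPath, jointPath]

/-- The trajectories whose coordinates are at distance at least `c`. -/
def apartSet (δ : C(ℝ, M) → C(ℝ, M) → ℝ) (c : ℝ) : Set C(ℝ≥0, Fin 2 → M) :=
  {w | c ≤ δ (coordPath w 0) (coordPath w 1)}

lemma measurableSet_apartSet {δ : C(ℝ, M) → C(ℝ, M) → ℝ} (hδ : IsCompactOpenDist δ) (c : ℝ) :
    MeasurableSet (apartSet δ c) :=
  (isClosed_le continuous_const (hδ.continuous.comp
    ((continuous_coordPath 0).prodMk (continuous_coordPath 1)))).measurableSet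

/-- Realizes the laws for all pairs (x, y) on one probability space, where convergence of starting
points can be turned into almost sure convergence of paths. -/
lemma IsVersionFamily.markovLaw_apartSet {X : M → Ω → C(ℝ, M)}
    (hX : IsVersionFamily μ ψ (fun x : M => ((0 : ℝ), x)) (fun x t ω => X x ω t))
    (hψ : IsStochasticFlow P μ ψ) (hP : ∀ n, IsFellerTransition (P n)) (hTF3 : TF3 P)
    {δ : C(ℝ, M) → C(ℝ, M) → ℝ} (hδ : IsCompactOpenDist δ) (c : ℝ) (x y : M) :
    MeasurableSet {ω | c ≤ δ (X x ω) (X y ω)} ∧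
    markovLaw (P 2) ![x, y] (apartSet δ c) = μ {ω | c ≤ δ (X x ω) (X y ω)} := by
  have hZ := hX.isMarkov_jointPath hψ hP (![x, y] : Fin 2 → M) (a := 0) fun _ => le_rfl
  have hstart : ∀ ω, jointPath (fun j => X ((![x, y] : Fin 2 → M) j) ω) 0 0 = ![x, y] := fun ω =>
    funext fun j => hX.before ((![x, y] : Fin 2 → M) j) _ ω (by simp)
  have h := hZ.measure_inter_preimage_path (fun z => hψ.exists_isMarkovLaw hP hTF3 z)
    (A := univ) MeasurableSet.univ (measurableSet_apartSet hδ c)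
  have hcoord : ∀ ω (j : Fin 2), coordPath (jointPath (fun j => X ((![x, y] : Fin 2 → M) j) ω) 0) j
      = X ((![x, y] : Fin 2 → M) j) ω := by
    intro ω j
    ext t
    rw [coordPath_jointPath, zero_add]
    rcases le_total t 0 with ht | ht
    · rw [max_eq_right ht]
      exact (hX.before _ 0 ω le_rfl).trans (hX.before _ t ω ht).symm
    · rw [max_eq_left ht]
  have e : (fun ω => jointPath (fun j => X ((![x, y] : Fin 2 → M) j) ω) 0) ⁻¹' apartSet δ c =
      {ω | c ≤ δ (X x ω) (X y ω)} := by
    ext ω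
    simp only [apartSet, mem_preimage, mem_ofPred_eq, hcoord]
    rfl
  refine ⟨?_, ?_⟩
  · rw [← e]
    exact hX.measurable_jointPath _ 0 (measurableSet_apartSet hδ c)
  · rw [univ_inter, e] at h
    rw [h]
    simp only [hstart]
    simp

/-- Upper semicontinuity of the probability that two trajectories are apart. -/
lemma IsStochasticFlow.isClosed_markovLaw_apartSet (hψ : IsStochasticFlow P μ ψ)
    (hP : ∀ n, IsFellerTransition (P n)) (hTF2 : TF2 P) (hTF3 : TF3 P)
    {δ : C(ℝ, M) → C(ℝ, M) → ℝ} (hδ : IsCompactOpenDist δ) (c : ℝ) (a : ℝ≥0∞) :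
    IsClosed {p : M × M | a ≤ markovLaw (P 2) ![p.1, p.2] (apartSet δ c)} := by
  obtain ⟨X, hX⟩ := hψ.exists_version_zero hP hTF3
  have hlaw := hX.markovLaw_apartSet hψ hP hTF3 hδ c
  refine IsSeqClosed.isClosed fun p q hp hpq => ?_
  simp only [mem_ofPred_eq, (hlaw _ _).2] at hp ⊢
  obtain ⟨φ, hφ, h1⟩ := hX.exists_subseq_tendsto hψ hP hTF2 (hpq.fst_nhds)
  obtain ⟨φ', hφ', h2⟩ := hX.exists_subseq_tendsto hψ hP hTF2
    ((hpq.snd_nhds).comp hφ.tendsto_atTop)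
  set S : ℕ → Set Ω := fun k => {ω | c ≤ δ (X (p (φ (φ' k))).1 ω) (X (p (φ (φ' k))).2 ω)} with hS
  have hSm : ∀ k, MeasurableSet (S k) := fun k => (hlaw _ _).1
  have hanti : Antitone fun n => ⋃ k ≥ n, S k := fun m n hmn =>
    biUnion_mono (fun k hk => le_trans hmn hk) fun _ _ => Subset.rfl
  -- Reverse Fatou: infinitely many of the events occur with probability at least a. Where this
  -- happens, continuity of δ makes the limiting paths apart.
  have hlim := tendsto_measure_iInter_atTop (μ := μ) (fun n => (MeasurableSet.biUnion
    (to_countable {k | k ≥ n}) fun k _ => hSm k).nullMeasurableSet) hanti ⟨0, measure_ne_top _ _⟩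
  have hge : a ≤ μ (⋂ n, ⋃ k ≥ n, S k) := by
    refine ge_of_tendsto' hlim fun n => (hp (φ (φ' n))).trans (measure_mono ?_)
    exact fun ω hω => mem_biUnion (show n ∈ {k | k ≥ n} from le_refl n) hω
  refine hge.trans (measure_mono_ae ?_)
  filter_upwards [h1, h2] with ω h1 h2 hω
  have hconv : Tendsto (fun k => δ (X (p (φ (φ' k))).1 ω) (X (p (φ (φ' k))).2 ω)) atTop
      (𝓝 (δ (X q.1 ω) (X q.2 ω))) :=
    (hδ.continuous.tendsto (X q.1 ω, X q.2 ω)).comp ((h1.comp hφ'.tendsto_atTop).prodMk_nhds h2)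
  change c ≤ _
  refine ge_of_tendsto_of_frequently hconv ?_
  rw [frequently_atTop]
  intro n
  obtain ⟨k, hk, hkω⟩ := mem_iUnion₂.1 (mem_iInter.1 hω n)
  exact ⟨k, hk, hkω⟩

/-! ### Positivity and measurability of the functions ε_k -/

lemma epsilonSeq_eq (δ : C(ℝ, M) → C(ℝ, M) → ℝ) (k : ℕ) (x : M) :
    epsilonSeq δ P k x = min ((2 : ℝ≥0∞)⁻¹ ^ k)
    (⨅ (r : ℝ) (_ : 0 < r ∧ (2 : ℝ≥0∞)⁻¹ ^ k < ⨆ y ∈ Metric.closedBall x r,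
      markovLaw (P 2) ![x, y] (apartSet δ ((2 : ℝ)⁻¹ ^ k))), ENNReal.ofReal r) := rfl

/-- Within distance `ε_k(x)` of `x`, trajectories are close to the trajectory started at `x`. -/
lemma markovLaw_apartSet_le {δ : C(ℝ, M) → C(ℝ, M) → ℝ} {k : ℕ} {x y : M}
    (hy : edist y x < epsilonSeq δ P k x) :
    markovLaw (P 2) ![x, y] (apartSet δ ((2 : ℝ)⁻¹ ^ k)) ≤ 2⁻¹ ^ k := by
  by_contra! hcon
  have h1 : ∀ r : ℝ, 0 < r → dist y x ≤ r → epsilonSeq δ P k x ≤ ENNReal.ofReal r := by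
    intro r hr hyr
    refine (min_le_right _ _).trans (iInf₂_le r ⟨hr, hcon.trans_le ?_⟩)
    exact le_iSup₂ (f := fun (y : M) (_ : y ∈ Metric.closedBall x r) =>
      markovLaw (P 2) ![x, y] (apartSet δ ((2 : ℝ)⁻¹ ^ k))) y hyr
  obtain ⟨c, hc1, hc2⟩ := ENNReal.lt_iff_exists_nnreal_btwn.1 hy
  rw [edist_lt_coe] at hc1
  have h2 : dist y x < c := by
    rw [← coe_nndist]
    exact_mod_cast hc1
  have := h1 c (dist_nonneg.trans_lt h2) h2.le
  rw [ENNReal.ofReal_coe_nnreal] at this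
  exact absurd hc2 (not_lt.2 this)

/-- Removes the infimum over radii and the supremum over balls: a sublevel set is described by the
existence of one bad point y near x. -/
lemma epsilonSeq_lt_iff {δ : C(ℝ, M) → C(ℝ, M) → ℝ} {k : ℕ} {x : M} {c : ℝ≥0∞} :
    epsilonSeq δ P k x < c ↔ (2 : ℝ≥0∞)⁻¹ ^ k < c ∨ ∃ y, edist y x < c ∧
      2⁻¹ ^ k < markovLaw (P 2) ![x, y] (apartSet δ ((2 : ℝ)⁻¹ ^ k)) := by
  rw [epsilonSeq_eq, min_lt_iff]
  refine or_congr_right ?_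
  simp only [iInf_lt_iff, lt_iSup_iff]
  constructor
  · rintro ⟨r, ⟨hr, y, hy, hlt⟩, hrc⟩
    refine ⟨y, lt_of_le_of_lt ?_ hrc, hlt⟩
    rw [edist_dist]
    exact ENNReal.ofReal_le_ofReal hy
  · rintro ⟨y, hy, hlt⟩
    obtain ⟨b, hb1, hb2⟩ := ENNReal.lt_iff_exists_nnreal_btwn.1 hy
    rw [edist_lt_coe] at hb1
    have h2 : dist y x < b := by
      rw [← coe_nndist]
      exact_mod_cast hb1
    exact ⟨b, ⟨dist_nonneg.trans_lt h2, y, h2.le, hlt⟩, by rwa [ENNReal.ofReal_coe_nnreal]⟩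

/-- Otherwise bad points y would converge to x, and by upper semicontinuity the probability at (x,
x) would be at least 2⁻ᵏ; but a trajectory has distance 0 from itself. -/
lemma IsStochasticFlow.epsilonSeq_pos (hψ : IsStochasticFlow P μ ψ)
    (hP : ∀ n, IsFellerTransition (P n)) (hTF2 : TF2 P) (hTF3 : TF3 P)
    {δ : C(ℝ, M) → C(ℝ, M) → ℝ} (hδ : IsCompactOpenDist δ) (k : ℕ) (x : M) :
    0 < epsilonSeq δ P k x := by
  by_contra! hcon
  have h2k : (0 : ℝ≥0∞) < 2⁻¹ ^ k := ENNReal.pow_pos (by simp) k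
  have h : ∀ n : ℕ, ∃ y, edist y x < min ((n : ℝ≥0∞) + 1)⁻¹ (2⁻¹ ^ k) ∧
      2⁻¹ ^ k < markovLaw (P 2) ![x, y] (apartSet δ ((2 : ℝ)⁻¹ ^ k)) := by
    intro n
    have hpos : 0 < min ((n : ℝ≥0∞) + 1)⁻¹ (2⁻¹ ^ k) :=
      lt_min (ENNReal.inv_pos.2 (by finiteness)) h2k
    rcases epsilonSeq_lt_iff.1 (hcon.trans_lt hpos) with h1 | h1
    · exact absurd h1 (not_lt.2 (min_le_right _ _))
    · exact h1
  choose y hy1 hy2 using h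
  have hyx : Tendsto y atTop (𝓝 x) := by
    rw [tendsto_iff_edist_tendsto_0]
    have h0 : Tendsto (fun n : ℕ => ((n : ℝ≥0∞) + 1)⁻¹) atTop (𝓝 0) := by
      have := ENNReal.tendsto_inv_nat_nhds_zero.comp (tendsto_add_atTop_nat 1)
      refine this.congr fun n => ?_
      simp
    exact tendsto_of_tendsto_of_tendsto_of_le_of_le tendsto_const_nhds h0 (fun _ => zero_le)
      fun n => (hy1 n).le.trans (min_le_left _ _)
  have hcl := hψ.isClosed_markovLaw_apartSet hP hTF2 hTF3 hδ ((2 : ℝ)⁻¹ ^ k) (2⁻¹ ^ k)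
  have hmem : (x, x) ∈ {p : M × M | (2⁻¹ : ℝ≥0∞) ^ k ≤
      markovLaw (P 2) ![p.1, p.2] (apartSet δ ((2 : ℝ)⁻¹ ^ k))} :=
    hcl.mem_of_tendsto (tendsto_const_nhds.prodMk_nhds hyx) (Eventually.of_forall fun n => (hy2 n).le)
  obtain ⟨X, hX⟩ := hψ.exists_version_zero hP hTF3
  have h3 : (2⁻¹ : ℝ≥0∞) ^ k ≤ markovLaw (P 2) ![x, x] (apartSet δ ((2 : ℝ)⁻¹ ^ k)) := hmem
  rw [(hX.markovLaw_apartSet hψ hP hTF3 hδ _ x x).2] at h3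
  have hemp : {ω : Ω | (2 : ℝ)⁻¹ ^ k ≤ δ (X x ω) (X x ω)} = ∅ := by
    refine eq_empty_of_forall_notMem fun ω hω => ?_
    have : (2 : ℝ)⁻¹ ^ k ≤ δ (X x ω) (X x ω) := hω
    rw [hδ.self] at this
    have : (0 : ℝ) < 2⁻¹ ^ k := by positivity
    linarith
  rw [hemp, measure_empty] at h3
  exact absurd h2k (not_lt.2 h3)

/-- Strict inequalities are exhausted by closed ones, so a sublevel set is a countable union of
projections of closed sets in M × M. As M × M is σ-compact, these projections are countable unions
of compact sets. -/
lemma IsStochasticFlow.measurable_epsilonSeq (hψ : IsStochasticFlow P μ ψ)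
    (hP : ∀ n, IsFellerTransition (P n)) (hTF2 : TF2 P) (hTF3 : TF3 P)
    {δ : C(ℝ, M) → C(ℝ, M) → ℝ} (hδ : IsCompactOpenDist δ) (k : ℕ) :
    Measurable (epsilonSeq δ P k) := by
  refine measurable_of_Iio fun c => ?_
  rcases eq_or_ne c 0 with rfl | hc
  · simp
  have hc0 : 0 < c := pos_iff_ne_zero.2 hc
  obtain ⟨u, -, hu1, hu2⟩ := exists_seq_strictMono_tendsto' hc0
  obtain ⟨v, -, hv1, hv2⟩ := exists_seq_strictAnti_tendsto' (show (2⁻¹ : ℝ≥0∞) ^ k < ∞ by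
    exact ENNReal.pow_lt_top (by simp))
  have hset : epsilonSeq δ P k ⁻¹' Iio c = {_x : M | (2 : ℝ≥0∞)⁻¹ ^ k < c} ∪
      ⋃ (n : ℕ) (m : ℕ), Prod.fst '' ({p : M × M | edist p.2 p.1 ≤ u n} ∩
        {p : M × M | v m ≤ markovLaw (P 2) ![p.1, p.2] (apartSet δ ((2 : ℝ)⁻¹ ^ k))}) := by
    ext x
    rw [mem_preimage, mem_Iio, epsilonSeq_lt_iff, mem_union]
    refine or_congr Iff.rfl ?_
    simp only [mem_iUnion]
    constructor
    · rintro ⟨y, hy1, hy2⟩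
      obtain ⟨n, hn⟩ := (hu2.eventually (lt_mem_nhds hy1)).exists
      obtain ⟨m, hm⟩ := (hv2.eventually (gt_mem_nhds hy2)).exists
      exact ⟨n, m, (x, y), ⟨hn.le, hm.le⟩, rfl⟩
    · rintro ⟨n, m, ⟨x', y⟩, ⟨h1, h2⟩, rfl⟩
      exact ⟨y, lt_of_le_of_lt h1 (hu1 n).2, (hv1 m).1.trans_le h2⟩
  rw [hset]
  refine (MeasurableSet.const _).union (MeasurableSet.iUnion fun n => MeasurableSet.iUnion fun m => ?_)
  have hcl : IsClosed ({p : M × M | edist p.2 p.1 ≤ u n} ∩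
        {p : M × M | v m ≤ markovLaw (P 2) ![p.1, p.2] (apartSet δ ((2 : ℝ)⁻¹ ^ k))}) :=
    (isClosed_le (by fun_prop) continuous_const).inter
      (hψ.isClosed_markovLaw_apartSet hP hTF2 hTF3 hδ _ _)
  rw [← inter_univ (_ ∩ _), ← iUnion_compactCovering (M × M), inter_iUnion, image_iUnion]
  refine MeasurableSet.iUnion fun l => ?_
  exact (((isCompact_compactCovering (M × M) l).inter_left hcl).image
    continuous_fst).isClosed.measurableSet

end Versions

/-! ### Coalescence and local equicontinuity -/

section Events

variable {M : Type*} [MetricSpace M] [ProperSpace M] [MeasurableSpace M] [BorelSpace M]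
  {P : (n : ℕ) → ℝ≥0 → Kernel (Fin n → M) (Fin n → M)}
  {Ω : Type*} [mΩ : MeasurableSpace Ω] {μ : Measure Ω} [IsProbabilityMeasure μ]
  {ψ : ℝ → ℝ → Ω → MeasMap M} {I : Type*} {D : I → ℝ × M} {Y : I → Ω → C(ℝ, M)}

omit [MetricSpace M] [ProperSpace M] [MeasurableSpace M] [BorelSpace M] in
lemma exists_pos_le_finset {J : Type*} (F : Finset J) {f : J → ℝ} (hf : ∀ i ∈ F, 0 < f i) :
    ∃ c, 0 < c ∧ ∀ i ∈ F, c ≤ f i := by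
  rcases F.eq_empty_or_nonempty with rfl | hne
  · exact ⟨1, one_pos, by simp⟩
  · obtain ⟨i, hi, h⟩ := F.exists_min_image f hne
    exact ⟨f i, hf i hi, h⟩

lemma measure_eq_zero_of_forall_le {S : Set Ω} {c : ℝ≥0∞} (hc : c ≠ ∞)
    (h : ∀ κ : ℝ≥0, 0 < κ → μ S ≤ c * κ) : μ S = 0 := by
  have hlim : Tendsto (fun n : ℕ => c * ((1 / ((n : ℝ≥0) + 1) : ℝ≥0) : ℝ≥0∞)) atTop (𝓝 (c * 0)) := by
    refine ENNReal.Tendsto.const_mul ?_ (Or.inr hc)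
    have := ENNReal.tendsto_coe.2 (tendsto_one_div_add_atTop_nhds_zero_nat (𝕜 := ℝ≥0))
    rwa [ENNReal.coe_zero] at this
  rw [mul_zero] at hlim
  exact le_antisymm (ge_of_tendsto' hlim fun n => h _ (by positivity)) zero_le

/-- Once two trajectories have met, they stay together. -/
lemma IsVersionFamily.ae_coalescence [Countable I]
    (hY : IsVersionFamily μ ψ D (fun i t ω => Y i ω t)) (hψ : IsStochasticFlow P μ ψ)
    (hP : ∀ n, IsFellerTransition (P n)) (hTF2 : TF2 P) :
    ∀ᵐ ω ∂μ, ∀ i j s, (D i).1 ≤ s → (D j).1 ≤ s → Y i ω s = Y j ω s →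
      ∀ t, s ≤ t → Y i ω t = Y j ω t := by
  rw [ae_all_iff]
  intro i
  rw [ae_all_iff]
  intro j
  set o := (D i).2
  set f := gapFun o with hf
  have hfc : Continuous f := map_continuous _
  set a := max (D i).1 (D j).1 with ha
  set w : Ω → C(ℝ≥0, Fin 2 → M) := fun ω => jointPath (fun l => Y ((![i, j] : Fin 2 → I) l) ω) a
    with hw
  have hw0 : ∀ ω u, w ω u 0 = Y i ω (a + u) := fun ω u => rfl
  have hw1 : ∀ ω u, w ω u 1 = Y j ω (a + u) := fun ω u => rfl
  have hZ : IsMarkov μ _ (P 2) (fun t ω => w ω t) :=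
    hY.isMarkov_jointPath hψ hP (![i, j] : Fin 2 → I) (a := a) (by
      rw [Fin.forall_fin_two]
      exact ⟨le_max_left _ _, le_max_right _ _⟩)
  obtain ⟨C, hCc, hCd⟩ := TopologicalSpace.exists_countable_dense ℝ≥0
  have key : ∀ T : ℝ≥0, ∀ c : ℝ, 0 < c →
      μ {ω | (∃ t < T, w ω t 0 = w ω t 1) ∧ c ≤ f (w ω T)} = 0 := by
    intro T c hc
    refine measure_eq_zero_of_forall_le (c := 1) (by simp) fun κ hκ => ?_
    -- The diagonal is thickened to the states whose expected gap at time T is below κc. Along a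
    -- path this condition is open in time, so after a meeting it holds at some time of the dense
    -- set C. From such a state the gap at T reaches c with probability at most κ.
    set U : ℝ≥0 → Set (Fin 2 → M) := fun t => {z | ∫ y, f y ∂(P 2 (T - t) z) < κ * c} with hU
    have hUm : ∀ t, MeasurableSet (U t) := fun t =>
      (isOpen_lt ((hP 2).continuous_integral f (T - t)) continuous_const).measurableSet
    have hB : MeasurableSet {z | c ≤ f z} := (isClosed_le continuous_const hfc).measurableSet
    have h := hZ.first_entry hUm hB (η := κ) (C := C ∩ Iic T) (T := T) (hCc.mono inter_subset_left)
      (fun t ht => ht.2) (fun t ht z hz => by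
        have := (hP 2).markov (T - t)
        refine (measure_le_integral f (gapFun_nonneg o) hB hc fun y hy => hy).trans ?_
        rw [← ENNReal.ofReal_coe_nnreal]
        refine ENNReal.ofReal_le_ofReal ?_
        rw [div_le_iff₀ hc]
        exact le_of_lt hz) MeasurableSet.univ
    refine (measure_mono ?_).trans (h.trans ?_)
    · rintro ω ⟨⟨t, htT, ht⟩, hcT⟩
      refine ⟨⟨mem_univ _, ?_⟩, hcT⟩
      have hcont : Continuous fun u : ℝ≥0 => ∫ y, f y ∂(P 2 (T - u) (w ω u)) :=
        ((hP 2).continuous_integral_prod f).comp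
          ((continuous_const.sub continuous_id).prodMk (w ω).continuous)
      have hopen : IsOpen {u : ℝ≥0 | u < T ∧ ∫ y, f y ∂(P 2 (T - u) (w ω u)) < κ * c} :=
        (isOpen_lt continuous_id continuous_const).inter (isOpen_lt hcont continuous_const)
      obtain ⟨u, ⟨hu1, hu2⟩, huC⟩ := hCd.inter_open_nonempty _ hopen ⟨t, htT, by
        have e : w ω t = ![w ω t 0, w ω t 0] := by
          funext l
          fin_cases l
          · rfl
          · exact ht.symm
        rw [e, hf, hTF2.integral_gapFun hP]
        positivity⟩
      exact mem_biUnion (x := u) ⟨huC, hu1.le⟩ hu2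
    · rw [one_mul]
      exact (mul_le_mul_right prob_le_one _).trans_eq (mul_one _)
  have hall : ∀ᵐ ω ∂μ, ∀ T ∈ C, ∀ k : ℕ,
      ¬ ((∃ t < T, w ω t 0 = w ω t 1) ∧ 1 / ((k : ℝ) + 1) ≤ f (w ω T)) := by
    rw [ae_ball_iff hCc]
    intro T _
    rw [ae_all_iff]
    intro k
    rw [ae_iff]
    simp only [not_not]
    exact key T _ (by positivity)
  filter_upwards [hall] with ω hω s hsi hsj hs t hst
  by_contra hne
  have hsa : a ≤ s := max_le hsi hsj
  have hs0 : a + ((s - a).toNNReal : ℝ) = s := by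
    rw [Real.coe_toNNReal _ (by linarith), add_sub_cancel]
  have ht0 : a + ((t - a).toNNReal : ℝ) = t := by
    rw [Real.coe_toNNReal _ (by linarith), add_sub_cancel]
  have hfpos : 0 < f (w ω (t - a).toNNReal) := by
    refine lt_of_le_of_ne (gapFun_nonneg _ _) fun h => hne ?_
    have := (gapFun_eq_zero_iff o _).1 h.symm
    rwa [hw0, hw1, ht0] at this
  obtain ⟨k, hk⟩ := exists_nat_one_div_lt hfpos
  have hlt : (s - a).toNNReal < (t - a).toNNReal := by
    have : s ≠ t := fun h => hne (h ▸ hs)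
    have := lt_of_le_of_ne hst this
    rw [← NNReal.coe_lt_coe, Real.coe_toNNReal _ (by linarith), Real.coe_toNNReal _ (by linarith)]
    linarith
  have hopen : IsOpen {u : ℝ≥0 | (s - a).toNNReal < u ∧ 1 / ((k : ℝ) + 1) < f (w ω u)} :=
    (isOpen_lt continuous_const continuous_id).inter
      (isOpen_lt continuous_const (hfc.comp (w ω).continuous))
  obtain ⟨u, ⟨hu1, hu2⟩, huC⟩ := hCd.inter_open_nonempty _ hopen ⟨_, hlt, hk⟩
  exact hω u huC k ⟨⟨_, hu1, by rw [hw0, hw1, hs0]; exact hs⟩, hu2.le⟩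

/-- Trajectories are unlikely to move away from their position at a given time. -/
lemma IsVersionFamily.exists_small_time (hY : IsVersionFamily μ ψ D (fun i t ω => Y i ω t))
    (hψ : IsStochasticFlow P μ ψ) (hP : ∀ n, IsFellerTransition (P n)) (hTF3 : TF3 P)
    {K : Set M} (hK : IsCompact K) {r : ℝ} (hr : 0 < r) {κ : ℝ≥0} (hκ : 0 < κ) :
    ∃ h₀ : ℝ≥0, 0 < h₀ ∧ ∀ h : ℝ≥0, 0 < h → h ≤ h₀ → ∀ i a, (D i).1 ≤ a →
      μ {ω | Y i ω a ∈ K ∧ ∃ u, a ≤ u ∧ u < a + h ∧ r < dist (Y i ω u) (Y i ω a)} ≤ κ * h := by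
  have hK' : IsCompact {z : Fin 1 → M | z 0 ∈ K} := by
    have := isCompact_univ_pi (X := fun _ : Fin 1 => M) (s := fun _ => K) fun _ => hK
    refine this.of_isClosed_subset (hK.isClosed.preimage (continuous_apply 0)) fun z hz j _ => ?_
    rw [Subsingleton.elim j 0]
    exact hz
  obtain ⟨h₀, hh₀, H⟩ := (hP 1).exists_small_time hTF3.tendsto μ hK' hr hκ
  refine ⟨h₀, hh₀, fun h hh hle i a hia => ?_⟩
  have hZ := hY.isMarkov_jointPath hψ hP (fun _ : Fin 1 => i) (a := a) fun _ => hia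
  obtain ⟨C, hCc, hCd⟩ := TopologicalSpace.exists_countable_dense ℝ≥0
  refine (measure_mono ?_).trans (H h hh hle _ _ hZ (C ∩ Iic h) (hCc.mono inter_subset_left)
    fun t ht => ht.2)
  rintro ω ⟨h1, u, hau, huh, hu⟩
  set w := jointPath (fun _ : Fin 1 => Y i ω) a with hw
  have hwu : ∀ u : ℝ≥0, w u 0 = Y i ω (a + u) := fun _ => rfl
  have hw0 : w 0 0 = Y i ω a := by rw [hwu]; simp
  refine ⟨show w 0 0 ∈ K by rwa [hw0], ?_⟩
  have hopen : IsOpen {u : ℝ≥0 | u < h ∧ r < dist (w u) (w 0)} :=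
    (isOpen_lt continuous_id continuous_const).inter
      (isOpen_lt continuous_const (w.continuous.dist continuous_const))
  obtain ⟨u', ⟨hu1, hu2⟩, huC⟩ := hCd.inter_open_nonempty _ hopen ⟨(u - a).toNNReal, by
    rw [← NNReal.coe_lt_coe, Real.coe_toNNReal _ (by linarith)]
    linarith, by
    rw [dist_fin_one, hw0, hwu, Real.coe_toNNReal _ (by linarith), add_sub_cancel]
    exact hu⟩
  exact ⟨u', ⟨huC, hu1.le⟩, hu2⟩

/-- At every time there are trajectories that stay for a while near a given point. -/
lemma IsVersionFamily.ae_exists_guard (hY : IsVersionFamily μ ψ D (fun i t ω => Y i ω t))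
    (hψ : IsStochasticFlow P μ ψ) (hP : ∀ n, IsFellerTransition (P n)) (hTF3 : TF3 P)
    (hD : DenseRange D) (p : M) {η : ℝ} (hη : 0 < η) (N : ℕ) :
    ∀ᵐ ω ∂μ, ∃ h : ℝ, 0 < h ∧ ∀ s : ℝ, |s| ≤ N → ∃ i, (D i).1 ≤ s ∧
      ∀ u ∈ Icc s (s + h), dist (Y i ω u) p < η := by
  rw [ae_iff]
  refine measure_eq_zero_of_forall_le (c := (3 * (2 * N + 1) : ℕ)) (by finiteness) fun κ hκ => ?_
  obtain ⟨h₀, hh₀, H⟩ := hY.exists_small_time hψ hP hTF3 (isCompact_closedBall p η)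
    (half_pos hη) hκ
  -- Time is cut into cells of length 1/q. The guard for s starts in the preceding cell and has to
  -- last until s + 1/q, which is within 3/q of its start. At most (2N + 1)q guards are needed, each
  -- failing with probability at most 3κ/q, so q cancels and κ is arbitrary.
  obtain ⟨q, hq⟩ := exists_nat_gt (3 / h₀)
  have hq0 : 0 < q := by
    rcases Nat.eq_zero_or_pos q with rfl | h
    · simp at hq
    · exact h
  have hq0' : (0 : ℝ≥0) < q := by exact_mod_cast hq0
  have hqR : (0 : ℝ) < q := by exact_mod_cast hq0
  have hstep : (3 / q : ℝ≥0) ≤ h₀ := by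
    rw [div_le_iff₀ hq0']
    rw [div_lt_iff₀ hh₀] at hq
    exact hq.le.trans_eq (mul_comm _ _)
  have hex : ∀ j : ℤ, ∃ i, (D i).1 < j / q ∧ (j : ℝ) / q - 1 / q < (D i).1 ∧ dist (D i).2 p < η / 2 := by
    intro j
    obtain ⟨i, hi1, hi2⟩ := hD.exists_mem_open
      (isOpen_Ioo.prod (Metric.isOpen_ball (x := p) (ε := η / 2)))
      (s := Ioo ((j : ℝ) / q - 1 / q) (j / q) ×ˢ Metric.ball p (η / 2))
      ⟨((j : ℝ) / q - 1 / q / 2, p), ⟨by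
        have : (0 : ℝ) < 1 / q := by positivity
        constructor <;> dsimp only <;> linarith, Metric.mem_ball_self (half_pos hη)⟩⟩
    exact ⟨i, hi1.2, hi1.1, hi2⟩
  choose i hi1 hi2 hi3 using hex
  have hbad : {ω | ¬ ∃ h : ℝ, 0 < h ∧ ∀ s : ℝ, |s| ≤ N → ∃ i, (D i).1 ≤ s ∧
      ∀ u ∈ Icc s (s + h), dist (Y i ω u) p < η} ⊆
      ⋃ j ∈ Finset.Ico (-(N * q : ℤ)) (N * q + 1), {ω | Y (i j) ω (D (i j)).1 ∈ Metric.closedBall p η ∧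
        ∃ u, (D (i j)).1 ≤ u ∧ u < (D (i j)).1 + (3 / q : ℝ≥0) ∧
        η / 2 < dist (Y (i j) ω u) (Y (i j) ω (D (i j)).1)} := by
    intro ω hω
    by_contra hcon
    refine hω ⟨1 / q, by positivity, fun s hs => ?_⟩
    have hsq := abs_le.1 hs
    have hj1 := Int.floor_le (s * q)
    have hj2 := Int.lt_floor_add_one (s * q)
    set j := ⌊s * q⌋ with hj
    have hjs : (j : ℝ) / q ≤ s := by rwa [div_le_iff₀ hqR]
    have hjs' : s < (j : ℝ) / q + 1 / q := by rwa [← add_div, lt_div_iff₀ hqR]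
    refine ⟨i j, (hi1 j).le.trans hjs, fun u hu => ?_⟩
    have hmem : j ∈ Finset.Ico (-(N * q : ℤ)) (N * q + 1) := by
      rw [Finset.mem_Ico, hj]
      constructor
      · rw [Int.le_floor]
        push_cast
        nlinarith
      · rw [Int.floor_lt]
        push_cast
        nlinarith
    have hstart : Y (i j) ω (D (i j)).1 = (D (i j)).2 := hY.before (i j) _ ω le_rfl
    have hnot : ¬ (η / 2 < dist (Y (i j) ω u) (Y (i j) ω (D (i j)).1)) := by
      intro hlt
      refine hcon (mem_biUnion hmem ⟨?_, u, ?_, ?_, hlt⟩)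
      · rw [hstart, Metric.mem_closedBall]
        linarith [hi3 j]
      · linarith [hi1 j, hu.1]
      · have := hi2 j
        have := hu.2
        push_cast
        have e : (3 : ℝ) / q = 1 / q + 1 / q + 1 / q := by ring
        linarith
    rw [hstart] at hnot
    linarith [dist_triangle (Y (i j) ω u) (D (i j)).2 p, hi3 j]
  refine (measure_mono hbad).trans ((measure_biUnion_finset_le _ _).trans ?_)
  refine (Finset.sum_le_sum fun j _ => H (3 / q) (by positivity) hstep (i j) _ le_rfl).trans ?_
  rw [Finset.sum_const, Int.card_Ico, nsmul_eq_mul]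
  have hcard : ((N : ℤ) * q + 1 - -(N * q : ℤ)).toNat ≤ (2 * N + 1) * q := by
    have : ((N : ℤ) * q + 1 - -(N * q : ℤ)) = ((2 * (N * q) + 1 : ℕ) : ℤ) := by push_cast; ring
    rw [this, Int.toNat_natCast]
    nlinarith
  have hfin : ((((2 * N + 1) * q : ℕ) : ℝ≥0) * (κ * (3 / q)) : ℝ≥0) = ((3 * (2 * N + 1) : ℕ) : ℝ≥0) * κ := by
    push_cast
    field_simp
  calc _ ≤ (((2 * N + 1) * q : ℕ) : ℝ≥0∞) * (κ * (3 / q : ℝ≥0)) := by gcongr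
    _ = _ := by exact_mod_cast congrArg (fun x : ℝ≥0 => (x : ℝ≥0∞)) hfin

/-- The local equicontinuity of the trajectories. -/
lemma IsVersionFamily.ae_locally_equicontinuous [Countable I]
    (hY : IsVersionFamily μ ψ D (fun i t ω => Y i ω t)) (hψ : IsStochasticFlow P μ ψ)
    (hP : ∀ n, IsFellerTransition (P n)) (hTF2 : TF2 P) (hTF3 : TF3 P)
    {V : Set M} {𝓔 : Set (Set M)} (hM : IsMetricGraph V 𝓔) (hD : DenseRange D) (o : M) :
    ∀ᵐ ω ∂μ, ∀ (N : ℕ) (r : ℝ), 0 < r → ∃ h : ℝ, 0 < h ∧ ∀ i s, (D i).1 ≤ s → |s| ≤ N →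
      dist (Y i ω s) o ≤ N → ∀ u ∈ Icc s (s + h), dist (Y i ω u) (Y i ω s) ≤ r := by
  suffices h : ∀ (N k : ℕ), ∀ᵐ ω ∂μ, ∃ h : ℝ, 0 < h ∧ ∀ i s, (D i).1 ≤ s → |s| ≤ N →
      dist (Y i ω s) o ≤ N → ∀ u ∈ Icc s (s + h), dist (Y i ω u) (Y i ω s) ≤ 1 / ((k : ℝ) + 1) by
    filter_upwards [ae_all_iff.2 fun N => ae_all_iff.2 (h N)] with ω hω N r hr
    obtain ⟨k, hk⟩ := exists_nat_one_div_lt hr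
    obtain ⟨h, hh, H⟩ := hω N k
    exact ⟨h, hh, fun i s h1 h2 h3 u hu => (H i s h1 h2 h3 u hu).trans hk.le⟩
  intro N k
  set r : ℝ := 1 / ((k : ℝ) + 1) with hr
  have hr0 : 0 < r := by positivity
  choose R n γ hst hV using fun x : M => hM.exists_star x
  -- A path within ρ of x is kept within 3ρ by guards posted at distance 2ρ, so its displacement is
  -- at most 4ρ ≤ r/2.
  set ρ : M → ℝ := fun x => min (R x / 3) (r / 8) with hρ
  have hρ0 : ∀ x, 0 < ρ x := fun x => lt_min (by have := (hst x).pos; positivity) (by positivity)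
  have hρR : ∀ x, 3 * ρ x ≤ R x := fun x => by linarith [min_le_left (R x / 3) (r / 8)]
  have hρr : ∀ x, ρ x ≤ r / 8 := fun x => min_le_right _ _
  choose η hη hηball using fun x i => (hst x).exists_trap_radius (hρ0 x) (hρR x) i
  obtain ⟨F, -, hF⟩ := (isCompact_closedBall o N).elim_nhds_subcover (fun x => Metric.ball x (ρ x))
    fun x _ => Metric.ball_mem_nhds x (hρ0 x)
  have hguard : ∀ᵐ ω ∂μ, ∀ x ∈ (F : Set M), ∀ i, ∃ h : ℝ, 0 < h ∧ ∀ s : ℝ, |s| ≤ N → ∃ j, (D j).1 ≤ s ∧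
      ∀ u ∈ Icc s (s + h), dist (Y j ω u) (γ x i (2 * ρ x)) < η x i := by
    rw [ae_ball_iff F.countable_toSet]
    intro x _
    rw [ae_all_iff]
    intro i
    exact hY.ae_exists_guard hψ hP hTF3 hD _ (hη x i) N
  filter_upwards [hguard, hY.ae_coalescence hψ hP hTF2] with ω hg hc
  choose! h hh hgu using hg
  obtain ⟨h₁, hh₁, hle⟩ : ∃ h₁ : ℝ, 0 < h₁ ∧ ∀ x ∈ F, ∀ i, h₁ ≤ h x i := by
    have h1 : ∀ x ∈ F, ∃ h₁ : ℝ, 0 < h₁ ∧ ∀ i, h₁ ≤ h x i := by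
      intro x hx
      obtain ⟨b, hb, hbl⟩ := exists_pos_le_finset Finset.univ fun i _ => hh x hx i
      exact ⟨b, hb, fun i => hbl i (Finset.mem_univ i)⟩
    choose! b hb hbl using h1
    obtain ⟨c, hc, hcl⟩ := exists_pos_le_finset F hb
    exact ⟨c, hc, fun x hx i => (hcl x hx).trans (hbl x hx i)⟩
  refine ⟨h₁, hh₁, fun j s hjs hs hjo u hu => ?_⟩
  obtain ⟨x, hx, hxs⟩ := mem_iUnion₂.1 (hF (Metric.mem_closedBall.2 hjo))
  have hxF : x ∈ (F : Set M) := hx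
  choose g hg1 hg2 using fun i => hgu x hxF i s hs
  have hmono : ∀ i, ∀ v ∈ Icc s u, v ∈ Icc s (s + h x i) := fun i v hv =>
    ⟨hv.1, hv.2.trans (hu.2.trans (by have := hle x hx i; linarith))⟩
  have h3 : dist x (Y j ω u) ≤ 3 * ρ x := by
    refine (hst x).dist_le_of_trap (hρ0 x) (hρR x) (f := fun t => Y j ω t) (s := s)
      (b := fun i t => Y (g i) ω t) (by fun_prop) ?_ (fun i => by fun_prop) ?_ ?_ hu.1
    · rw [dist_comm]
      exact (Metric.mem_ball.1 hxs).le
    · exact fun i v hv => hηball x i (hg2 i v (hmono i v hv))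
    · exact fun i v hv hvv => hc j (g i) v (hjs.trans hv.1) ((hg1 i).trans hv.1) hvv u hv.2
  have h4 := dist_triangle_left (Y j ω u) (Y j ω s) x
  have h5 := Metric.mem_ball'.1 hxs
  have := hρr x
  linarith

end Events

/-! ### Finitely many trajectories survive -/

/-- Elements of the same colour can be paired, up to one element of each colour. -/
lemma exists_matching (q : ℕ) (c : ℕ → ℕ) (R : Finset ℕ) (hc : ∀ i ∈ R, c i < q) :
    ∃ W : Finset (ℕ × ℕ), (∀ x ∈ W, x.1 ∈ R ∧ x.2 ∈ R ∧ x.1 ≠ x.2 ∧ c x.1 = c x.2) ∧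
      R.card ≤ 2 * W.card + q ∧
      ∀ S ⊆ R, S.card + (W.filter fun x => ¬ (x.1 ∈ S ∧ x.2 ∈ S)).card ≤ R.card := by
  induction R using Finset.strongInduction with
  | H R ih =>
    by_cases hinj : InjOn c R
    · refine ⟨∅, by simp, ?_, fun S hS => by simpa using Finset.card_le_card hS⟩
      have := Finset.card_le_card_of_injOn c (t := Finset.range q)
        (fun i hi => Finset.mem_range.2 (hc i hi)) hinj
      simpa using this
    -- Two elements of one colour are removed as a pair and the remainder is matched by induction.
    -- As the pairs are disjoint, every pair not contained in S costs S at least one element.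
    · simp only [InjOn, not_forall] at hinj
      obtain ⟨a, ha, b, hb, hab, hne⟩ := hinj
      have ha' : a ∈ R := ha
      have hb' : b ∈ R := hb
      have hb'' : b ∈ R.erase a := Finset.mem_erase.2 ⟨Ne.symm hne, hb'⟩
      set R' := (R.erase a).erase b with hR'
      have hsub : R' ⊆ R := (Finset.erase_subset _ _).trans (Finset.erase_subset _ _)
      have haR' : a ∉ R' := by simp [hR']
      have hbR' : b ∉ R' := by simp [hR']
      have hcard : R'.card + 2 = R.card := by
        have h1 := Finset.card_erase_add_one ha'
        have h2 := Finset.card_erase_add_one hb''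
        rw [← hR'] at h2
        omega
      obtain ⟨W, h1, h2, h3⟩ := ih R' ((Finset.ssubset_iff_of_subset hsub).2 ⟨a, ha', haR'⟩)
        fun i hi => hc i (hsub hi)
      have hnot : (a, b) ∉ W := fun h => haR' (h1 _ h).1
      refine ⟨insert (a, b) W, ?_, ?_, fun S hS => ?_⟩
      · intro x hx
        rcases Finset.mem_insert.1 hx with rfl | hx
        · exact ⟨ha', hb', hne, hab⟩
        · obtain ⟨h4, h5, h6⟩ := h1 x hx
          exact ⟨hsub h4, hsub h5, h6⟩
      · rw [Finset.card_insert_of_notMem hnot]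
        omega
      · have h4 := h3 (S ∩ R') Finset.inter_subset_right
        have h5 : W.filter (fun x => ¬ (x.1 ∈ S ∩ R' ∧ x.2 ∈ S ∩ R')) =
            W.filter fun x => ¬ (x.1 ∈ S ∧ x.2 ∈ S) := by
          refine Finset.filter_congr fun x hx => ?_
          obtain ⟨h6, h7, -⟩ := h1 x hx
          simp [h6, h7]
        rw [h5] at h4
        have h6 : S \ R' ⊆ {a, b} := by
          intro x hx
          rw [Finset.mem_sdiff] at hx
          have := hS hx.1
          by_contra hcon
          simp only [Finset.mem_insert, Finset.mem_singleton, not_or] at hcon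
          exact hx.2 (Finset.mem_erase.2 ⟨hcon.2, Finset.mem_erase.2 ⟨hcon.1, this⟩⟩)
        have h7 : S.card = (S ∩ R').card + (S \ R').card := (Finset.card_inter_add_card_sdiff S R').symm
        have h8 : ({a, b} : Finset ℕ).card = 2 := Finset.card_pair hne
        by_cases h9 : a ∈ S ∧ b ∈ S
        · rw [Finset.filter_insert, if_neg (not_not.2 h9)]
          have := Finset.card_le_card h6
          omega
        · have h10 : S \ R' ⊂ {a, b} := by
            refine (Finset.ssubset_iff_of_subset h6).2 ?_
            by_contra! hcon
            exact h9 ⟨(Finset.mem_sdiff.1 (hcon a (by simp))).1,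
              (Finset.mem_sdiff.1 (hcon b (by simp))).1⟩
          have h11 := Finset.card_lt_card h10
          rw [Finset.filter_insert, if_pos h9,
            Finset.card_insert_of_notMem (fun h => hnot (Finset.mem_filter.1 h).1)]
          omega

/-! ### Representatives of the occupied positions -/

section Reps

variable {M : Type*} [MetricSpace M] {Ω : Type*}

/-- The trajectory `i` stays in `K` during `[s, τ]`. -/
def Stays (Y : ℕ → Ω → C(ℝ, M)) (K : Set M) (s τ : ℝ) (i : ℕ) (ω : Ω) : Prop :=
  ∀ u ∈ Icc s τ, Y i ω u ∈ K

/-- The trajectory `i` starts before `s`, stays in `K` during `[s, τ]`, and is at time `τ` the first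
of these trajectories with its position. -/
def IsRep (D : ℕ → ℝ × M) (Y : ℕ → Ω → C(ℝ, M)) (K : Set M) (s τ : ℝ) (i : ℕ) (ω : Ω) : Prop :=
  (D i).1 ≤ s ∧ Stays Y K s τ i ω ∧
    ∀ j < i, (D j).1 ≤ s → Stays Y K s τ j ω → Y j ω τ ≠ Y i ω τ

open Classical in
/-- The representatives with index less than `m`. -/
def reps (D : ℕ → ℝ × M) (Y : ℕ → Ω → C(ℝ, M)) (K : Set M) (s τ : ℝ) (m : ℕ) (ω : Ω) : Finset ℕ :=
  (Finset.range m).filter fun i => IsRep D Y K s τ i ω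

variable {D : ℕ → ℝ × M} {Y : ℕ → Ω → C(ℝ, M)} {K : Set M} {s τ τ' : ℝ} {m i : ℕ} {ω : Ω}

lemma mem_reps : i ∈ reps D Y K s τ m ω ↔ i < m ∧ IsRep D Y K s τ i ω := by
  simp [reps]

lemma card_reps_le : (reps D Y K s τ m ω).card ≤ m :=
  (Finset.card_le_card (t := Finset.range m) fun _ hi => Finset.mem_range.2 (mem_reps.1 hi).1).trans
    (by simp)

/-- A path of smaller index at the same position at time τ would coincide with path i from then on.
It would thus also stay in K up to τ', and i would not be first at τ'. -/
lemma reps_mono (hs : s ≤ τ) (hτ : τ ≤ τ')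
    (hc : ∀ i j s, (D i).1 ≤ s → (D j).1 ≤ s → Y i ω s = Y j ω s → ∀ t, s ≤ t → Y i ω t = Y j ω t) :
    reps D Y K s τ' m ω ⊆ reps D Y K s τ m ω := by
  intro i hi
  rw [mem_reps] at hi ⊢
  obtain ⟨him, h1, h2, h3⟩ := hi
  refine ⟨him, h1, fun u hu => h2 u ⟨hu.1, hu.2.trans hτ⟩, fun j hj hj1 hj2 heq => ?_⟩
  have hcoal := hc j i τ (hj1.trans hs) (h1.trans hs) heq
  refine h3 j hj hj1 (fun u hu => ?_) (hcoal τ' hτ)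
  rcases le_total u τ with h | h
  · exact hj2 u ⟨hu.1, h⟩
  · rw [hcoal u h]
    exact h2 u hu

/-- If there is a bound for the number of representatives, the set of positions is finite. -/
lemma finite_of_card_reps_le {b : ℕ} (hb : ∀ m, (reps D Y K s τ m ω).card ≤ b) :
    {x | ∃ i, (D i).1 ≤ s ∧ Stays Y K s τ i ω ∧ Y i ω τ = x}.Finite := by
  have hfin : {i | IsRep D Y K s τ i ω}.Finite := by
    by_contra hinf
    obtain ⟨F, hF, hcard⟩ := Set.Infinite.exists_subset_card_eq hinf (b + 1)
    obtain ⟨m, hm⟩ := F.exists_nat_subset_range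
    have : F ⊆ reps D Y K s τ m ω := fun i hi => mem_reps.2 ⟨Finset.mem_range.1 (hm hi), hF hi⟩
    have := Finset.card_le_card this
    have := hb m
    omega
  refine (hfin.image fun i => Y i ω τ).subset ?_
  rintro x ⟨i, h1, h2, rfl⟩
  classical
  have hex : ∃ j, (D j).1 ≤ s ∧ Stays Y K s τ j ω ∧ Y j ω τ = Y i ω τ := ⟨i, h1, h2, rfl⟩
  obtain ⟨h3, h4, h5⟩ := Nat.find_spec hex
  refine ⟨Nat.find hex, ⟨h3, h4, fun j hj hj1 hj2 heq => ?_⟩, h5⟩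
  exact Nat.find_min hex hj ⟨hj1, hj2, heq.trans h5⟩

variable [ProperSpace M] [MeasurableSpace M] [BorelSpace M] [MeasurableSpace Ω]

/-- Only positions up to time τ are assumed measurable, so that the result also applies with
`pastSigma` at τ as the σ-field on Ω. For closed K the rational times, clamped to [s, τ], suffice.
-/
lemma measurableSet_stays (hK : IsClosed K) (hs : s ≤ τ)
    (hY : ∀ i u, u ≤ τ → Measurable fun ω => Y i ω u) (i : ℕ) :
    MeasurableSet {ω | Stays Y K s τ i ω} := by
  have e : {ω | Stays Y K s τ i ω} = ⋂ q : ℚ, {ω | Y i ω (max s (min q τ)) ∈ K} := by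
    ext ω
    simp only [mem_iInter, mem_ofPred_eq]
    constructor
    · exact fun h q => h _ ⟨le_max_left _ _, max_le hs (min_le_right _ _)⟩
    · intro h u hu
      have hcl : IsClosed {v : ℝ | Y i ω (max s (min v τ)) ∈ K} := hK.preimage (by fun_prop)
      have := (hcl.closure_subset_iff (s := range ((↑) : ℚ → ℝ))).2 (by rintro _ ⟨q, rfl⟩; exact h q)
      have hu' := this (Rat.denseRange_cast u)
      simpa [hu.1, hu.2] using hu'
  rw [e]
  exact MeasurableSet.iInter fun q => hY i _ (max_le hs (min_le_right _ _)) hK.measurableSet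

lemma measurableSet_mem_reps (hK : IsClosed K) (hs : s ≤ τ)
    (hY : ∀ i u, u ≤ τ → Measurable fun ω => Y i ω u) (m i : ℕ) :
    MeasurableSet {ω | i ∈ reps D Y K s τ m ω} := by
  simp only [mem_reps, IsRep]
  refine (MeasurableSet.const _).inter ((MeasurableSet.const _).inter
    ((measurableSet_stays hK hs hY i).inter ?_))
  change MeasurableSet {ω | ∀ j < i, (D j).1 ≤ s → Stays Y K s τ j ω → Y j ω τ ≠ Y i ω τ}
  have : {ω | ∀ j < i, (D j).1 ≤ s → Stays Y K s τ j ω → Y j ω τ ≠ Y i ω τ} =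
      ⋂ (j : ℕ) (_ : j < i) (_ : (D j).1 ≤ s), ({ω | Stays Y K s τ j ω} ∩ {ω | Y j ω τ = Y i ω τ})ᶜ := by
    ext ω
    simp
  rw [this]
  exact MeasurableSet.iInter fun j => MeasurableSet.iInter fun _ => MeasurableSet.iInter fun _ =>
    ((measurableSet_stays hK hs hY j).inter
      (measurableSet_eq_fun (hY j τ le_rfl) (hY i τ le_rfl))).compl

lemma measurableSet_reps_eq (hK : IsClosed K) (hs : s ≤ τ)
    (hY : ∀ i u, u ≤ τ → Measurable fun ω => Y i ω u) (m : ℕ) (R : Finset ℕ) :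
    MeasurableSet {ω | reps D Y K s τ m ω = R} := by
  have : {ω | reps D Y K s τ m ω = R} = ⋂ i : ℕ, {ω | i ∈ reps D Y K s τ m ω ↔ i ∈ R} := by
    ext ω
    simp [Finset.ext_iff]
  rw [this]
  refine MeasurableSet.iInter fun i => ?_
  by_cases hi : i ∈ R
  · simpa only [hi, iff_true] using measurableSet_mem_reps hK hs hY m i
  · simp only [hi, iff_false]
    exact (measurableSet_mem_reps hK hs hY m i).compl

lemma measurable_card_reps (hK : IsClosed K) (hs : s ≤ τ)
    (hY : ∀ i u, u ≤ τ → Measurable fun ω => Y i ω u) (m : ℕ) :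
    Measurable fun ω => ((reps D Y K s τ m ω).card : ℝ≥0∞) := by
  classical
  have : (fun ω => ((reps D Y K s τ m ω).card : ℝ≥0∞)) = fun ω =>
      ∑ i ∈ Finset.range m, if i ∈ reps D Y K s τ m ω then (1 : ℝ≥0∞) else 0 := by
    funext ω
    rw [Finset.sum_ite_mem, Finset.inter_eq_right.2 fun i hi => Finset.mem_range.2 (mem_reps.1 hi).1]
    simp
  rw [this]
  exact Finset.measurable_sum _ fun i _ =>
    Measurable.ite (measurableSet_mem_reps hK hs hY m i) measurable_const measurable_const

end Reps

/-! ### Decrease of the expected number of representatives over one time step -/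

section Counting

variable {M : Type*} [MetricSpace M] [ProperSpace M] [MeasurableSpace M] [BorelSpace M]
  {P : (n : ℕ) → ℝ≥0 → Kernel (Fin n → M) (Fin n → M)}
  {Ω : Type*} [mΩ : MeasurableSpace Ω] {μ : Measure Ω} [IsProbabilityMeasure μ]
  {ψ : ℝ → ℝ → Ω → MeasMap M} {D : ℕ → ℝ × M} {Y : ℕ → Ω → C(ℝ, M)} {K : Set M}

/-- The trajectories of two points that stay in `K` and do not meet up to time `c`. -/
def survivors (K : Set M) (c : ℝ≥0) : Set C(ℝ≥0, Fin 2 → M) :=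
  {w | ∀ u ≤ c, w u 0 ∈ K ∧ w u 1 ∈ K ∧ w u 0 ≠ w u 1}

lemma measurableSet_survivors (hK : IsClosed K) (c : ℝ≥0) : MeasurableSet (survivors K c) := by
  have e : survivors K c = {w : C(ℝ≥0, Fin 2 → M) | MapsTo w (Icc 0 c) {z | z 0 ∈ K ∧ z 1 ∈ K}} ∩
      {w : C(ℝ≥0, Fin 2 → M) | MapsTo w (Icc 0 c) {z | z 0 ≠ z 1}} := by
    ext w
    simp only [survivors, mem_inter_iff, mem_ofPred_eq, MapsTo, mem_Icc, zero_le, true_and]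
    exact ⟨fun h => ⟨fun u hu => ⟨(h u hu).1, (h u hu).2.1⟩, fun u hu => (h u hu).2.2⟩,
      fun h u hu => ⟨(h.1 hu).1, (h.1 hu).2, h.2 hu⟩⟩
  rw [e]
  refine MeasurableSet.inter (IsClosed.measurableSet ?_) (IsOpen.measurableSet ?_)
  · exact ContinuousMap.isClosed_setOfPred_mapsTo
      ((hK.preimage (continuous_apply 0)).inter (hK.preimage (continuous_apply 1))) _
  · exact ContinuousMap.isOpen_setOfPred_mapsTo isCompact_Icc
      (isOpen_ne_fun (continuous_apply 0) (continuous_apply 1))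

lemma survivors_subset {b : ℝ} {c : ℝ≥0} (hb0 : 0 ≤ b) (hb : b < c) :
    survivors K c ⊆ {w | ENNReal.ofReal b < min (exitTime K w) (meetingTime w)} := by
  intro w hw
  have h1 : (c : ℝ≥0∞) ≤ exitTime K w := by
    refine le_iInf₂ fun t ht => ?_
    by_contra! h
    have := hw t (by exact_mod_cast h.le)
    exact ht ⟨this.1, this.2.1⟩
  have h2 : (c : ℝ≥0∞) ≤ meetingTime w := by
    refine le_iInf₂ fun t ht => ?_
    by_contra! h
    exact (hw t (by exact_mod_cast h.le)).2.2 ht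
  refine lt_of_lt_of_le ?_ (le_min h1 h2)
  rw [← ENNReal.ofReal_coe_nnreal, ENNReal.ofReal_lt_ofReal_iff']
  exact ⟨hb, hb0.trans_lt hb⟩

/-- A measurable colouring such that points of `K` with the same colour are close to each other. -/
lemma exists_colouring {F : Finset M} (hF : F.Nonempty) {ε : ℝ}
    (hnet : ∀ y ∈ K, ∃ p ∈ F, dist y p ≤ ε / 2) : ∃ col : M → ℕ, Measurable col ∧
      (∀ y, col y < F.card) ∧ ∀ x ∈ K, ∀ y ∈ K, col x = col y → dist x y ≤ ε := by
  obtain ⟨N, hN⟩ : ∃ N, F.card = N + 1 := ⟨F.card - 1, by have := hF.card_pos; omega⟩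
  set e : ℕ → M := fun k => if h : k < F.card then (F.equivFin.symm ⟨k, h⟩ : M) else hF.choose with he
  have hnear : ∀ y ∈ K, dist (e (SimpleFunc.nearestPtInd e N y)) y ≤ ε / 2 := by
    intro y hy
    obtain ⟨p, hp, hpy⟩ := hnet y hy
    obtain ⟨k, hk⟩ : ∃ k : Fin F.card, F.equivFin.symm k = ⟨p, hp⟩ := ⟨_, F.equivFin.symm_apply_apply _⟩
    have hek : e k = p := by
      simp only [he, k.2, dite_true, Fin.eta, hk]
    have h := SimpleFunc.edist_nearestPt_le e y (k := k) (N := N) (by have := k.2; omega)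
    rw [hek, SimpleFunc.nearestPt, SimpleFunc.map_apply, edist_dist, edist_dist,
      ENNReal.ofReal_le_ofReal_iff dist_nonneg] at h
    exact h.trans (by rwa [dist_comm])
  refine ⟨SimpleFunc.nearestPtInd e N, (SimpleFunc.nearestPtInd e N).measurable, fun y => ?_,
    fun x hx y hy hxy => ?_⟩
  · have := SimpleFunc.nearestPtInd_le e N y
    omega
  · have h1 := hnear x hx
    have h2 := hnear y hy
    rw [hxy] at h1
    linarith [dist_triangle_left x y (e (SimpleFunc.nearestPtInd e N y))]

lemma IsVersionFamily.measure_inter_survivors_le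
    (hY : IsVersionFamily μ ψ D (fun i t ω => Y i ω t)) (hψ : IsStochasticFlow P μ ψ)
    (hP : ∀ n, IsFellerTransition (P n)) (hTF3 : TF3 P) (hK : IsClosed K) {c : ℝ≥0} {p ε : ℝ}
    (hsurv : ∀ x ∈ K, ∀ y ∈ K, dist x y ≤ ε →
      markovLaw (P 2) ![x, y] (survivors K c) ≤ ENNReal.ofReal (1 - p))
    {τ : ℝ} {A : Set Ω} (hA : MeasurableSet[pastSigma (fun i t ω => Y i ω t) τ] A) {i j : ℕ}
    (hi : (D i).1 ≤ τ) (hj : (D j).1 ≤ τ)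
    (hAK : ∀ ω ∈ A, Y i ω τ ∈ K ∧ Y j ω τ ∈ K ∧ dist (Y i ω τ) (Y j ω τ) ≤ ε) :
    μ (A ∩ (fun ω => jointPath ![Y i ω, Y j ω] τ) ⁻¹' survivors K c) ≤ ENNReal.ofReal (1 - p) * μ A := by
  have e : ∀ ω, (fun l => Y ((![i, j] : Fin 2 → ℕ) l) ω) = ![Y i ω, Y j ω] := fun ω => by
    funext l
    fin_cases l <;> rfl
  have hZ := hY.isMarkov_jointPath hψ hP (![i, j] : Fin 2 → ℕ) (a := τ) (by
      rw [Fin.forall_fin_two]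
      exact ⟨hi, hj⟩)
  simp only [e] at hZ
  have hA' : MeasurableSet[pastSigma (fun i t ω => Y i ω t) (τ + ((0 : ℝ≥0) : ℝ))] A := by
    rw [NNReal.coe_zero, add_zero]
    exact hA
  refine (hZ.measure_inter_preimage_path (fun z => hψ.exists_isMarkovLaw hP hTF3 z) hA'
    (measurableSet_survivors hK c)).trans_le ?_
  have hle : pastSigma (fun i t ω => Y i ω t) τ ≤ mΩ :=
    iSup₂_le fun q _ => (hY.measurable q.1 q.2).comap_le
  rw [← setLIntegral_const]
  refine setLIntegral_mono' (hle _ hA) fun ω hω => ?_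
  have e0 : jointPath ![Y i ω, Y j ω] τ 0 = ![Y i ω τ, Y j ω τ] := by
    funext l
    fin_cases l <;> simp [jointPath]
  rw [e0]
  obtain ⟨h1, h2, h3⟩ := hAK ω hω
  exact hsurv _ h1 _ h2 h3

/-- The number of representatives decreases. -/
lemma IsVersionFamily.lintegral_card_reps_le
    (hY : IsVersionFamily μ ψ D (fun i t ω => Y i ω t)) (hψ : IsStochasticFlow P μ ψ)
    (hP : ∀ n, IsFellerTransition (P n)) (hTF2 : TF2 P) (hTF3 : TF3 P) (hK : IsClosed K)
    {F : Finset M} (hF : F.Nonempty) {ε : ℝ} (hnet : ∀ y ∈ K, ∃ x ∈ F, dist y x ≤ ε / 2)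
    {c : ℝ≥0} {p : ℝ} (hp0 : 0 ≤ p) (hp1 : p ≤ 1)
    (hsurv : ∀ x ∈ K, ∀ y ∈ K, dist x y ≤ ε →
      markovLaw (P 2) ![x, y] (survivors K c) ≤ ENNReal.ofReal (1 - p))
    {s τ : ℝ} (hs : s ≤ τ) (m : ℕ) :
    2 * ∫⁻ ω, (reps D Y K s (τ + c) m ω).card ∂μ +
      ENNReal.ofReal p * ∫⁻ ω, (reps D Y K s τ m ω).card ∂μ ≤
    2 * ∫⁻ ω, (reps D Y K s τ m ω).card ∂μ + ENNReal.ofReal p * F.card := by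
  classical
  obtain ⟨col, hcolm, hcolF, hcol⟩ := exists_colouring hF hnet
  have hpast : ∀ i u, u ≤ τ → Measurable[pastSigma (fun i t ω => Y i ω t) τ] fun ω => Y i ω u :=
    fun i u hu => measurable_pastSigma (fun i t ω => Y i ω t) i hu
  have hle : pastSigma (fun i t ω => Y i ω t) τ ≤ mΩ :=
    iSup₂_le fun q _ => (hY.measurable q.1 q.2).comap_le
  -- A countable partition into events known at time τ. On each piece the representatives and their
  -- colours are constant, so the matching W can be chosen deterministically.
  set A : Finset ℕ × (Fin m → ℕ) → Set Ω := fun x => {ω | reps D Y K s τ m ω = x.1} ∩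
    ⋂ i : Fin m, {ω | col (Y i ω τ) = x.2 i} with hA
  have hApast : ∀ x, MeasurableSet[pastSigma (fun i t ω => Y i ω t) τ] (A x) := by
    intro x
    refine @MeasurableSet.inter _ (pastSigma (fun i t ω => Y i ω t) τ) _ _
      (@measurableSet_reps_eq _ _ _ _ _ _ _ _ _ _ _ (pastSigma (fun i t ω => Y i ω t) τ) hK hs
        hpast m x.1)
      (@MeasurableSet.iInter _ _ (pastSigma (fun i t ω => Y i ω t) τ) _ _ fun i => ?_)
    exact (hcolm.comp (hpast i τ le_rfl)) (measurableSet_singleton (x.2 i))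
  have hAm : ∀ x, MeasurableSet (A x) := fun x => hle _ (hApast x)
  have hAd : Pairwise (Function.onFun Disjoint A) := by
    intro x y hxy
    refine Set.disjoint_left.2 fun ω h1 h2 => hxy ?_
    refine Prod.ext (h1.1.symm.trans h2.1) (funext fun i => ?_)
    exact (mem_iInter.1 h1.2 i).symm.trans (mem_iInter.1 h2.2 i)
  have hAu : ⋃ x, A x = univ := eq_univ_of_forall fun ω =>
    mem_iUnion.2 ⟨(reps D Y K s τ m ω, fun i => col (Y i ω τ)), rfl, mem_iInter.2 fun _ => rfl⟩
  have hsplit : ∀ f : Ω → ℝ≥0∞, ∫⁻ ω, f ω ∂μ = ∑' x, ∫⁻ ω in A x, f ω ∂μ := fun f => by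
    rw [← lintegral_iUnion hAm hAd, hAu, Measure.restrict_univ]
  have hFsum : ENNReal.ofReal p * F.card = ∑' x, ENNReal.ofReal p * F.card * μ (A x) := by
    rw [ENNReal.tsum_mul_left, ← measure_iUnion hAd hAm, hAu, measure_univ, mul_one]
  rw [hFsum, hsplit, hsplit, ← ENNReal.tsum_mul_left, ← ENNReal.tsum_mul_left,
    ← ENNReal.tsum_mul_left, ← ENNReal.tsum_add, ← ENNReal.tsum_add]
  refine ENNReal.tsum_le_tsum fun x => ?_
  rcases (A x).eq_empty_or_nonempty with hemp | ⟨ω₀, hω₀⟩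
  · simp [hemp]
  obtain ⟨R, κ⟩ := x
  have hRm : ∀ i ∈ R, i < m := fun i hi => by
    rw [← show _ = R from hω₀.1, mem_reps] at hi
    exact hi.1
  set κ' : ℕ → ℕ := fun i => if h : i < m then κ ⟨i, h⟩ else 0 with hκ'
  have hcolκ : ∀ ω ∈ A (R, κ), ∀ i ∈ R, col (Y i ω τ) = κ' i := fun ω hω i hi => by
    simp only [hκ', hRm i hi, dite_true]
    exact mem_iInter.1 hω.2 ⟨i, hRm i hi⟩
  obtain ⟨W, hW1, hW2, hW3⟩ := exists_matching F.card κ' R fun i hi => by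
    rw [← hcolκ ω₀ hω₀ i hi]
    exact hcolF _
  have hR : ∀ ω ∈ A (R, κ), reps D Y K s τ m ω = R := fun ω hω => hω.1
  have hRK : ∀ ω ∈ A (R, κ), ∀ i ∈ R, (D i).1 ≤ τ ∧ Y i ω τ ∈ K := fun ω hω i hi => by
    rw [← hR ω hω, mem_reps] at hi
    exact ⟨hi.2.1.trans hs, hi.2.2.1 τ ⟨hs, le_rfl⟩⟩
  set G : ℕ × ℕ → Set Ω := fun x => (fun ω => jointPath ![Y x.1 ω, Y x.2 ω] τ) ⁻¹' survivors K c
    with hG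
  have hGm : ∀ x, MeasurableSet (G x) := fun x => by
    refine (measurable_continuousMap_iff.2 fun t => measurable_pi_lambda _ fun l => ?_)
      (measurableSet_survivors hK c)
    fin_cases l
    · exact hY.measurable x.1 (τ + t)
    · exact hY.measurable x.2 (τ + t)
  -- Paired paths have the same colour and so are within ε of each other. Given the piece, the pair
  -- meets or leaves K before τ + c with probability at least p.
  have hkill : ∀ x ∈ W, ENNReal.ofReal p * μ (A (R, κ)) ≤ μ (A (R, κ) ∩ (G x)ᶜ) := by
    intro x hx
    obtain ⟨h1, h2, h3, h4⟩ := hW1 x hx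
    have h5 := hY.measure_inter_survivors_le hψ hP hTF3 hK hsurv (hApast (R, κ))
      (hRK ω₀ hω₀ _ h1).1 (hRK ω₀ hω₀ _ h2).1 fun ω hω => ⟨(hRK ω hω _ h1).2, (hRK ω hω _ h2).2,
        hcol _ (hRK ω hω _ h1).2 _ (hRK ω hω _ h2).2
          ((hcolκ ω hω _ h1).trans (h4.trans (hcolκ ω hω _ h2).symm))⟩
    have h6 : μ (A (R, κ)) = μ (A (R, κ) ∩ G x) + μ (A (R, κ) ∩ (G x)ᶜ) := by
      rw [← sdiff_eq, measure_inter_add_sdiff _ (hGm x)]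
    have h7 : ENNReal.ofReal p * μ (A (R, κ)) + ENNReal.ofReal (1 - p) * μ (A (R, κ)) =
        μ (A (R, κ)) := by
      rw [← add_mul, ← ENNReal.ofReal_add hp0 (by linarith)]
      simp
    refine ENNReal.le_of_add_le_add_right (a := ENNReal.ofReal (1 - p) * μ (A (R, κ)))
      (by finiteness) ?_
    rw [h7]
    calc μ (A (R, κ)) = _ := h6
      _ ≤ ENNReal.ofReal (1 - p) * μ (A (R, κ)) + μ (A (R, κ) ∩ (G x)ᶜ) := by gcongr
      _ = _ := add_comm _ _
  -- A broken pair cannot consist of two representatives at τ + c: either a member has left K, or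
  -- the two have coalesced and only the one with the smaller index could still count.
  have hpt : ∀ᵐ ω ∂μ.restrict (A (R, κ)), ((reps D Y K s (τ + c) m ω).card : ℝ≥0∞) +
      ∑ x ∈ W, (G x)ᶜ.indicator 1 ω ≤ R.card := by
    filter_upwards [ae_restrict_mem (hAm (R, κ)),
      ae_restrict_of_ae (hY.ae_coalescence hψ hP hTF2)] with ω hω hc
    have hsub : reps D Y K s (τ + c) m ω ⊆ R := by
      rw [← hR ω hω]
      exact reps_mono hs (by simp) hc
    have h1 := hW3 _ hsub
    have h2 : ∑ x ∈ W, (G x)ᶜ.indicator (1 : Ω → ℝ≥0∞) ω = (W.filter fun x => ω ∈ (G x)ᶜ).card := by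
      simp only [indicator_apply, Pi.one_apply]
      rw [Finset.sum_boole]
    rw [h2]
    have h3 : (W.filter fun x => ω ∈ (G x)ᶜ).card ≤ (W.filter fun x =>
        ¬ (x.1 ∈ reps D Y K s (τ + c) m ω ∧ x.2 ∈ reps D Y K s (τ + c) m ω)).card := by
      refine Finset.card_le_card (Finset.monotone_filter_right W fun x hx hx' hmem => hx' ?_)
      obtain ⟨h5, h6, h7, -⟩ := hW1 x hx
      rw [mem_reps, mem_reps] at hmem
      obtain ⟨⟨-, a1, a2, a3⟩, -, b1, b2, b3⟩ := hmem
      intro u hu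
      have hu' : (u : ℝ) ≤ c := by exact_mod_cast hu
      have hmemI : τ + (u : ℝ) ∈ Icc s (τ + c) := ⟨hs.trans (by simp), by linarith⟩
      refine ⟨a2 _ hmemI, b2 _ hmemI, fun heq => ?_⟩
      have hend : Y x.1 ω (τ + c) = Y x.2 ω (τ + c) :=
        hc x.1 x.2 (τ + u) (a1.trans hmemI.1) (b1.trans hmemI.1) heq _ (by linarith)
      rcases lt_or_gt_of_ne h7 with hlt | hlt
      · exact b3 _ hlt a1 a2 hend
      · exact a3 _ hlt b1 b2 hend.symm
    exact_mod_cast (Nat.add_le_add_left h3 _).trans h1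
  have hint := lintegral_mono_ae hpt
  rw [lintegral_add_right _ (Finset.measurable_sum _ fun x _ =>
      measurable_one.indicator (hGm x).compl), lintegral_finsetSum _ fun x _ =>
      measurable_one.indicator (hGm x).compl, lintegral_const, Measure.restrict_apply_univ] at hint
  have hsum : (W.card : ℝ≥0∞) * (ENNReal.ofReal p * μ (A (R, κ))) ≤
      ∑ x ∈ W, ∫⁻ ω in A (R, κ), (G x)ᶜ.indicator 1 ω ∂μ := by
    rw [← nsmul_eq_mul, ← Finset.sum_const]
    refine Finset.sum_le_sum fun x hx => (hkill x hx).trans_eq ?_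
    rw [lintegral_indicator_one (hGm x).compl, Measure.restrict_apply (hGm x).compl, inter_comm]
  have hRint : ∫⁻ ω in A (R, κ), ((reps D Y K s τ m ω).card : ℝ≥0∞) ∂μ = R.card * μ (A (R, κ)) := by
    rw [setLIntegral_congr_fun (g := fun _ => (R.card : ℝ≥0∞)) (hAm _)
      fun ω hω => by rw [hR ω hω], setLIntegral_const]
  rw [hRint]
  -- There are at least (|R| - |F|)/2 pairs. The estimate is kept additive and doubled to avoid
  -- truncated subtraction and halving in `ℝ≥0∞`.
  have hcard : (R.card : ℝ≥0∞) ≤ 2 * W.card + F.card := by exact_mod_cast hW2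
  calc _ ≤ 2 * ∫⁻ ω in A (R, κ), ((reps D Y K s (τ + c) m ω).card : ℝ≥0∞) ∂μ +
        ENNReal.ofReal p * ((2 * W.card + F.card) * μ (A (R, κ))) := by gcongr
    _ = 2 * (∫⁻ ω in A (R, κ), ((reps D Y K s (τ + c) m ω).card : ℝ≥0∞) ∂μ +
        (W.card : ℝ≥0∞) * (ENNReal.ofReal p * μ (A (R, κ)))) +
        ENNReal.ofReal p * F.card * μ (A (R, κ)) := by ring
    _ ≤ 2 * (R.card * μ (A (R, κ))) + ENNReal.ofReal p * F.card * μ (A (R, κ)) := by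
      gcongr
      exact (add_le_add_right hsum _).trans hint

end Counting

/-! ### Summation over shrinking scales -/

section Finiteness

/-- After k steps, e 0 is at most aᵏ e k plus b times a partial geometric sum of ratio a/θ. The a
priori bound m only makes the first term vanish and does not enter the result. -/
lemma le_of_recursion {e : ℕ → ℝ} {m b a θ : ℝ} (ha0 : 0 ≤ a) (haθ : a < θ) (hθ : θ < 1) (hb : 0 ≤ b)
    (hm : ∀ k, e k ≤ m) (h : ∀ k, e k ≤ a * e (k + 1) + b * θ⁻¹ ^ k) : e 0 ≤ b / (1 - a / θ) := by
  have hθ0 : 0 < θ := ha0.trans_lt haθ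
  have hr0 : 0 ≤ a / θ := by positivity
  have hr1 : a / θ < 1 := (div_lt_one hθ0).2 haθ
  have key : ∀ k, e 0 ≤ a ^ k * e k + b * ∑ j ∈ Finset.range k, (a / θ) ^ j := by
    intro k
    induction k with
    | zero => simp
    | succ k ih =>
      rw [Finset.sum_range_succ]
      have h1 := mul_le_mul_of_nonneg_left (h k) (pow_nonneg ha0 k)
      have h2 : (a / θ) ^ k = a ^ k * θ⁻¹ ^ k := by rw [div_eq_mul_inv, mul_pow]
      rw [h2, pow_succ]
      linarith
  have hlim : Tendsto (fun k => a ^ k * m + b * (1 - a / θ)⁻¹) atTop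
      (𝓝 (0 * m + b * (1 - a / θ)⁻¹)) :=
    ((tendsto_pow_atTop_nhds_zero_of_lt_one ha0 (haθ.trans hθ)).mul_const m).add_const _
  rw [zero_mul, zero_add] at hlim
  rw [div_eq_mul_inv]
  refine ge_of_tendsto' hlim fun k => (key k).trans ?_
  have h1 := mul_le_mul_of_nonneg_left (hm k) (pow_nonneg ha0 k)
  have h2 : ∑ j ∈ Finset.range k, (a / θ) ^ j ≤ (1 - a / θ)⁻¹ := by
    rw [← tsum_geometric_of_lt_one hr0 hr1]
    exact (summable_geometric_of_lt_one hr0 hr1).sum_le_tsum _ fun _ _ => by positivity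
  have h3 := mul_le_mul_of_nonneg_left h2 hb
  linarith

variable {M : Type*} [MetricSpace M] [ProperSpace M] [MeasurableSpace M] [BorelSpace M]
  {P : (n : ℕ) → ℝ≥0 → Kernel (Fin n → M) (Fin n → M)}
  {Ω : Type*} [mΩ : MeasurableSpace Ω] {μ : Measure Ω} [IsProbabilityMeasure μ]
  {ψ : ℝ → ℝ → Ω → MeasMap M} {D : ℕ → ℝ × M} {Y : ℕ → Ω → C(ℝ, M)}

/-- The bound B does not depend on m, so it survives the passage to the whole family. It is obtained
by running the one-step estimate backwards from t through ever finer scales. -/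
lemma IsVersionFamily.exists_lintegral_card_reps_le
    (hY : IsVersionFamily μ ψ D (fun i t ω => Y i ω t)) (hψ : IsStochasticFlow P μ ψ)
    (hP : ∀ n, IsFellerTransition (P n)) (hTF2 : TF2 P) (hTF3 : TF3 P) {V : Set M} (hTF5 : TF5 V P)
    {x : M} {R : ℝ} {N : ℕ} {γ : Fin N → ℝ → M} (hγ : IsStar x R γ)
    (hV : Metric.closedBall x R ∩ V ⊆ {x}) {s t : ℝ} (hst : s < t) :
    ∃ B : ℝ, ∀ m, ∫⁻ ω, (reps D Y (closure (Metric.ball x R)) s t m ω).card ∂μ ≤ ENNReal.ofReal B := by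
  set K := closure (Metric.ball x R) with hKdef
  have hK : IsClosed K := isClosed_closure
  have hxK : x ∈ K := subset_closure (Metric.mem_ball_self hγ.pos)
  obtain ⟨β, p, hβ, hp, hTF⟩ := hTF5 K (hγ.isSimpleCompact hV)
  have hp1 : p ≤ 1 := by
    have h1 := hTF x hxK x hxK 1 one_pos (by simp)
    have h2 : (0 : ℝ) ≤ _ := (measureReal_nonneg (μ := markovLaw (P 2) ![x, x])).trans h1
    linarith
  obtain ⟨C, hC, hnet⟩ := hγ.exists_net
  -- One step contracts by the factor a = 1 - p/2. The scales shrink by a ratio θ strictly between a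
  -- and 1, so the error terms, which grow like θ⁻ʲ, are still summable against aʲ.
  set θ : ℝ := 1 - p / 4 with hθ
  set a : ℝ := 1 - p / 2 with ha
  have hθ0 : 0 < θ := by linarith
  have hθ1 : θ < 1 := by linarith
  set ε₀ : ℝ := min 1 ((t - s) * (1 - θ) / (2 * β)) with hε₀
  have hε₀0 : 0 < ε₀ := lt_min one_pos
    (div_pos (mul_pos (by linarith) (by linarith)) (by positivity))
  have hε₀1 : ε₀ ≤ 1 := min_le_left _ _
  have hε₀t : 2 * β * ε₀ ≤ (t - s) * (1 - θ) := by
    have := min_le_right 1 ((t - s) * (1 - θ) / (2 * β))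
    rw [← hε₀, le_div_iff₀ (by positivity)] at this
    linarith
  set ε : ℕ → ℝ := fun j => ε₀ * θ ^ j with hε
  have hε0 : ∀ j, 0 < ε j := fun j => by positivity
  have hε1 : ∀ j, ε j ≤ 1 := fun j =>
    mul_le_one₀ hε₀1 (by positivity) (pow_le_one₀ hθ0.le hθ1.le)
  -- Twice the time in (TF5), because `survivors_subset` needs a strict inequality.
  set h : ℕ → ℝ≥0 := fun j => (2 * β * ε j ^ 2).toNNReal with hh
  have hhj : ∀ j, (h j : ℝ) = 2 * β * ε j ^ 2 := fun j => Real.coe_toNNReal _ (by positivity)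
  -- The steps are laid out backwards from t, the finest scales coming earliest. By the choice of ε₀
  -- they never reach below s.
  set τ : ℕ → ℝ := fun j => t - ∑ i ∈ Finset.range j, (h i : ℝ) with hτ
  have hτs : ∀ j, s ≤ τ j := by
    intro j
    have h1 : ∀ i, (h i : ℝ) ≤ 2 * β * ε₀ * θ ^ i := fun i => by
      rw [hhj, sq]
      have : ε i * ε i ≤ ε i := mul_le_of_le_one_left (hε0 i).le (hε1 i)
      have := mul_le_mul_of_nonneg_left this (show 0 ≤ 2 * β by positivity)
      exact this.trans_eq (by rw [hε]; ring)
    have h2 : ∑ i ∈ Finset.range j, (h i : ℝ) ≤ t - s := by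
      calc ∑ i ∈ Finset.range j, (h i : ℝ) ≤ ∑ i ∈ Finset.range j, 2 * β * ε₀ * θ ^ i :=
            Finset.sum_le_sum fun i _ => h1 i
        _ = 2 * β * ε₀ * ∑ i ∈ Finset.range j, θ ^ i := by rw [Finset.mul_sum]
        _ ≤ 2 * β * ε₀ * (1 - θ)⁻¹ := by
          gcongr
          rw [← tsum_geometric_of_lt_one hθ0.le hθ1]
          exact (summable_geometric_of_lt_one hθ0.le hθ1).sum_le_tsum _ fun _ _ => by positivity
        _ ≤ t - s := by
          rw [← div_eq_mul_inv, div_le_iff₀ (by linarith)]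
          exact hε₀t
    simp only [hτ]
    linarith
  refine ⟨p * C / ε₀ / (1 - a / θ), fun m => ?_⟩
  set e : ℕ → ℝ≥0∞ := fun j => ∫⁻ ω, (reps D Y K s (τ j) m ω).card ∂μ with he
  have hem : ∀ j, e j ≤ m := fun j => by
    calc e j ≤ ∫⁻ _, (m : ℝ≥0∞) ∂μ := lintegral_mono fun ω => Nat.cast_le.2 card_reps_le
      _ = m := by simp
  have hetop : ∀ j, e j ≠ ∞ := fun j => ne_top_of_le_ne_top (by simp) (hem j)
  have hstep : ∀ j, (e j).toReal ≤ a * (e (j + 1)).toReal + p * C / ε₀ * θ⁻¹ ^ j := by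
    intro j
    obtain ⟨F, hF1, hF2⟩ := hnet (ε j / 2) (half_pos (hε0 j)) (by linarith [hε1 j])
    have hFne : F.Nonempty := by
      obtain ⟨q, hq, -⟩ := hF2 x (Metric.mem_closedBall_self hγ.pos.le)
      exact ⟨q, hq⟩
    have hsurv : ∀ y ∈ K, ∀ z ∈ K, dist y z ≤ ε j →
        markovLaw (P 2) ![y, z] (survivors K (h j)) ≤ ENNReal.ofReal (1 - p) := by
      intro y hy z hz hyz
      have hprob := (isMarkovLaw_markovLaw (hψ.exists_isMarkovLaw hP hTF3 ![y, z])).prob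
      rw [ENNReal.le_ofReal_iff_toReal_le (measure_ne_top _ _) (by linarith)]
      refine le_trans ?_ (hTF y hy z hz (ε j) (hε0 j) hyz)
      refine measureReal_mono (survivors_subset (by positivity) ?_)
      rw [hhj]
      have : 0 < β * ε j ^ 2 := mul_pos hβ (pow_pos (hε0 j) 2)
      linarith
    have h1 := hY.lintegral_card_reps_le hψ hP hTF2 hTF3 hK hFne
      (fun y hy => hF2 y (Metric.closure_ball_subset_closedBall hy)) hp.le hp1 hsurv (hτs (j + 1)) m
    have hτj : τ (j + 1) + h j = τ j := by
      simp only [hτ, Finset.sum_range_succ]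
      ring
    rw [hτj] at h1
    have h2 := ENNReal.toReal_mono (by have := hetop (j + 1); finiteness) h1
    rw [ENNReal.toReal_add (by have := hetop j; finiteness) (by have := hetop (j + 1); finiteness),
      ENNReal.toReal_add (by have := hetop (j + 1); finiteness) (by finiteness),
      ENNReal.toReal_mul, ENNReal.toReal_mul, ENNReal.toReal_mul, ENNReal.toReal_mul,
      ENNReal.toReal_ofReal hp.le] at h2
    simp only [ENNReal.toReal_ofNat, ENNReal.toReal_natCast] at h2
    have h3 : p * (F.card : ℝ) ≤ 2 * (p * C / ε₀ * θ⁻¹ ^ j) := by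
      have := mul_le_mul_of_nonneg_left hF1 hp.le
      refine this.trans_eq ?_
      simp only [hε]
      rw [inv_pow]
      field_simp
    simp only [ha]
    linarith
  have h0 := le_of_recursion (e := fun j => (e j).toReal) (m := m) (a := a) (θ := θ)
    (b := p * C / ε₀) (by linarith) (by linarith) hθ1 (by positivity)
    (fun k => ENNReal.toReal_le_of_le_ofReal (by positivity) ((hem k).trans_eq (by simp))) hstep
  have hτ0 : τ 0 = t := by simp [hτ]
  rw [← hτ0]
  exact (ENNReal.le_ofReal_iff_toReal_le (hetop 0) ((ENNReal.toReal_nonneg).trans h0)).2 h0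

/-- Almost surely, the trajectories that stay in a star occupy finitely many positions after any
positive time. -/
lemma IsVersionFamily.ae_finite_stays
    (hY : IsVersionFamily μ ψ D (fun i t ω => Y i ω t)) (hψ : IsStochasticFlow P μ ψ)
    (hP : ∀ n, IsFellerTransition (P n)) (hTF2 : TF2 P) (hTF3 : TF3 P) {V : Set M} (hTF5 : TF5 V P)
    {x : M} {R : ℝ} {N : ℕ} {γ : Fin N → ℝ → M} (hγ : IsStar x R γ)
    (hV : Metric.closedBall x R ∩ V ⊆ {x}) {s t : ℝ} (hst : s < t) :
    ∀ᵐ ω ∂μ, {y | ∃ i, (D i).1 ≤ s ∧ Stays Y (closure (Metric.ball x R)) s t i ω ∧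
      Y i ω t = y}.Finite := by
  obtain ⟨B, hB⟩ := hY.exists_lintegral_card_reps_le hψ hP hTF2 hTF3 hTF5 hγ hV hst
  set K := closure (Metric.ball x R) with hKdef
  have hmeas : ∀ m, Measurable fun ω => ((reps D Y K s t m ω).card : ℝ≥0∞) := fun m =>
    measurable_card_reps isClosed_closure hst.le (fun i u _ => hY.measurable i u) m
  have hmono : Monotone fun (m : ℕ) ω => ((reps D Y K s t m ω).card : ℝ≥0∞) := by
    intro m m' hmm ω
    have : reps D Y K s t m ω ⊆ reps D Y K s t m' ω := fun i hi => by
      rw [mem_reps] at hi ⊢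
      exact ⟨hi.1.trans_le hmm, hi.2⟩
    exact Nat.cast_le.2 (Finset.card_le_card this)
  have hsup : ∫⁻ ω, ⨆ m, ((reps D Y K s t m ω).card : ℝ≥0∞) ∂μ ≤ ENNReal.ofReal B := by
    rw [lintegral_iSup hmeas hmono]
    exact iSup_le hB
  filter_upwards [ae_lt_top (Measurable.iSup hmeas) (ne_top_of_le_ne_top (by simp) hsup)] with ω hω
  obtain ⟨b, hb⟩ := ENNReal.exists_nat_gt hω.ne
  refine finite_of_card_reps_le (b := b) fun m => ?_
  have := (le_iSup (fun m => ((reps D Y K s t m ω).card : ℝ≥0∞)) m).trans hb.le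
  exact_mod_cast this

end Finiteness

/-! ### The topology of the path space -/

namespace PathSpace

variable {M : Type*} [MetricSpace M]

lemma ext' {f g : PathSpace M} (h1 : f.start = g.start) (h2 : f.toMap = g.toMap) : f = g := by
  cases f
  cases g
  subst h1
  subst h2
  rfl

/-- The embedding `f ↦ (i(f), e(f))`. -/
def toProd (f : PathSpace M) : ℝ × C(ℝ, M) := (f.start, f.toMap)

/-- Being constant to the left of the starting time is a family of closed conditions on the pair.
Closedness of the range lets compactness be checked in ℝ × C(ℝ, M). -/
lemma isClosedEmbedding_toProd : IsClosedEmbedding (toProd : PathSpace M → ℝ × C(ℝ, M)) := by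
  refine ⟨⟨⟨rfl⟩, fun f g h => ext' (congrArg Prod.fst h) (congrArg Prod.snd h)⟩, ?_⟩
  have e : range (toProd : PathSpace M → _) = ⋂ t : ℝ, {q : ℝ × C(ℝ, M) | q.2 (min t q.1) = q.2 q.1} := by
    ext q
    simp only [mem_range, mem_iInter, mem_ofPred_eq]
    constructor
    · rintro ⟨f, rfl⟩ t
      exact f.const_left _ (min_le_right _ _)
    · intro h
      exact ⟨⟨q.1, q.2, fun t ht => by rw [← h t, min_eq_left ht]⟩, rfl⟩
  rw [e]
  exact isClosed_iInter fun t => isClosed_eq (by fun_prop) (by fun_prop)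

lemma continuous_start : Continuous (start : PathSpace M → ℝ) :=
  continuous_fst.comp isClosedEmbedding_toProd.continuous

lemma continuous_toMap : Continuous (toMap : PathSpace M → C(ℝ, M)) :=
  continuous_snd.comp isClosedEmbedding_toProd.continuous

lemma continuous_eval : Continuous fun q : PathSpace M × ℝ => q.1.toMap q.2 := by
  have := continuous_toMap (M := M)
  fun_prop

lemma continuous_eval_const (t : ℝ) : Continuous fun f : PathSpace M => f.toMap t :=
  continuous_eval.comp (continuous_id.prodMk continuous_const)

lemma continuous_restrict : Continuous fun q : PathSpace M × ℝ => q.1.restrict q.2 := by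
  refine isClosedEmbedding_toProd.isInducing.continuous_iff.2 (continuous_snd.prodMk ?_)
  refine ContinuousMap.continuous_of_continuous_uncurry _ ?_
  change Continuous fun r : (PathSpace M × ℝ) × ℝ => r.1.1.toMap (max r.1.2 r.2)
  exact continuous_eval.comp ((continuous_fst.comp continuous_fst).prodMk
    ((continuous_snd.comp continuous_fst).max continuous_snd))

instance : T2Space (PathSpace M) := isClosedEmbedding_toProd.isEmbedding.t2Space

lemma restrict_toMap (f : PathSpace M) (s t : ℝ) : (f.restrict s).toMap t = f.toMap (max s t) := rfl

/-- A criterion for relative compactness. -/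
lemma isCompact_closure [ProperSpace M] {A : Set (PathSpace M)} {N : ℝ} (hN : ∀ f ∈ A, |f.start| ≤ N)
    (hQ : ∀ t : ℝ, ∃ Q : Set M, IsCompact Q ∧ ∀ f ∈ A, f.toMap t ∈ Q)
    (hequi : ∀ t r : ℝ, 0 < r → ∃ d : ℝ, 0 < d ∧ ∀ u, dist u t < d → ∀ f ∈ A,
      dist (f.toMap u) (f.toMap t) ≤ r) : IsCompact (closure A) := by
  set 𝒢 : Set C(ℝ, M) := toMap '' A with h𝒢
  have h1 : IsCompact (closure 𝒢) := by
    refine ArzelaAscoli.isCompact_closure_of_isClosedEmbedding (F := fun f : C(ℝ, M) => (f : ℝ → M))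
      (𝔖 := {K : Set ℝ | IsCompact K}) (fun K hK => hK) ?_ ?_ ?_
    · have : T2Space (UniformOnFun ℝ M {K | IsCompact K}) := UniformOnFun.t2Space_of_covering
        (eq_univ_of_forall fun x => mem_sUnion_of_mem (mem_singleton x) isCompact_singleton)
      exact ContinuousMap.isUniformEmbedding_toUniformOnFunIsCompact.isClosedEmbedding
    · intro K _
      refine Equicontinuous.equicontinuousOn (fun t => ?_) K
      rw [Metric.equicontinuousAt_iff]
      intro ε hε
      obtain ⟨d, hd, H⟩ := hequi t (ε / 2) (half_pos hε)
      refine ⟨d, hd, ?_⟩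
      rintro u hu ⟨_, f, hf, rfl⟩
      rw [dist_comm]
      exact (H u hu f hf).trans_lt (half_lt_self hε)
    · intro K _ t _
      obtain ⟨Q, hQc, hQA⟩ := hQ t
      refine ⟨Q, hQc, ?_⟩
      rintro _ ⟨f, hf, rfl⟩
      exact hQA f hf
  have h2 : IsCompact (toProd ⁻¹' (Icc (-N) N ×ˢ closure 𝒢)) :=
    isClosedEmbedding_toProd.isCompact_preimage (isCompact_Icc.prod h1)
  refine h2.closure_of_subset fun f hf => ⟨abs_le.1 (hN f hf), subset_closure ⟨f, hf, rfl⟩⟩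

end PathSpace

lemma mem_of_mapClusterPt {X : Type*} [TopologicalSpace X] {u : ℕ → X} {x : X}
    (h : MapClusterPt x atTop u) {S : Set X} (hS : IsClosed S) (hu : ∀ᶠ k in atTop, u k ∈ S) : x ∈ S := by
  by_contra hx
  obtain ⟨k, hk1, hk2⟩ := ((h.frequently (hS.isOpen_compl.mem_nhds hx)).and_eventually hu).exists
  exact hk1 hk2

/-! ### Regular sequences of paths -/

section Tame

variable {M : Type*} [MetricSpace M]

/-- The properties of the random sequence of paths that hold almost surely. -/
structure IsTame (o : M) (φ : ℕ → PathSpace M) : Prop where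
  coalescence : ∀ i j s, (φ i).start ≤ s → (φ j).start ≤ s → (φ i).toMap s = (φ j).toMap s →
    ∀ t, s ≤ t → (φ i).toMap t = (φ j).toMap t
  equicontinuous : ∀ (N : ℕ) (r : ℝ), 0 < r → ∃ h : ℝ, 0 < h ∧ ∀ i s, (φ i).start ≤ s → |s| ≤ N →
    dist ((φ i).toMap s) o ≤ N → ∀ u ∈ Icc s (s + h), dist ((φ i).toMap u) ((φ i).toMap s) ≤ r
  dense : DenseRange (fun n => ((φ n).start, (φ n).toMap (φ n).start))
  finite : ∀ x : M, ∃ K ∈ 𝓝 x, ∀ s t : ℚ, s < t → {y | ∃ i, (φ i).start ≤ s ∧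
    (∀ u ∈ Icc (s : ℝ) t, (φ i).toMap u ∈ K) ∧ (φ i).toMap t = y}.Finite

variable {o : M} {φ : ℕ → PathSpace M}

lemma exists_finset_of_finite {S : Set ℕ} {t : ℝ} (h : {y | ∃ i ∈ S, (φ i).toMap t = y}.Finite) :
    ∃ F : Finset ℕ, (∀ m ∈ F, m ∈ S) ∧ ∀ n ∈ S, ∃ m ∈ F, (φ n).toMap t = (φ m).toMap t := by
  classical
  have h' : ((fun i => (φ i).toMap t) '' S).Finite := h
  obtain ⟨F, hF1, hF2⟩ := Finset.subset_set_image_iff (s := S) (t := h'.toFinset)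
    (f := fun i => (φ i).toMap t).1 (by simp)
  refine ⟨F, hF1, fun n hn => ?_⟩
  have : (φ n).toMap t ∈ Finset.image (fun i => (φ i).toMap t) F := by
    rw [hF2]
    simp only [Finite.mem_toFinset]
    exact ⟨n, hn, rfl⟩
  obtain ⟨m, hm, e⟩ := Finset.mem_image.1 this
  exact ⟨m, hm, e.symm⟩

lemma exists_nat_bound (o : M) {L : Set M} (hL : Bornology.IsBounded L) (a : ℝ) :
    ∃ N : ℕ, a ≤ N ∧ ∀ y ∈ L, dist y o ≤ N := by
  obtain ⟨r, hr⟩ := hL.subset_closedBall o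
  obtain ⟨N, hN⟩ := exists_nat_ge (max r a)
  exact ⟨N, (le_max_right _ _).trans hN, fun y hy => (hr hy).trans ((le_max_left _ _).trans hN)⟩

namespace IsTame

/-- The trajectories that are in a compact set at a given time follow finitely many trajectories
after any positive time. -/
lemma exists_finset (hφ : IsTame o φ) {s t : ℝ} (hst : s < t) {L : Set M} (hL : IsCompact L) :
    ∃ F : Finset ℕ, (∀ m ∈ F, (φ m).start ≤ s) ∧ ∀ n, (φ n).start ≤ s → (φ n).toMap s ∈ L →
      ∃ m ∈ F, ∀ u, t ≤ u → (φ n).toMap u = (φ m).toMap u := by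
  classical
  have hloc : ∀ x : M, ∃ r : ℝ, 0 < r ∧ ∃ F : Finset ℕ, (∀ m ∈ F, (φ m).start ≤ s) ∧
      ∀ n, (φ n).start ≤ s → (φ n).toMap s ∈ Metric.ball x r →
      ∃ m ∈ F, ∀ u, t ≤ u → (φ n).toMap u = (φ m).toMap u := by
    intro x
    obtain ⟨K, hK, hfin⟩ := hφ.finite x
    obtain ⟨ρ, hρ, hball⟩ := Metric.mem_nhds_iff.1 hK
    obtain ⟨N, hN1, hN2⟩ := exists_nat_bound o (Metric.isBounded_ball (x := x) (r := ρ / 2)) |s|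
    obtain ⟨h, hh, H⟩ := hφ.equicontinuous N (ρ / 4) (by positivity)
    -- The finiteness property is available only at rational times. By equicontinuity a path that
    -- starts in the half ball is still in K at two rational times shortly after s, and coalescence
    -- carries the conclusion from the second of them on to t.
    obtain ⟨q, hq1, hq2⟩ := exists_rat_btwn (show s < min t (s + h) from lt_min hst (by linarith))
    obtain ⟨q', hq1', hq2'⟩ := exists_rat_btwn hq2
    have hS : {y | ∃ i ∈ {i | (φ i).start ≤ s ∧ (φ i).toMap s ∈ Metric.ball x (ρ / 2)},
        (φ i).toMap q' = y}.Finite := by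
      refine (hfin q q' (by exact_mod_cast hq1')).subset ?_
      rintro y ⟨i, ⟨hi1, hi2⟩, rfl⟩
      refine ⟨i, hi1.trans hq1.le, fun u hu => hball ?_, rfl⟩
      have h1 := H i s hi1 hN1 (hN2 _ hi2) u ⟨hq1.le.trans hu.1,
        hu.2.trans (hq2'.le.trans (min_le_right _ _))⟩
      have h2 := dist_triangle ((φ i).toMap u) ((φ i).toMap s) x
      rw [Metric.mem_ball] at hi2 ⊢
      linarith
    obtain ⟨F, hF1, hF2⟩ := exists_finset_of_finite hS
    refine ⟨ρ / 2, half_pos hρ, F, fun m hm => (hF1 m hm).1, fun n hn1 hn2 => ?_⟩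
    obtain ⟨m, hm, e⟩ := hF2 n ⟨hn1, hn2⟩
    have hs' : s ≤ q' := (hq1.trans hq1').le
    exact ⟨m, hm, fun u hu => hφ.coalescence n m q' (hn1.trans hs') ((hF1 m hm).1.trans hs') e u
      ((hq2'.le.trans (min_le_left _ _)).trans hu)⟩
  choose r hr F hF1 hF2 using hloc
  obtain ⟨T, -, hT⟩ := hL.elim_nhds_subcover (fun x => Metric.ball x (r x))
    fun x _ => Metric.ball_mem_nhds x (hr x)
  refine ⟨T.biUnion F, fun m hm => ?_, fun n hn1 hn2 => ?_⟩
  · obtain ⟨x, -, hx⟩ := Finset.mem_biUnion.1 hm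
    exact hF1 x m hx
  · obtain ⟨x, hx, hxn⟩ := mem_iUnion₂.1 (hT hn2)
    obtain ⟨m, hm, h⟩ := hF2 x n hn1 hxn
    exact ⟨m, Finset.mem_biUnion.2 ⟨x, hx, hm⟩, h⟩

/-- At every time the trajectories are dense. -/
lemma exists_near (hφ : IsTame o φ) (s : ℝ) (x : M) {r : ℝ} (hr : 0 < r) :
    ∃ n, (φ n).start ≤ s ∧ dist ((φ n).toMap s) x < r := by
  obtain ⟨N, hN1, hN2⟩ := exists_nat_bound o (Metric.isBounded_ball (x := x) (r := r / 2)) (|s| + 1)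
  obtain ⟨h, hh, H⟩ := hφ.equicontinuous N (r / 2) (half_pos hr)
  obtain ⟨n, hn1, hn2⟩ := hφ.dense.exists_mem_open (isOpen_Ioo.prod Metric.isOpen_ball)
    (s := Ioo (s - min h 1) s ×ˢ Metric.ball x (r / 2))
    ⟨(s - min h 1 / 2, x), ⟨by
      have : 0 < min h 1 := lt_min hh one_pos
      constructor <;> dsimp only <;> linarith, Metric.mem_ball_self (half_pos hr)⟩⟩
  simp only [mem_Ioo] at hn1
  have hm1 := min_le_left h 1
  have hm2 := min_le_right h 1
  refine ⟨n, hn1.2.le, ?_⟩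
  have h1 := H n (φ n).start le_rfl (by
    have h2 := abs_sub_abs_le_abs_sub (φ n).start s
    have h3 : |(φ n).start - s| ≤ 1 := abs_le.2 ⟨by linarith, by linarith⟩
    linarith) (hN2 _ hn2) s ⟨hn1.2.le, by linarith⟩
  have h2 := dist_triangle ((φ n).toMap s) ((φ n).toMap (φ n).start) x
  have h3 : dist ((φ n).toMap (φ n).start) x < r / 2 := hn2
  linarith

/-- The trajectories that pass through a compact set follow finitely many trajectories after any
positive time. -/
lemma exists_finset_uniform (hφ : IsTame o φ) [ProperSpace M] (N : ℕ) {h : ℝ} (hh : 0 < h) :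
    ∃ F : Finset ℕ, ∀ n s, (φ n).start ≤ s → |s| ≤ N → dist ((φ n).toMap s) o ≤ N →
      ∃ m ∈ F, ∀ u, s + h ≤ u → (φ n).toMap u = (φ m).toMap u := by
  classical
  obtain ⟨h₁, hh₁, H⟩ := hφ.equicontinuous N 1 one_pos
  -- If s lies in the j-th cell, the path is still within N + 1 of o at time (j + 1)d, and it
  -- follows one of the paths in `F j` from (j + 2)d ≤ s + h on. Only finitely many cells meet [-N,
  -- N].
  set d : ℝ := min h h₁ / 2 with hd
  have hd0 : 0 < d := half_pos (lt_min hh hh₁)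
  have hd1 : 2 * d ≤ h := by linarith [min_le_left h h₁]
  have hd2 : 2 * d ≤ h₁ := by linarith [min_le_right h h₁]
  choose F hF1 hF2 using fun j : ℤ => hφ.exists_finset (s := (j + 1) * d) (t := (j + 2) * d)
    (by linarith) (isCompact_closedBall o (N + 1))
  refine ⟨(Finset.Icc (⌊-N / d⌋) (⌊N / d⌋)).biUnion F, fun n s h1 h2 h3 => ?_⟩
  have h2' := abs_le.1 h2
  set j := ⌊s / d⌋ with hj
  have hj1 : (j : ℝ) * d ≤ s := by
    rw [← le_div_iff₀ hd0]
    exact Int.floor_le _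
  have hj2 : s < (j + 1) * d := by
    rw [← div_lt_iff₀ hd0]
    exact Int.lt_floor_add_one _
  have hmem : j ∈ Finset.Icc (⌊-N / d⌋) (⌊N / d⌋) := by
    rw [Finset.mem_Icc]
    exact ⟨Int.floor_mono (by gcongr; exact h2'.1), Int.floor_mono (by gcongr; exact h2'.2)⟩
  obtain ⟨m, hm, e⟩ := hF2 j n (h1.trans hj2.le) (by
    have h4 := H n s h1 h2 h3 ((j + 1) * d) ⟨hj2.le, by linarith⟩
    rw [Metric.mem_closedBall]
    linarith [dist_triangle ((φ n).toMap ((j + 1) * d)) ((φ n).toMap s) o])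
  exact ⟨m, Finset.mem_biUnion.2 ⟨j, hmem, hm⟩, fun u hu => e u (by linarith)⟩

/-- Shortly after its start a restricted path is controlled by equicontinuity, later it is one of
finitely many continuous paths. The two regimes overlap on [s + h/2, s + h], so nearby times always
fall under a common one. -/
lemma isSkeleton (hφ : IsTame o φ) [ProperSpace M] : IsSkeleton φ where
  coalescence s m n := hφ.coalescence m n s
  dense := hφ.dense
  relatively_compact L hL := by
    obtain ⟨N, hN1, hN2⟩ := exists_nat_bound (0, o) hL.isBounded 0
    set A : Set (PathSpace M) := {f : PathSpace M | ∃ (n : ℕ) (s : ℝ),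
      (φ n).start ≤ s ∧ (s, (φ n).toMap s) ∈ L ∧ f = (φ n).restrict s} with hA
    have hAN : ∀ n s, (s, (φ n).toMap s) ∈ L → |s| ≤ N ∧ dist ((φ n).toMap s) o ≤ N := by
      intro n s h
      have := hN2 _ h
      rw [Prod.dist_eq, max_le_iff, Real.dist_eq, sub_zero] at this
      exact this
    refine PathSpace.isCompact_closure (N := N) ?_ ?_ ?_
    · rintro f ⟨n, s, -, h2, rfl⟩
      exact (hAN n s h2).1
    · intro t
      obtain ⟨h, hh, H⟩ := hφ.equicontinuous N 1 one_pos
      obtain ⟨F, hF⟩ := hφ.exists_finset_uniform N hh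
      refine ⟨Metric.closedBall o (N + 1) ∪ (fun m => (φ m).toMap t) '' F,
        (isCompact_closedBall _ _).union (F.finite_toSet.image _).isCompact, ?_⟩
      rintro f ⟨n, s, h1, h2, rfl⟩
      obtain ⟨h3, h4⟩ := hAN n s h2
      rw [PathSpace.restrict_toMap]
      rcases le_total t (s + h) with ht | ht
      · left
        have h5 := H n s h1 h3 h4 (max s t) ⟨le_max_left _ _, max_le (by linarith) ht⟩
        rw [Metric.mem_closedBall]
        linarith [dist_triangle ((φ n).toMap (max s t)) ((φ n).toMap s) o]
      · right
        rw [max_eq_right (by linarith)]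
        obtain ⟨m, hm, e⟩ := hF n s h1 h3 h4
        exact ⟨m, hm, (e t ht).symm⟩
    · intro t r hr
      obtain ⟨h, hh, H⟩ := hφ.equicontinuous N (r / 2) (half_pos hr)
      obtain ⟨F, hF⟩ := hφ.exists_finset_uniform N (half_pos hh)
      have hev : ∀ᶠ u in 𝓝 t, dist u t < h / 2 ∧ ∀ m ∈ F, dist ((φ m).toMap u) ((φ m).toMap t) < r := by
        refine Filter.Eventually.and (Metric.ball_mem_nhds t (half_pos hh)) ((Filter.eventually_all_finset F).2 fun m _ => ?_)
        exact Metric.tendsto_nhds.1 ((φ m).toMap.continuous.tendsto t) r hr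
      obtain ⟨d, hd, hdu⟩ := Metric.eventually_nhds_iff.1 hev
      refine ⟨d, hd, fun u hu => ?_⟩
      obtain ⟨h5, h6⟩ := hdu hu
      rw [Real.dist_eq, abs_lt] at h5
      rintro f ⟨n, s, h1, h2, rfl⟩
      obtain ⟨h3, h4⟩ := hAN n s h2
      simp only [PathSpace.restrict_toMap]
      by_cases hcase : u ≤ s + h ∧ t ≤ s + h
      · have h7 := H n s h1 h3 h4 (max s u) ⟨le_max_left _ _, max_le (by linarith) hcase.1⟩
        have h8 := H n s h1 h3 h4 (max s t) ⟨le_max_left _ _, max_le (by linarith) hcase.2⟩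
        linarith [dist_triangle_right ((φ n).toMap (max s u)) ((φ n).toMap (max s t)) ((φ n).toMap s)]
      · have h9 : s + h / 2 ≤ u ∧ s + h / 2 ≤ t := by
          rw [not_and_or, not_le, not_le] at hcase
          rcases hcase with h' | h' <;> constructor <;> linarith
        obtain ⟨m, hm, e⟩ := hF n s h1 h3 h4
        rw [max_eq_right (by linarith), max_eq_right (by linarith), e u h9.1, e t h9.2]
        exact (h6 m hm).le

/-! ### The family `Θ` along a regular sequence -/

variable {ε : ℕ → M → ℝ≥0∞} {ℓ : (ℕ → PathSpace M) → PathSpace M}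

/-- By density at time s the set of admissible indices is non-empty, so its infimum is attained
rather than a default 0. -/
lemma approxIndex_spec (hφ : IsTame o φ) (hε : ∀ k x, 0 < ε k x) (s : ℝ) (x : M) (k : ℕ) :
    (φ (approxIndex ε φ s x k)).start ≤ s ∧ edist ((φ (approxIndex ε φ s x k)).toMap s) x < ε k x := by
  refine Nat.sInf_mem (s := {n | (φ n).start ≤ s ∧ edist ((φ n).toMap s) x < ε k x}) ?_
  obtain ⟨r, hr0, hr⟩ := ENNReal.lt_iff_exists_nnreal_btwn.1 (hε k x)
  obtain ⟨n, h1, h2⟩ := hφ.exists_near s x (r := r) (by exact_mod_cast hr0)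
  refine ⟨n, h1, lt_trans ?_ hr⟩
  rw [edist_lt_coe, ← NNReal.coe_lt_coe, coe_nndist]
  exact h2

lemma tendsto_approx (hφ : IsTame o φ) (hε : ∀ k x, 0 < ε k x) (hε2 : ∀ k x, ε k x ≤ 2⁻¹ ^ k) (s : ℝ)
    (x : M) : Tendsto (fun k => (φ (approxIndex ε φ s x k)).toMap s) atTop (𝓝 x) := by
  rw [tendsto_iff_edist_tendsto_0]
  exact tendsto_of_tendsto_of_tendsto_of_le_of_le tendsto_const_nhds
    (ENNReal.tendsto_pow_atTop_nhds_zero_of_lt_one (by simp)) (fun _ => zero_le)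
    fun k => (hφ.approxIndex_spec hε s x k).2.le.trans (hε2 k x)

lemma mapClusterPt_Theta (hφ : IsTame o φ) [ProperSpace M] (hε : ∀ k x, 0 < ε k x)
    (hε2 : ∀ k x, ε k x ≤ 2⁻¹ ^ k) (hℓ : IsLimitPointSelection ℓ) (s : ℝ) (x : M) :
    MapClusterPt (Theta ℓ ε s x φ) atTop fun k => (φ (approxIndex ε φ s x k)).restrict s := by
  refine hℓ.2 _ ?_
  refine (hφ.isSkeleton.relatively_compact ({s} ×ˢ Metric.closedBall x 1)
    (isCompact_singleton.prod (isCompact_closedBall x 1))).of_isClosed_subset isClosed_closure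
    (closure_mono ?_)
  rintro _ ⟨k, rfl⟩
  obtain ⟨h1, h2⟩ := hφ.approxIndex_spec hε s x k
  refine ⟨_, s, h1, ⟨rfl, ?_⟩, rfl⟩
  have h3 : edist ((φ (approxIndex ε φ s x k)).toMap s) x ≤ 1 :=
    h2.le.trans ((hε2 k x).trans (pow_le_one₀ zero_le (by simp)))
  rw [edist_dist, ← ENNReal.ofReal_one, ENNReal.ofReal_le_ofReal_iff zero_le_one] at h3
  exact h3

/-- If the approximating paths converge at time `t`, then `Θ` takes the limit as its value. -/
lemma Theta_eq_of_tendsto (hφ : IsTame o φ) [ProperSpace M] (hε : ∀ k x, 0 < ε k x)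
    (hε2 : ∀ k x, ε k x ≤ 2⁻¹ ^ k) (hℓ : IsLimitPointSelection ℓ) {s : ℝ} {x : M} {t : ℝ} (hst : s ≤ t)
    {y : M} (hy : Tendsto (fun k => (φ (approxIndex ε φ s x k)).toMap t) atTop (𝓝 y)) :
    (Theta ℓ ε s x φ).toMap t = y := by
  refine eq_of_forall_dist_le fun r hr => ?_
  refine mem_of_mapClusterPt (S := {f | dist (f.toMap t) y ≤ r})
    (hφ.mapClusterPt_Theta hε hε2 hℓ s x)
    (isClosed_le ((PathSpace.continuous_eval_const t).dist continuous_const) continuous_const) ?_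
  filter_upwards [Metric.tendsto_nhds.1 hy r hr] with k hk
  change dist ((φ (approxIndex ε φ s x k)).toMap (max s t)) y ≤ r
  rw [max_eq_right hst]
  exact hk.le

lemma Theta_self (hφ : IsTame o φ) [ProperSpace M] (hε : ∀ k x, 0 < ε k x)
    (hε2 : ∀ k x, ε k x ≤ 2⁻¹ ^ k) (hℓ : IsLimitPointSelection ℓ) (s : ℝ) (x : M) :
    (Theta ℓ ε s x φ).toMap s = x :=
  hφ.Theta_eq_of_tendsto hε hε2 hℓ le_rfl (hφ.tendsto_approx hε hε2 s x)

/-- From t on, the approximating paths eventually agree with members of a fixed finite set of paths.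
This condition is closed in the path space, so it passes to the limit point, whichever one ℓ
selects. -/
lemma exists_Theta_eq (hφ : IsTame o φ) [ProperSpace M] (hε : ∀ k x, 0 < ε k x)
    (hε2 : ∀ k x, ε k x ≤ 2⁻¹ ^ k) (hℓ : IsLimitPointSelection ℓ) {s t : ℝ} (hst : s < t) (x : M) :
    ∃ m, (φ m).start ≤ s ∧ ∀ u, t ≤ u → (Theta ℓ ε s x φ).toMap u = (φ m).toMap u := by
  obtain ⟨F, hF1, hF2⟩ := hφ.exists_finset hst (isCompact_closedBall x 1)
  have hcl : IsClosed (⋃ m ∈ F, ⋂ u ∈ Ici t, {f : PathSpace M | f.toMap u = (φ m).toMap u}) :=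
    F.finite_toSet.isClosed_biUnion fun m _ => isClosed_biInter fun u _ =>
      isClosed_eq (PathSpace.continuous_eval_const u) continuous_const
  have hmem := mem_of_mapClusterPt (hφ.mapClusterPt_Theta hε hε2 hℓ s x) hcl ?_
  · simp only [mem_iUnion, mem_iInter] at hmem
    obtain ⟨m, hm, h⟩ := hmem
    exact ⟨m, hF1 m hm, fun u hu => h u hu⟩
  · have hnear := Metric.tendsto_nhds.1 (hφ.tendsto_approx hε hε2 s x) 1 one_pos
    filter_upwards [hnear] with k hk
    obtain ⟨m, hm, e⟩ := hF2 _ (hφ.approxIndex_spec hε s x k).1 hk.le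
    simp only [mem_iUnion, mem_iInter]
    refine ⟨m, hm, fun u (hu : t ≤ u) => ?_⟩
    change (φ (approxIndex ε φ s x k)).toMap (max s u) = _
    rw [max_eq_right (hst.le.trans hu)]
    exact e u hu

/-- As `φ m` is itself at the point y, the indices are at most m and only finitely many paths can be
chosen. Those that are not at y at time t are eventually excluded, and those at y coalesce with `φ
m`. -/
lemma Theta_apply (hφ : IsTame o φ) [ProperSpace M] (hε : ∀ k x, 0 < ε k x)
    (hε2 : ∀ k x, ε k x ≤ 2⁻¹ ^ k) (hℓ : IsLimitPointSelection ℓ) {m : ℕ} {t u : ℝ}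
    (hm : (φ m).start ≤ t) (htu : t ≤ u) :
    (Theta ℓ ε t ((φ m).toMap t) φ).toMap u = (φ m).toMap u := by
  refine hφ.Theta_eq_of_tendsto hε hε2 hℓ htu (tendsto_const_nhds.congr' ?_)
  set y := (φ m).toMap t with hy
  have hle : ∀ k, approxIndex ε φ t y k ≤ m := fun k =>
    Nat.sInf_le ⟨hm, by rw [← hy, edist_self]; exact hε k y⟩
  have hev : ∀ᶠ k in atTop, ∀ n ∈ Finset.range (m + 1), (φ n).toMap t ≠ y →
      (φ (approxIndex ε φ t y k)).toMap t ≠ (φ n).toMap t := by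
    rw [Filter.eventually_all_finset]
    intro n _
    by_cases hn : (φ n).toMap t = y
    · exact Eventually.of_forall fun k h => absurd hn h
    · filter_upwards [(hφ.tendsto_approx hε hε2 t y).eventually_ne (Ne.symm hn)] with k hk _
      exact hk
  filter_upwards [hev] with k hk
  have h1 : (φ (approxIndex ε φ t y k)).toMap t = y := by
    by_contra hne
    exact hk _ (Finset.mem_range.2 (by have := hle k; omega)) hne rfl
  exact (hφ.coalescence _ m t (hφ.approxIndex_spec hε t y k).1 hm h1 u htu).symm

lemma Theta_flow (hφ : IsTame o φ) [ProperSpace M] (hε : ∀ k x, 0 < ε k x)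
    (hε2 : ∀ k x, ε k x ≤ 2⁻¹ ^ k) (hℓ : IsLimitPointSelection ℓ) {s t u : ℝ} (hst : s ≤ t)
    (htu : t ≤ u) (x : M) :
    (Theta ℓ ε s x φ).toMap u = (Theta ℓ ε t ((Theta ℓ ε s x φ).toMap t) φ).toMap u := by
  rcases hst.eq_or_lt with rfl | hlt
  · rw [hφ.Theta_self hε hε2 hℓ]
  · obtain ⟨m, hm, h⟩ := hφ.exists_Theta_eq hε hε2 hℓ hlt x
    rw [h t le_rfl, h u htu, hφ.Theta_apply hε hε2 hℓ (hm.trans hst) htu]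

end IsTame

end Tame

/-! ### Measurability of `Θ` -/

section Measurability

variable {M : Type*} [MetricSpace M] [ProperSpace M] [MeasurableSpace M] [BorelSpace M]
  {Z : Type*} [MeasurableSpace Z]

lemma measurable_sInf_nat {S : Z → Set ℕ} (hS : ∀ n, MeasurableSet {z | n ∈ S z}) :
    Measurable fun z => sInf (S z) := by
  refine measurable_to_countable' fun n => ?_
  -- The second set accounts for the convention that the infimum of the empty set of natural numbers
  -- is 0.
  have e : (fun z => sInf (S z)) ⁻¹' {n} = ({z | n ∈ S z} ∩ ⋂ m ∈ {m | m < n}, {z | m ∈ S z}ᶜ) ∪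
      ({_z | n = 0} ∩ ⋂ m, {z | m ∈ S z}ᶜ) := by
    ext z
    simp only [mem_preimage, mem_singleton_iff, mem_union, mem_inter_iff, mem_iInter, mem_compl_iff,
      mem_ofPred_eq]
    constructor
    · rintro rfl
      rcases (S z).eq_empty_or_nonempty with h | h
      · right
        rw [h]
        simp
      · left
        exact ⟨Nat.sInf_mem h, fun m hm => Nat.notMem_of_lt_sInf hm⟩
    · rintro (⟨h1, h2⟩ | ⟨rfl, h⟩)
      · refine le_antisymm (Nat.sInf_le h1) ?_
        by_contra! hlt
        exact h2 _ hlt (Nat.sInf_mem ⟨n, h1⟩)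
      · rw [eq_empty_of_forall_notMem h, Nat.sInf_empty]
  rw [e]
  refine ((hS n).inter (MeasurableSet.biInter (to_countable _) fun m _ => (hS m).compl)).union
    ((MeasurableSet.const _).inter (MeasurableSet.iInter fun m => (hS m).compl))

lemma measurable_Theta {ε : ℕ → M → ℝ≥0∞} (hε : ∀ k, Measurable (ε k))
    {ℓ : (ℕ → PathSpace M) → PathSpace M} (hℓ : Measurable ℓ) {s t : Z → ℝ} {x : Z → M}
    {φ : Z → ℕ → PathSpace M} (hs : Measurable s) (ht : Measurable t) (hx : Measurable x)
    (hφ : Measurable φ) : Measurable fun z => (Theta ℓ ε (s z) (x z) (φ z)).toMap (t z) := by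
  have hφn : ∀ n, Measurable fun z => φ z n := fun n => (measurable_pi_apply n).comp hφ
  have heval : Measurable fun q : PathSpace M × ℝ => q.1.toMap q.2 := PathSpace.continuous_eval.measurable
  have hidx : ∀ k, Measurable fun z => approxIndex ε (φ z) (s z) (x z) k := by
    intro k
    refine measurable_sInf_nat fun n => ?_
    refine (measurableSet_le (PathSpace.continuous_start.measurable.comp (hφn n)) hs).inter ?_
    exact measurableSet_lt ((heval.comp ((hφn n).prodMk hs)).edist hx) ((hε k).comp hx)
  have hpath : ∀ k, Measurable fun z => φ z (approxIndex ε (φ z) (s z) (x z) k) := by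
    intro k
    have h : Measurable fun q : ℕ × Z => φ q.2 q.1 := measurable_from_prod_countable_right fun n => hφn n
    exact h.comp ((hidx k).prodMk measurable_id)
  have hTheta : Measurable fun z => Theta ℓ ε (s z) (x z) (φ z) :=
    hℓ.comp (measurable_pi_lambda _ fun k =>
      PathSpace.continuous_restrict.measurable.comp ((hpath k).prodMk hs))
  exact heval.comp (hTheta.prodMk ht)

end Measurability

/-! ### The random sequence of paths -/

section Sequence

variable {M : Type*} [MetricSpace M] [ProperSpace M] [MeasurableSpace M] [BorelSpace M]
  {P : (n : ℕ) → ℝ≥0 → Kernel (Fin n → M) (Fin n → M)}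
  {Ω : Type*} [mΩ : MeasurableSpace Ω] {μ : Measure Ω} [IsProbabilityMeasure μ]
  {ψ : ℝ → ℝ → Ω → MeasMap M} {D : ℕ → ℝ × M} {Φ : Ω → ℕ → PathSpace M}

lemma IsContinuousSequence.isVersionFamily (hΦ : IsContinuousSequence μ ψ D Φ) :
    IsVersionFamily μ ψ D (fun i t ω => (Φ ω i).toMap t) where
  measurable i t := (PathSpace.continuous_eval_const t).measurable.comp
    ((measurable_pi_apply i).comp hΦ.measurable)
  before i t ω ht := by
    rw [← hΦ.start_eq ω i] at ht
    rw [(Φ ω i).const_left t ht, hΦ.start_eq, hΦ.initial]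
  modification := hΦ.modification

/-- By the Lindelöf property countably many stars cover M. Together with the restriction to rational
times this leaves countably many null sets in the finiteness condition. -/
lemma IsContinuousSequence.ae_isTame (hΦ : IsContinuousSequence μ ψ D Φ)
    (hψ : IsStochasticFlow P μ ψ) (hP : ∀ n, IsFellerTransition (P n)) (hTF2 : TF2 P) (hTF3 : TF3 P)
    {V : Set M} {𝓔 : Set (Set M)} (hM : IsMetricGraph V 𝓔) (hTF5 : TF5 V P) (hD : DenseRange D) (o : M) :
    ∀ᵐ ω ∂μ, IsTame o (Φ ω) := by
  have hY := hΦ.isVersionFamily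
  choose R N γ hγ hV using fun x : M => hM.exists_star x
  obtain ⟨S, hSc, hS⟩ := TopologicalSpace.countable_cover_nhds (f := fun x : M => Metric.ball x (R x))
    fun x => Metric.ball_mem_nhds x (hγ x).pos
  have hfin : ∀ᵐ ω ∂μ, ∀ x ∈ S, ∀ s t : ℚ, s < t → {y | ∃ i, (D i).1 ≤ s ∧
      Stays (fun i ω => (Φ ω i).toMap) (closure (Metric.ball x (R x))) s t i ω ∧
      (Φ ω i).toMap t = y}.Finite := by
    rw [ae_ball_iff hSc]
    intro x _
    rw [ae_all_iff]
    intro s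
    rw [ae_all_iff]
    intro t
    rw [eventually_all]
    intro hst
    exact hY.ae_finite_stays (Y := fun i ω => (Φ ω i).toMap) hψ hP hTF2 hTF3 hTF5 (hγ x) (hV x)
      (by exact_mod_cast hst)
  filter_upwards [hY.ae_coalescence (Y := fun i ω => (Φ ω i).toMap) hψ hP hTF2,
    hY.ae_locally_equicontinuous (Y := fun i ω => (Φ ω i).toMap) hψ hP hTF2 hTF3 hM hD o, hfin]
    with ω h1 h2 h3
  refine ⟨?_, ?_, ?_, fun x => ?_⟩
  · simpa only [hΦ.start_eq] using h1
  · simpa only [hΦ.start_eq] using h2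
  · have : (fun n => ((Φ ω n).start, (Φ ω n).toMap (Φ ω n).start)) = D := by
      funext n
      rw [hΦ.start_eq, hΦ.initial]
    rw [this]
    exact hD
  · obtain ⟨y, hy, hxy⟩ := mem_iUnion₂.1 (hS.symm ▸ mem_univ x : x ∈ ⋃ x ∈ S, Metric.ball x (R x))
    refine ⟨_, mem_of_superset (Metric.isOpen_ball.mem_nhds hxy) subset_closure, ?_⟩
    simp only [hΦ.start_eq]
    exact h3 y hy

omit [MetricSpace M] [ProperSpace M] [MeasurableSpace M] [BorelSpace M] in
lemma IsCompactOpenDist.nonneg [TopologicalSpace M] {δ : C(ℝ, M) → C(ℝ, M) → ℝ}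
    (hδ : IsCompactOpenDist δ) (f g : C(ℝ, M)) : 0 ≤ δ f g := by
  obtain ⟨m, hm, -⟩ := hδ
  rw [← hm]
  exact @dist_nonneg _ m.toPseudoMetricSpace f g

/-- `Θ` yields a modification of the flow. -/
lemma IsContinuousSequence.ae_Theta_eq (hΦ : IsContinuousSequence μ ψ D Φ)
    (hψ : IsStochasticFlow P μ ψ) (hP : ∀ n, IsFellerTransition (P n)) (hTF2 : TF2 P) (hTF3 : TF3 P)
    {o : M} (htame : ∀ᵐ ω ∂μ, IsTame o (Φ ω)) {δ : C(ℝ, M) → C(ℝ, M) → ℝ} (hδ : IsCompactOpenDist δ)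
    {ℓ : (ℕ → PathSpace M) → PathSpace M} (hℓ : IsLimitPointSelection ℓ) {s t : ℝ} (hst : s ≤ t) (x : M) :
    ∀ᵐ ω ∂μ, (Theta ℓ (epsilonSeq δ P) s x (Φ ω)).toMap t = (ψ s t ω).1 x := by
  have hε : ∀ k x, 0 < epsilonSeq δ P k x := fun k x => hψ.epsilonSeq_pos hP hTF2 hTF3 hδ k x
  have hε2 : ∀ k x, epsilonSeq δ P k x ≤ 2⁻¹ ^ k := fun k x => min_le_left _ _
  obtain ⟨X, hX1, hX2, hX3⟩ := hψ.exists_continuous_version hP hTF3 s x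
  have hY := hΦ.isVersionFamily
  -- The trajectory of x itself joins the family under the index `none`, so that it forms two-point
  -- motions with the paths of `Φ`.
  set D' : Option ℕ → ℝ × M := fun i => i.elim (s, x) D with hD'
  set Y : Option ℕ → Ω → C(ℝ, M) := fun i ω => i.elim (X ω) fun n => (Φ ω n).toMap with hYdef
  have hY' : IsVersionFamily μ ψ D' (fun i t ω => Y i ω t) := by
    refine ⟨fun i t => ?_, fun i t ω ht => ?_, fun i t ht => ?_⟩ <;> cases i
    · exact hX1 t
    · exact hY.measurable _ t
    · exact hX2 ω t ht
    · exact hY.before _ t ω ht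
    · exact hX3 t ht
    · exact hY.modification _ t ht
  set E : ℕ → ℕ → Set Ω := fun k n =>
    {ω | (D n).1 ≤ s ∧ edist ((Φ ω n).toMap s) x < epsilonSeq δ P k x} with hE
  -- The event that the k-th approximating index is n. It is known at time s, and these events are
  -- disjoint in n.
  set A : ℕ → ℕ → Set Ω := fun k n => E k n ∩ ⋂ m ∈ {m | m < n}, (E k m)ᶜ with hA
  have hEpast : ∀ k n, MeasurableSet[pastSigma (fun i t ω => Y i ω t) s] (E k n) := by
    intro k n
    have h1 : Measurable[pastSigma (fun i t ω => Y i ω t) s] fun ω => Y (some n) ω s :=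
      measurable_pastSigma (fun i t ω => Y i ω t) (some n) le_rfl
    have h2 : MeasurableSet {y : M | (D n).1 ≤ s ∧ edist y x < epsilonSeq δ P k x} :=
      (MeasurableSet.const _).inter (measurableSet_lt (measurable_id.edist measurable_const) measurable_const)
    exact h1 h2
  have hApast : ∀ k n, MeasurableSet[pastSigma (fun i t ω => Y i ω t) s] (A k n) := by
    intro k n
    refine @MeasurableSet.inter _ (pastSigma (fun i t ω => Y i ω t) s) _ _ (hEpast k n)
      (@MeasurableSet.biInter _ _ (pastSigma (fun i t ω => Y i ω t) s) _ _ (to_countable _) fun m _ =>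
      @MeasurableSet.compl _ _ (pastSigma (fun i t ω => Y i ω t) s) (hEpast k m))
  have hle : pastSigma (fun i t ω => Y i ω t) s ≤ mΩ :=
    iSup₂_le fun q _ => (hY'.measurable q.1 q.2).comap_le
  set B : ℕ → ℕ → Set Ω := fun k n => A k n ∩
    (fun ω => jointPath ![X ω, (Φ ω n).toMap] s) ⁻¹' apartSet δ ((2 : ℝ)⁻¹ ^ k) with hB
  -- Markov property at time s: on `A k n` the path n is within ε_k(x) of x, where by definition of
  -- ε_k the conditional probability of being apart is at most 2⁻ᵏ.
  have hBle : ∀ k n, μ (B k n) ≤ 2⁻¹ ^ k * μ (A k n) := by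
    intro k n
    by_cases hn : (D n).1 ≤ s
    swap
    · have : B k n = ∅ := eq_empty_of_forall_notMem fun ω hω => hn hω.1.1.1
      rw [this, measure_empty]
      exact zero_le
    have e : ∀ ω, (fun l => Y ((![none, some n] : Fin 2 → Option ℕ) l) ω) = ![X ω, (Φ ω n).toMap] :=
      fun ω => by
        funext l
        fin_cases l <;> rfl
    have hZ := hY'.isMarkov_jointPath hψ hP (![none, some n] : Fin 2 → Option ℕ) (a := s) (by
      rw [Fin.forall_fin_two]
      exact ⟨le_rfl, hn⟩)
    simp only [e] at hZ
    have hA' : MeasurableSet[pastSigma (fun i t ω => Y i ω t) (s + ((0 : ℝ≥0) : ℝ))] (A k n) := by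
      rw [NNReal.coe_zero, add_zero]
      exact hApast k n
    refine (hZ.measure_inter_preimage_path (fun z => hψ.exists_isMarkovLaw hP hTF3 z) hA'
      (measurableSet_apartSet hδ _)).trans_le ?_
    rw [← setLIntegral_const]
    refine setLIntegral_mono' (hle _ (hApast k n)) fun ω hω => ?_
    have e0 : jointPath ![X ω, (Φ ω n).toMap] s 0 = ![x, (Φ ω n).toMap s] := by
      funext l
      fin_cases l
      · simpa [jointPath] using hX2 ω s le_rfl
      · simp [jointPath]
    rw [e0]
    exact markovLaw_apartSet_le hω.1.2
  have hAd : ∀ k, Pairwise (Function.onFun Disjoint (A k)) := by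
    intro k m n hmn
    refine Set.disjoint_left.2 fun ω h1 h2 => ?_
    rcases lt_or_gt_of_ne hmn with h | h
    · exact mem_iInter₂.1 h2.2 m h h1.1
    · exact mem_iInter₂.1 h1.2 n h h2.1
  have hBk : ∀ k, μ (⋃ n, B k n) ≤ 2⁻¹ ^ k := by
    intro k
    calc μ (⋃ n, B k n) ≤ ∑' n, μ (B k n) := measure_iUnion_le _
      _ ≤ ∑' n, 2⁻¹ ^ k * μ (A k n) := ENNReal.tsum_le_tsum (hBle k)
      _ = 2⁻¹ ^ k * μ (⋃ n, A k n) := by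
        rw [ENNReal.tsum_mul_left, measure_iUnion (hAd k) fun n => hle _ (hApast k n)]
      _ ≤ 2⁻¹ ^ k * 1 := by gcongr; exact prob_le_one
      _ = _ := mul_one _
  have hsum : ∑' k : ℕ, μ (⋃ n, B k n) ≠ ∞ := by
    refine ne_top_of_le_ne_top ?_ (ENNReal.tsum_le_tsum hBk)
    rw [ENNReal.tsum_geometric, ENNReal.one_sub_inv_two, inv_inv]
    simp
  filter_upwards [htame, ae_eventually_notMem hsum, hX3 t hst] with ω hω hev hXt
  rw [← hXt]
  refine hω.Theta_eq_of_tendsto hε hε2 hℓ hst ?_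
  set n : ℕ → ℕ := fun k => approxIndex (epsilonSeq δ P) (Φ ω) s x k with hn
  have hAn : ∀ k, ω ∈ A k (n k) := by
    intro k
    have h1 := hω.approxIndex_spec hε s x k
    rw [hΦ.start_eq] at h1
    refine ⟨h1, mem_iInter₂.2 fun m hm hmE => ?_⟩
    refine Nat.notMem_of_lt_sInf hm ?_
    rw [mem_ofPred_eq, hΦ.start_eq]
    exact hmE
  -- The second entry of `![X ω, X ω]` is irrelevant, since only coordinate 0 is read. It makes the
  -- first argument of δ independent of k.
  have hlim : Tendsto (fun k => δ (coordPath (jointPath ![X ω, X ω] s) 0)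
      (coordPath (jointPath ![X ω, (Φ ω (n k)).toMap] s) 1)) atTop (𝓝 0) := by
    refine squeeze_zero' (Eventually.of_forall fun k => hδ.nonneg _ _) ?_
      (tendsto_pow_atTop_nhds_zero_of_lt_one (r := (2 : ℝ)⁻¹) (by norm_num) (by norm_num))
    filter_upwards [hev] with k hk
    by_contra! hcon
    exact hk (mem_iUnion.2 ⟨n k, hAn k, hcon.le⟩)
  have h := (continuous_eval_const (t - s)).continuousAt.tendsto.comp (hδ.tendsto hlim)
  simp only [Function.comp_def, coordPath_jointPath] at h
  have ets : s + max (t - s) 0 = t := by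
    rw [max_eq_left (by linarith), add_sub_cancel]
  rw [ets] at h
  exact h

end Sequence

end CoalescingFlow

end

/-! ### The main theorem -/

theorem mainTheorem5 {M : Type*} [MetricSpace M] [ProperSpace M] [MeasurableSpace M] [BorelSpace M]
    (V : Set M) (𝓔 : Set (Set M)) (hM : CoalescingFlow.IsMetricGraph V 𝓔)
    (P : (n : ℕ) → ℝ≥0 → Kernel (Fin n → M) (Fin n → M))
    (hP : ∀ n, CoalescingFlow.IsFellerTransition (P n))
    (hTF1 : CoalescingFlow.TF1 P) (hTF2 : CoalescingFlow.TF2 P)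
    (hTF3 : CoalescingFlow.TF3 P) (hTF5 : CoalescingFlow.TF5 V P)
    {Ω : Type*} [MeasurableSpace Ω] (μ : Measure Ω) [IsProbabilityMeasure μ]
    (ψ₀ : ℝ → ℝ → Ω → CoalescingFlow.MeasMap M)
    (hψ₀ : CoalescingFlow.IsStochasticFlow P μ ψ₀)
    (δ : C(ℝ, M) → C(ℝ, M) → ℝ) (hδ : CoalescingFlow.IsCompactOpenDist δ)
    (ℓ : (ℕ → CoalescingFlow.PathSpace M) → CoalescingFlow.PathSpace M)
    (hℓ : CoalescingFlow.IsLimitPointSelection ℓ)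
    (D : ℕ → ℝ × M) (hD : DenseRange D)
    (Φ : Ω → ℕ → CoalescingFlow.PathSpace M)
    (hΦ : CoalescingFlow.IsContinuousSequence μ ψ₀ D Φ) :
    ∃ Ω₀ : Set Ω, MeasurableSet Ω₀ ∧ μ Ω₀ = 1 ∧
      (∀ ω ∈ Ω₀, CoalescingFlow.IsSkeleton (Φ ω)) ∧
      CoalescingFlow.IsStrongMeasurableContinuousModification
        (μ.comap ((↑) : Ω₀ → Ω))
        (fun s t (ω : Ω₀) => ψ₀ s t ω)
        (fun s t (ω : Ω₀) x => CoalescingFlow.theta δ P ℓ Φ s t (ω : Ω) x) := by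
  -- An arbitrary reference point for bounded sets; the sequence `D` provides one.
  set o : M := (D 0).2
  have hε : ∀ k x, 0 < CoalescingFlow.epsilonSeq δ P k x := fun k x => hψ₀.epsilonSeq_pos hP hTF2 hTF3 hδ k x
  have hε2 : ∀ k x, CoalescingFlow.epsilonSeq δ P k x ≤ 2⁻¹ ^ k := fun k x => min_le_left _ _
  have hεm : ∀ k, Measurable (CoalescingFlow.epsilonSeq δ P k) := fun k =>
    hψ₀.measurable_epsilonSeq hP hTF2 hTF3 hδ k
  have htame : ∀ᵐ ω ∂μ, CoalescingFlow.IsTame o (Φ ω) := hΦ.ae_isTame hψ₀ hP hTF2 hTF3 hM hTF5 hD o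
  -- The tame event need not be measurable, so a measurable hull of its complement is removed.
  set Ω₀ : Set Ω := (toMeasurable μ {ω | ¬ CoalescingFlow.IsTame o (Φ ω)})ᶜ with hΩ₀
  have hm : MeasurableSet Ω₀ := (measurableSet_toMeasurable _ _).compl
  have hΩ₀tame : ∀ ω ∈ Ω₀, CoalescingFlow.IsTame o (Φ ω) := fun ω hω => by
    by_contra h
    exact hω (subset_toMeasurable μ {ω | ¬ CoalescingFlow.IsTame o (Φ ω)} h)
  have hΦm : Measurable fun ω : Ω₀ => Φ ω := hΦ.measurable.comp measurable_subtype_coe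
  refine ⟨Ω₀, hm, ?_, fun ω hω => (hΩ₀tame ω hω).isSkeleton, ?_⟩
  · rw [hΩ₀, prob_compl_eq_one_iff (measurableSet_toMeasurable _ _), measure_toMeasurable]
    exact htame
  refine ⟨fun s t _ ω => ?_, fun s t _ x => ?_, fun s ω x => ?_, fun s t hst x => ?_, ?_,
    fun s x ω => ?_, fun s t u hst htu ω => ?_⟩
  · exact CoalescingFlow.measurable_Theta hεm hℓ.1 measurable_const measurable_const measurable_id measurable_const
  · exact CoalescingFlow.measurable_Theta hεm hℓ.1 measurable_const measurable_const measurable_const hΦm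
  · exact (hΩ₀tame ω ω.2).Theta_self hε hε2 hℓ s x
  · have h := hΦ.ae_Theta_eq hψ₀ hP hTF2 hTF3 htame hδ hℓ hst x
    rw [ae_iff, comap_subtype_coe_apply hm]
    refine measure_mono_null ?_ (ae_iff.1 h)
    rintro _ ⟨ω, hω, rfl⟩
    exact hω
  · exact CoalescingFlow.measurable_Theta hεm hℓ.1 (measurable_fst.comp (measurable_subtype_coe.comp measurable_fst))
      (measurable_snd.comp (measurable_subtype_coe.comp measurable_fst))
      (measurable_fst.comp measurable_snd) (hΦm.comp (measurable_snd.comp measurable_snd))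
  · exact (CoalescingFlow.Theta ℓ (CoalescingFlow.epsilonSeq δ P) s x (Φ ω)).toMap.continuous.continuousOn
  · funext x
    exact (hΩ₀tame ω ω.2).Theta_flow hε hε2 hℓ hst htu x
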